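/- Let $0<k_1<k_2$, $\delta>0$ and $f=\dfrac{40(k_2-k_1)}{k_1k_2}$. For $n\ge 2$ and $k_{3,1},k_{3,2}\ge 0$, not both zero, let $L$ be the matrix of the linear diatomic chain $\ddot q=Lq$ of $2n$ unit masses with fixed walls, \begin{align*} \ddot q_1&=-k_{3,1}q_1+k_1(q_2-q_1), & \ddot q_{2m}&=k_1(q_{2m-1}-q_{2m})+k_2(q_{2m+1}-q_{2m}),\\ \ddot q_{2n}&=k_1(q_{2n-1}-q_{2n})-k_{3,2}q_{2n}, & \ddot q_{2m+1}&=k_2(q_{2m}-q_{2m+1})+k_1(q_{2m+2}-q_{2m+1}), \end{align*} for $1\le m\le n-1$. An eigenfrequency is a number $w>0$ such that $-w^2$ is an eigenvalue of $L$; it lies in the optical band if $2k_2<w^2<2k_1+2k_2$. There is $N=N(k_1,k_2,\delta)$ such that the following holds for all $n\ge N$ and all $k_{3,1},k_{3,2}\ge0$, not both zero, with $|k_{3,1}-2k_2|\ge\delta$ and $|k_{3,2}-2k_2|\ge\delta$, for which no eigenfrequency lies above the optical band (every eigenvalue $-s$ of $L$ has $s\le 2k_1+2k_2$). The optical band contains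 an eigenfrequency. Let $\omega^{(1)}$ be the smallest one, with eigenvector $u^{(1)}$. Then there are a unique real sequence $(\omega^{\langle m\rangle})_{m\ge0}$ and a unique sequence $(Q^{\langle m\rangle})_{m\ge0}$ of even, $2\pi$-periodic $C^2$ functions $\mathbb R\to\mathbb R^{2n}$ of mean zero such that $$\omega^{\langle0\rangle}=\omega^{(1)},\qquad Q^{\langle0\rangle}(\tau)=\frac{u^{(1)}}{|u^{(1)}|}\,(e^{i\tau}+e^{-i\tau}),\qquad (Q^{\langle0\rangle},Q^{\langle m\rangle})=0\quad(m\ge1),$$ where $(g,h)=\frac1{2\pi}\int_0^{2\pi}\sum_{j=1}^{2n} g_j(\tau)h_j(\tau)\,d\tau$, and the formal series $$\omega=\sum_{m\ge0}\epsilon^m\omega^{\langle m\rangle},\qquad Q(\tau)=\sum_{m\ge0}\epsilon^{m+1}Q^{\langle m\rangle}(\tau)$$ satisfy $\omega^2Q''=LQ+Q^3$ (entrywise cube) at every order in $\epsilon$. If $0<\epsilon^2<\dfrac1{fn}$, then both series converge absolutely, the second in the norm $\|h\|=(h,h)^{1/2}$ of $L^2_{per}[0,2\pi]$, and their sums are a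 genuine solution: the sum of the second is (represented by) an even $2\pi$-periodic $C^2$ function that satisfies $\omega^2Q''=LQ+Q^3$ with $\omega$ the sum of the first. So the radius of convergence in $\epsilon$ of each series is at least $1/\sqrt{fn}$, a bound of order $1/\sqrt n$. -/

import Mathlib

/-- Stiffness of the spring between the masses `i` and `i + 1` of the diatomic chain. Masses are
numbered from `0`, so mass `i` here is the mass usually numbered `i + 1`. -/
noncomputable def bondStiffness (k₁ k₂ : ℝ) (i : ℕ) : ℝ := if Even i then k₁ else k₂

/-- Stiffness of the spring to the left of mass `i`; mass `0` is tied to the left wall. -/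
noncomputable def leftStiffness (k₁ k₂ k₃₁ : ℝ) (i : ℕ) : ℝ :=
  if i = 0 then k₃₁ else bondStiffness k₁ k₂ (i - 1)

/-- Stiffness of the spring to the right of mass `i`; mass `2n - 1` is tied to the right wall. -/
noncomputable def rightStiffness (n : ℕ) (k₁ k₂ k₃₂ : ℝ) (i : ℕ) : ℝ :=
  if i + 1 = 2 * n then k₃₂ else bondStiffness k₁ k₂ i

/-- The matrix `L` of the linear diatomic chain `q'' = L q` of `2n` unit masses. -/
noncomputable def chainMatrix (n : ℕ) (k₁ k₂ k₃₁ k₃₂ : ℝ) :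
    Matrix (Fin (2 * n)) (Fin (2 * n)) ℝ :=
  Matrix.of fun i j =>
    if i = j then -(leftStiffness k₁ k₂ k₃₁ i + rightStiffness n k₁ k₂ k₃₂ i)
    else if (i : ℕ) + 1 = j then bondStiffness k₁ k₂ i
    else if (j : ℕ) + 1 = i then bondStiffness k₁ k₂ j
    else 0

/-- No eigenfrequency lies above the optical band: every eigenvalue `-s` of `L`
satisfies `s ≤ 2 k₁ + 2 k₂`. -/
def NoFrequencyAboveOpticalBand (n : ℕ) (k₁ k₂ k₃₁ k₃₂ : ℝ) : Prop :=
  ∀ (s : ℝ) (v : Fin (2 * n) → ℝ), v ≠ 0 →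
    (chainMatrix n k₁ k₂ k₃₁ k₃₂).mulVec v = (-s) • v → s ≤ 2 * k₁ + 2 * k₂

/-- `w > 0` is an eigenfrequency of the linear chain inside the optical band
`2 k₂ < w² < 2 k₁ + 2 k₂`, with eigenvector `u`. -/
structure IsOpticalMode (n : ℕ) (k₁ k₂ k₃₁ k₃₂ : ℝ) (w : ℝ) (u : Fin (2 * n) → ℝ) : Prop where
  pos : 0 < w
  ne_zero : u ≠ 0
  eigen : (chainMatrix n k₁ k₂ k₃₁ k₃₂).mulVec u = (-w ^ 2) • u
  lower : 2 * k₂ < w ^ 2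
  upper : w ^ 2 < 2 * k₁ + 2 * k₂

/-- The optical mode nearest the lower edge of the optical band. -/
def IsLowestOpticalMode (n : ℕ) (k₁ k₂ k₃₁ k₃₂ : ℝ) (w : ℝ) (u : Fin (2 * n) → ℝ) : Prop :=
  IsOpticalMode n k₁ k₂ k₃₁ k₃₂ w u ∧
    ∀ (w' : ℝ) (u' : Fin (2 * n) → ℝ), IsOpticalMode n k₁ k₂ k₃₁ k₃₂ w' u' → w ≤ w'

/-- The inner product `(2π)⁻¹ ∫₀^{2π} ∑ⱼ fⱼ(τ) gⱼ(τ) dτ` of `2π`-periodic vector functions. -/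
noncomputable def perInner {d : ℕ} (f g : ℝ → Fin d → ℝ) : ℝ :=
  (2 * Real.pi)⁻¹ * ∫ τ in (0 : ℝ)..(2 * Real.pi), ∑ j, f τ j * g τ j

/-- The norm of `L²_per[0, 2π]` that belongs to `perInner`. -/
noncomputable def perNorm {d : ℕ} (f : ℝ → Fin d → ℝ) : ℝ := Real.sqrt (perInner f f)

/-- The triples of natural numbers with sum `m`. -/
def triplesWithSum (m : ℕ) : Finset (ℕ × ℕ × ℕ) :=
  (Finset.range (m + 1) ×ˢ Finset.range (m + 1) ×ˢ Finset.range (m + 1)).filter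
    fun p => p.1 + p.2.1 + p.2.2 = m

/-- The triples of natural numbers whose sum plus `2` is `m` (there are none for `m < 2`). -/
def triplesWithSumAddTwo (m : ℕ) : Finset (ℕ × ℕ × ℕ) :=
  (Finset.range (m + 1) ×ˢ Finset.range (m + 1) ×ˢ Finset.range (m + 1)).filter
    fun p => p.1 + p.2.1 + p.2.2 + 2 = m

/-- `ω = ∑ₘ εᵐ ω m` and `Q = ∑ₘ εᵐ⁺¹ Q m` is a formal solution of `ω² Q'' = L Q + Q³` (with the
entrywise cube) that starts from the linear mode `(w, u)`. -/
structure IsFormalExpansion {d : ℕ} (L : Matrix (Fin d) (Fin d) ℝ) (w : ℝ) (u : Fin d → ℝ)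
    (ω : ℕ → ℝ) (Q : ℕ → ℝ → Fin d → ℝ) : Prop where
  contDiff : ∀ m, ContDiff ℝ 2 (Q m)
  periodic : ∀ m, Function.Periodic (Q m) (2 * Real.pi)
  even : ∀ m, Function.Even (Q m)
  /-- There is no constant Fourier mode: `Q m` is a series in `cos (k τ)` with `k ≥ 1`. -/
  mean_zero : ∀ m, ∫ τ in (0 : ℝ)..(2 * Real.pi), Q m τ = 0
  freq_zero : ω 0 = w
  /-- The leading term is `(u / |u|) (e^{iτ} + e^{-iτ})`. -/
  state_zero : ∀ τ, Q 0 τ = (2 * Real.cos τ / Real.sqrt (∑ j, u j ^ 2)) • u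
  /-- The later terms have no component along the leading one. -/
  orthogonal : ∀ m, 1 ≤ m → perInner (Q 0) (Q m) = 0
  /-- The coefficients of `ε ^ (m + 1)` on both sides of the equation agree. -/
  order : ∀ m τ,
    ∑ p ∈ triplesWithSum m, (ω p.1 * ω p.2.1) • iteratedDeriv 2 (Q p.2.2) τ =
      L.mulVec (Q m τ) + ∑ p ∈ triplesWithSumAddTwo m, Q p.1 τ * Q p.2.1 τ * Q p.2.2 τ

/-- `q` is a `2π`-periodic `C²` solution, even in time, of `w² q'' = L q + q³`. -/
structure IsEvenPeriodicSolution {d : ℕ} (L : Matrix (Fin d) (Fin d) ℝ) (w : ℝ)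
    (q : ℝ → Fin d → ℝ) : Prop where
  contDiff : ContDiff ℝ 2 q
  periodic : Function.Periodic q (2 * Real.pi)
  even : Function.Even q
  equation : ∀ τ, w ^ 2 • iteratedDeriv 2 q τ = L.mulVec (q τ) + q τ ^ 3

/-! ### Convolution sums and scalar majorants -/

section Combinatorics

open Finset

/-! The expansion is a Poincaré–Lindstedt series, and its convergence is a majorant argument resting
on one quantitative bound for the linearized operator.

Formal part. Every `Q m` is a polynomial in cosines of odd multiples of `τ`. Let `λ` be the power
series of `ω²` and `e` the normalized mode. At harmonic `k`, order `m` asks for `v` with `(k² w² +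
L) v` equal to minus the cubic terms, minus `k² λ_j Q_{m-j}` for `1 ≤ j < m`, minus `k² λ_m Q_0`.
For `k = 1` the operator has kernel spanned by `e`: solvability fixes `λ_m` and orthogonality fixes
`v`. For `k ≥ 2` there are no small divisors, because `k² w² > 8 k₂` while the absolute row sums of
`L` are at most `5 k₂` (`norm_le_of_higher_harmonic`). The recursion is `exists_coefficients`;
`exists_sqrt_series` recovers `ω` from `λ`; uniqueness is the same linear algebra applied to cosine
coefficients.

Majorant. Take a norm `ν` on vectors with `ν(abc) ≤ ν(a)ν(b)ν(c)`, an inverse bounded by `g`, and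
`|x·e| ≤ ℓ ν(x)`. If `g ε² (2ν(e) + s)³ (1 + ℓ s / 2) ≤ s`, then the terms of order `m ≥ 1` have
total norm at most `s` (`majorant_bound`). With `g ~ n²`, `ν(e) ~ s ~ n^(-1/2)` and `ℓ ~ n^(1/2)`,
this is a condition `ε² ≲ 1/n`. The explicit constant `f` requires good leading constants in `ν(e)`
and `g`.

The mode. Near the lower edge of the optical band a mode is the sign pattern `+ + - -` times a
slowly varying envelope. With `D = w² - k₁ - k₂` the dispersion relation is `D² = k₁² + k₂² - 2 k₁
k₂ cos φ`. The right wall gives a characteristic equation whose leading part is a multiple of `sin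
(n φ)`; the multiple stays away from zero because both wall springs stay away from `2 k₂`. Hence the
lowest mode has `n φ = π + O(1/n)`, its envelope is close to `A sin (m φ + α)` on both sublattices,
and the sup norm of `e` is at most about `1/√n` (`lowestOpticalMode_estimates`).

The inverse at resonance. Eliminating one sublattice leaves `y (l+2) - 2 cos φ y (l+1) + y l = F l`,
whose Green function `sin ((m-l) φ) / sin φ` is of size `n/π`; summing over the chain gives `n²`. If
the envelope of the forcing varies slowly, `F` is close to `c = 2 (k₂ - k₁) / (k₁ k₂)` times the
forcing, which is why `f = 20 c`. Rough forcing would lose the factor `k₂ - k₁`, so the norm used is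
`‖v‖ + γ Lip v`, with `Lip` the variation of the envelope and `γ = n / K`. Inverting gains a power
of `n` on `Lip`, so both parts fit under `g = 0.45 c n²` (`resonant_solution_bounds`,
`exists_modeExpansion`). -/

theorem mem_triplesWithSum {m : ℕ} {p : ℕ × ℕ × ℕ} :
    p ∈ triplesWithSum m ↔ p.1 + p.2.1 + p.2.2 = m := by
  simp only [triplesWithSum, mem_filter, mem_product, mem_range]
  omega

theorem mem_triplesWithSumAddTwo {m : ℕ} {p : ℕ × ℕ × ℕ} :
    p ∈ triplesWithSumAddTwo m ↔ p.1 + p.2.1 + p.2.2 + 2 = m := by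
  simp only [triplesWithSumAddTwo, mem_filter, mem_product, mem_range]
  omega

/-- A sequence may be defined by prescribing each term through the earlier ones. -/
theorem exists_strong_recursion {A : Type*} [Nonempty A] (Φ : ℕ → (ℕ → A) → A)
    (hΦ : ∀ m Q Q', (∀ i < m, Q i = Q' i) → Φ m Q = Φ m Q') : ∃ Q : ℕ → A, ∀ m, Q m = Φ m Q := by
  classical
  obtain ⟨a⟩ := ‹Nonempty A›
  let Q : ℕ → A := WellFoundedLT.fix (motive := fun _ => A)
    (fun m ih => Φ m fun i => if h : i < m then ih i h else a)
  refine ⟨Q, fun m => ?_⟩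
  have : Q m = Φ m fun i => if i < m then Q i else a := WellFoundedLT.fix_eq _ m
  rw [this]
  refine hΦ _ _ _ fun i hi => ?_
  simp [hi]

/-- Turns a product of absolutely convergent series, summed over all index triples, into a series
summed order by order. -/
theorem HasSum.sum_fiber {ι E : Type*} [NormedAddCommGroup E] [CompleteSpace E] {F : ι → E} {S : E}
    (hF : HasSum F S) (g : ι → ℕ) (T : ℕ → Finset ι) (hT : ∀ m p, p ∈ T m ↔ g p = m) :
    HasSum (fun m => ∑ p ∈ T m, F p) S := by
  have h := hF.tsum_fiberwise g
  convert h using 2 with m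
  have : g ⁻¹' {m} = (T m : Set ι) := by
    ext p
    simp [hT]
  rw [this, Finset.tsum_subtype']

theorem HasSum.triplesWithSum {E : Type*} [NormedAddCommGroup E] [CompleteSpace E]
    {F : ℕ × ℕ × ℕ → E} {S : E} (hF : HasSum F S) :
    HasSum (fun m => ∑ p ∈ triplesWithSum m, F p) S :=
  hF.sum_fiber (fun p => p.1 + p.2.1 + p.2.2) _ fun _ _ => mem_triplesWithSum

theorem HasSum.triplesWithSumAddTwo {E : Type*} [NormedAddCommGroup E] [CompleteSpace E]
    {F : ℕ × ℕ × ℕ → E} {S : E} (hF : HasSum F S) :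
    HasSum (fun m => ∑ p ∈ triplesWithSumAddTwo m, F p) S :=
  hF.sum_fiber (fun p => p.1 + p.2.1 + p.2.2 + 2) _ fun _ _ => mem_triplesWithSumAddTwo

/-- Associating the two frequency factors first lets the recursion be run with the coefficients of
`ω²` alone; `ω` is extracted only afterwards. -/
theorem sum_triplesWithSum {E : Type*} [AddCommMonoid E] (F : ℕ → ℕ → ℕ → E) (m : ℕ) :
    ∑ p ∈ triplesWithSum m, F p.1 p.2.1 p.2.2 =
      ∑ q ∈ antidiagonal m, ∑ r ∈ antidiagonal q.1, F r.1 r.2 q.2 := by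
  rw [Finset.sum_sigma']
  refine Finset.sum_bij' (fun p _ => ⟨(p.1 + p.2.1, p.2.2), (p.1, p.2.1)⟩)
    (fun q _ => (q.2.1, q.2.2, q.1.2)) ?_ ?_ ?_ ?_ ?_
  · intro p hp
    simpa [mem_triplesWithSum] using hp
  · rintro ⟨⟨a, b⟩, ⟨c, d⟩⟩ h
    simp only [mem_sigma, HasAntidiagonal.mem_antidiagonal] at h
    rw [mem_triplesWithSum]
    simp only
    omega
  · intro p _
    rfl
  · rintro ⟨⟨a, b⟩, ⟨c, d⟩⟩ h
    simp only [mem_sigma, HasAntidiagonal.mem_antidiagonal] at h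
    obtain ⟨_, rfl⟩ := h
    rfl
  · intro p _
    rfl

/-- A triple of total order at most `M` after the shift by two has all its indices below `M`, so its
product already occurs in the cube of the truncated sum; the shift is the factor `r ^ 2`. -/
theorem sum_triplesWithSumAddTwo_le {x : ℕ → ℝ} (hx : ∀ m, 0 ≤ x m) {r : ℝ} (hr : 0 ≤ r) (M : ℕ) :
    ∑ m ∈ Ico 1 (M + 1), (∑ p ∈ triplesWithSumAddTwo m, x p.1 * x p.2.1 * x p.2.2) * r ^ m ≤
      r ^ 2 * (∑ m ∈ range M, x m * r ^ m) ^ 3 := by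
  have e : r ^ 2 * (∑ m ∈ range M, x m * r ^ m) ^ 3 =
      ∑ p ∈ range M ×ˢ range M ×ˢ range M,
        x p.1 * x p.2.1 * x p.2.2 * r ^ (p.1 + p.2.1 + p.2.2 + 2) := by
    rw [pow_three, Finset.sum_mul_sum, Finset.sum_product, Finset.sum_mul_sum, Finset.mul_sum]
    refine Finset.sum_congr rfl fun a _ => ?_
    rw [Finset.sum_product, Finset.mul_sum]
    refine Finset.sum_congr rfl fun b _ => ?_
    rw [Finset.mul_sum, Finset.mul_sum]
    refine Finset.sum_congr rfl fun c _ => ?_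
    ring
  have e2 : ∑ m ∈ Ico 1 (M + 1),
      (∑ p ∈ triplesWithSumAddTwo m, x p.1 * x p.2.1 * x p.2.2) * r ^ m =
      ∑ p ∈ (range M ×ˢ range M ×ˢ range M).filter fun p => p.1 + p.2.1 + p.2.2 + 2 < M + 1,
        x p.1 * x p.2.1 * x p.2.2 * r ^ (p.1 + p.2.1 + p.2.2 + 2) := by
    simp_rw [Finset.sum_mul]
    rw [← Finset.sum_fiberwise_of_maps_to (s := Finset.filter _ _) (t := Ico 1 (M + 1))
      (g := fun p : ℕ × ℕ × ℕ => p.1 + p.2.1 + p.2.2 + 2)]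
    · refine Finset.sum_congr rfl fun m hm => ?_
      rw [mem_Ico] at hm
      refine Finset.sum_congr ?_ fun p hp => ?_
      · ext p
        simp only [mem_triplesWithSumAddTwo, mem_filter, mem_product, mem_range]
        omega
      · rw [mem_filter] at hp
        rw [hp.2]
    · intro p hp
      simp only [mem_filter, mem_Ico] at hp ⊢
      omega
  rw [e, e2]
  refine Finset.sum_le_sum_of_subset_of_nonneg (filter_subset _ _) fun p _ _ => ?_
  have := hx p.1
  have := hx p.2.1
  have := hx p.2.2
  positivity

theorem sum_Ico_convolution_le {x l : ℕ → ℝ} (hx : ∀ m, 0 ≤ x m) (hl : ∀ m, 0 ≤ l m) {r : ℝ}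
    (hr : 0 ≤ r) (M : ℕ) :
    ∑ m ∈ Ico 1 (M + 1), (∑ j ∈ Ico 1 m, l j * x (m - j)) * r ^ m ≤
      (∑ m ∈ Ico 1 M, l m * r ^ m) * ∑ m ∈ Ico 1 M, x m * r ^ m := by
  rw [Finset.sum_mul_sum, ← Finset.sum_product']
  simp_rw [Finset.sum_mul]
  rw [Finset.sum_sigma']
  have hinj : Set.InjOn (fun q : (_ : ℕ) × ℕ => (q.2, q.1 - q.2))
      ((Ico 1 (M + 1)).sigma fun m => Ico 1 m : Finset ((_ : ℕ) × ℕ)) := by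
    rintro ⟨a, b⟩ h ⟨c, d⟩ h' e
    simp only [coe_sigma, Set.mem_sigma_iff, mem_coe, mem_Ico, Prod.mk.injEq] at h h' e
    obtain ⟨rfl, e⟩ := e
    have : a = c := by omega
    subst this
    rfl
  have : ∑ q ∈ (Ico 1 (M + 1)).sigma fun m => Ico 1 m, l q.2 * x (q.1 - q.2) * r ^ q.1 =
      ∑ p ∈ ((Ico 1 (M + 1)).sigma fun m => Ico 1 m).image
        (fun q : (_ : ℕ) × ℕ => (q.2, q.1 - q.2)), l p.1 * r ^ p.1 * (x p.2 * r ^ p.2) := by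
    rw [Finset.sum_image hinj]
    refine Finset.sum_congr rfl fun q hq => ?_
    simp only [mem_sigma, mem_Ico] at hq
    have : r ^ q.1 = r ^ q.2 * r ^ (q.1 - q.2) := by
      rw [← pow_add]
      congr 1
      omega
    rw [this]
    ring
  rw [this]
  refine Finset.sum_le_sum_of_subset_of_nonneg ?_ fun p _ _ => ?_
  · intro p hp
    simp only [mem_image, mem_sigma, mem_Ico, mem_product] at hp ⊢
    obtain ⟨q, hq, rfl⟩ := hp
    simp only
    omega
  · have := hx p.2
    have := hl p.1
    positivity

/-- The majorant estimate for the coefficients of the expansion. -/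
theorem majorant_bound {x l : ℕ → ℝ} (hx : ∀ m, 0 ≤ x m) (hl : ∀ m, 0 ≤ l m) {g c B s r : ℝ}
    (hg : 0 ≤ g) (hc : 0 ≤ c) (hr : 0 ≤ r) (hs0 : 0 ≤ s) (hx0 : x 0 ≤ B)
    (hlm : ∀ m, 1 ≤ m → l m ≤ c * ∑ p ∈ triplesWithSumAddTwo m, x p.1 * x p.2.1 * x p.2.2)
    (hxm : ∀ m, 1 ≤ m → x m ≤ g * (∑ p ∈ triplesWithSumAddTwo m, x p.1 * x p.2.1 * x p.2.2 +
      ∑ j ∈ Ico 1 m, l j * x (m - j)))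
    (hs : g * (r ^ 2 * (B + s) ^ 3 + c * (r ^ 2 * (B + s) ^ 3) * s) ≤ s) (M : ℕ) :
    ∑ m ∈ Ico 1 M, x m * r ^ m ≤ s ∧
      ∑ m ∈ Ico 1 M, l m * r ^ m ≤ c * (r ^ 2 * (B + s) ^ 3) := by
  have hB : 0 ≤ B := (hx 0).trans hx0
  -- The bounds at order `m` involve only orders below `m`, so sums truncated at `M + 1` are
  -- controlled by those truncated at `M`. The hypothesis `hs` says that the interval `[0, s]` is
  -- mapped to itself.
  induction M with
  | zero => simp; constructor <;> positivity
  | succ M ih =>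
    have h0 : ∑ m ∈ range M, x m * r ^ m ≤ B + s := by
      rcases Nat.eq_zero_or_pos M with rfl | hM
      · simp; positivity
      · rw [Finset.range_eq_Ico, Finset.sum_eq_sum_Ico_succ_bot hM]
        simpa using add_le_add hx0 ih.1
    have h0' : 0 ≤ ∑ m ∈ range M, x m * r ^ m :=
      Finset.sum_nonneg fun m _ => mul_nonneg (hx m) (pow_nonneg hr m)
    have h1 : ∑ m ∈ Ico 1 (M + 1),
        (∑ p ∈ triplesWithSumAddTwo m, x p.1 * x p.2.1 * x p.2.2) * r ^ m ≤
          r ^ 2 * (B + s) ^ 3 := (sum_triplesWithSumAddTwo_le hx hr M).trans (by gcongr)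
    have h2 : ∑ m ∈ Ico 1 (M + 1), (∑ j ∈ Ico 1 m, l j * x (m - j)) * r ^ m ≤
        c * (r ^ 2 * (B + s) ^ 3) * s := by
      refine (sum_Ico_convolution_le hx hl hr M).trans ?_
      refine mul_le_mul ih.2 ih.1 (Finset.sum_nonneg fun m _ => mul_nonneg (hx m) (pow_nonneg hr m))
        (by positivity)
    constructor
    · calc ∑ m ∈ Ico 1 (M + 1), x m * r ^ m
          ≤ ∑ m ∈ Ico 1 (M + 1),
            g * (∑ p ∈ triplesWithSumAddTwo m, x p.1 * x p.2.1 * x p.2.2 +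
              ∑ j ∈ Ico 1 m, l j * x (m - j)) * r ^ m := by
            refine Finset.sum_le_sum fun m hm => ?_
            exact mul_le_mul_of_nonneg_right (hxm m (mem_Ico.1 hm).1) (pow_nonneg hr m)
        _ = g * (∑ m ∈ Ico 1 (M + 1),
            (∑ p ∈ triplesWithSumAddTwo m, x p.1 * x p.2.1 * x p.2.2) * r ^ m +
              ∑ m ∈ Ico 1 (M + 1), (∑ j ∈ Ico 1 m, l j * x (m - j)) * r ^ m) := by
            rw [← Finset.sum_add_distrib, Finset.mul_sum]
            refine Finset.sum_congr rfl fun m _ => ?_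
            ring
        _ ≤ _ := (mul_le_mul_of_nonneg_left (add_le_add h1 h2) hg).trans hs
    · calc ∑ m ∈ Ico 1 (M + 1), l m * r ^ m
          ≤ ∑ m ∈ Ico 1 (M + 1),
            c * (∑ p ∈ triplesWithSumAddTwo m, x p.1 * x p.2.1 * x p.2.2) * r ^ m := by
            refine Finset.sum_le_sum fun m hm => ?_
            exact mul_le_mul_of_nonneg_right (hlm m (mem_Ico.1 hm).1) (pow_nonneg hr m)
        _ = c * ∑ m ∈ Ico 1 (M + 1),
            (∑ p ∈ triplesWithSumAddTwo m, x p.1 * x p.2.1 * x p.2.2) * r ^ m := by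
            rw [Finset.mul_sum]
            refine Finset.sum_congr rfl fun m _ => ?_
            ring
        _ ≤ _ := mul_le_mul_of_nonneg_left h1 hc

theorem summable_of_sum_Ico_le {x : ℕ → ℝ} (hx : ∀ m, 0 ≤ x m) {s : ℝ}
    (h : ∀ M, ∑ m ∈ Ico 1 M, x m ≤ s) : Summable x := by
  refine summable_of_sum_range_le (c := x 0 + s) hx fun M => ?_
  rcases Nat.eq_zero_or_pos M with rfl | hM
  · have := h 0
    have := hx 0
    simp at *
    linarith
  · rw [Finset.range_eq_Ico, Finset.sum_eq_sum_Ico_succ_bot hM]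
    simpa using h M

/-- Coefficients of the square root of the power series with coefficients `l`, `l 0 = w ^ 2`. -/
theorem exists_sqrt_series {w : ℝ} (hw : 0 < w) (l : ℕ → ℝ) (hl : l 0 = w ^ 2) :
    ∃ ω : ℕ → ℝ, ω 0 = w ∧ (∀ m, ∑ q ∈ antidiagonal m, ω q.1 * ω q.2 = l m) ∧
      ∀ r : ℝ, 0 ≤ r → (∀ M, ∑ m ∈ Ico 1 M, |l m| * r ^ m ≤ w ^ 2) →
        Summable fun m => |ω m| * r ^ m := by
  obtain ⟨ω, hω⟩ := exists_strong_recursion (A := ℝ)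
    (fun m ω => if m = 0 then w else (l m - ∑ j ∈ Ico 1 m, ω j * ω (m - j)) / (2 * w)) (by
      intro m Q Q' h
      split_ifs with hm
      · rfl
      · congr 2
        refine Finset.sum_congr rfl fun j hj => ?_
        rw [mem_Ico] at hj
        rw [h j hj.2, h (m - j) (by omega)])
  have h0 : ω 0 = w := by rw [hω]; simp
  have hm : ∀ m, 1 ≤ m → 2 * w * ω m = l m - ∑ j ∈ Ico 1 m, ω j * ω (m - j) := by
    intro m hm
    have := hω m
    rw [if_neg (by omega)] at this
    rw [this]
    field_simp
  refine ⟨ω, h0, fun m => ?_, fun r hr hM => ?_⟩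
  · rcases Nat.eq_zero_or_pos m with rfl | h
    · simp [h0, hl, sq]
    · rw [Finset.Nat.sum_antidiagonal_eq_sum_range_succ (fun a b => ω a * ω b),
        Finset.sum_range_succ, Finset.range_eq_Ico, Finset.sum_eq_sum_Ico_succ_bot h]
      have := hm m h
      simp only [Nat.sub_zero, Nat.sub_self, h0, zero_add]
      linarith
  -- With `S` the truncated sum, the recursion gives `2 w S_new ≤ w² + S²`. The value `S = w` is the
  -- double root of `2 w S = w² + S²`, so the bound `w` propagates.
  · refine summable_of_sum_Ico_le (s := w) (fun m => by positivity) fun M => ?_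
    induction M with
    | zero => simpa using hw.le
    | succ M ih =>
      have h1 : ∀ m ∈ Ico 1 (M + 1), |ω m| * r ^ m ≤ (2 * w)⁻¹ * (|l m| * r ^ m +
          (∑ j ∈ Ico 1 m, |ω j| * |ω (m - j)|) * r ^ m) := by
        intro m hm'
        rw [mem_Ico] at hm'
        have e := hm m hm'.1
        have : 2 * w * |ω m| ≤ |l m| + ∑ j ∈ Ico 1 m, |ω j| * |ω (m - j)| := by
          rw [← abs_of_pos (show 0 < 2 * w by positivity), ← abs_mul, e]
          refine (abs_sub _ _).trans (add_le_add_right ?_ _)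
          refine (Finset.abs_sum_le_sum_abs _ _).trans (le_of_eq ?_)
          simp_rw [abs_mul]
        have h3 := mul_le_mul_of_nonneg_right this (pow_nonneg hr m)
        rw [← add_mul, inv_mul_eq_div, le_div_iff₀ (by positivity)]
        linarith
      refine (Finset.sum_le_sum h1).trans ?_
      rw [← Finset.mul_sum, Finset.sum_add_distrib, inv_mul_le_iff₀ (by positivity)]
      have h2 := sum_Ico_convolution_le (x := fun m => |ω m|) (l := fun m => |ω m|)
        (fun _ => abs_nonneg _) (fun _ => abs_nonneg _) hr M
      have h3 : (∑ m ∈ Ico 1 M, |ω m| * r ^ m) * (∑ m ∈ Ico 1 M, |ω m| * r ^ m) ≤ w * w :=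
        mul_le_mul ih ih (Finset.sum_nonneg fun m _ => by positivity) hw.le
      have := hM (M + 1)
      linarith

end Combinatorics

/-! ### Cosine polynomials with vector coefficients and their norms -/

section CosinePolynomials

variable {d : ℕ}

/-- The cosine polynomial `∑ k, cos (k τ) p k` with vector coefficients, at the point `τ`. -/
noncomputable def cosEval (τ : ℝ) : (ℕ →₀ (Fin d → ℝ)) →ₗ[ℝ] (Fin d → ℝ) :=
  Finsupp.lsum ℝ fun k : ℕ => Real.cos (k * τ) • LinearMap.id

theorem cosEval_apply (τ : ℝ) (p : ℕ →₀ (Fin d → ℝ)) :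
    cosEval τ p = ∑ k ∈ p.support, Real.cos (k * τ) • p k := by
  simp [cosEval, Finsupp.sum]

theorem cosEval_single (τ : ℝ) (k : ℕ) (c : Fin d → ℝ) :
    cosEval τ (Finsupp.single k c) = Real.cos (k * τ) • c := by
  simp [cosEval]

theorem cosEval_even (p : ℕ →₀ (Fin d → ℝ)) : Function.Even fun τ => cosEval τ p := by
  intro τ
  simp [cosEval_apply]

theorem cosEval_periodic (p : ℕ →₀ (Fin d → ℝ)) :
    Function.Periodic (fun τ => cosEval τ p) (2 * Real.pi) := by
  intro τ
  simp only [cosEval_apply]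
  refine Finset.sum_congr rfl fun k _ => ?_
  rw [mul_add, Real.cos_add_nat_mul_two_pi]

/-- The derivative of a cosine polynomial. -/
noncomputable def cosEvalDeriv (τ : ℝ) (p : ℕ →₀ (Fin d → ℝ)) : Fin d → ℝ :=
  ∑ k ∈ p.support, (-(Real.sin (k * τ) * k)) • p k

/-- Multiplication of the `k`-th coefficient by `k ^ 2`. -/
noncomputable def cosLaplacian (p : ℕ →₀ (Fin d → ℝ)) : ℕ →₀ (Fin d → ℝ) :=
  Finsupp.onFinset p.support (fun k => ((k : ℝ) ^ 2) • p k) fun k hk => by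
    rw [Finsupp.mem_support_iff]
    rintro h
    simp [h] at hk

theorem cosLaplacian_apply (p : ℕ →₀ (Fin d → ℝ)) (k : ℕ) :
    cosLaplacian p k = ((k : ℝ) ^ 2) • p k := rfl

theorem cosLaplacian_support (p : ℕ →₀ (Fin d → ℝ)) : (cosLaplacian p).support ⊆ p.support :=
  Finsupp.support_onFinset_subset

theorem cosEval_eq_sum_of_subset (τ : ℝ) {p : ℕ →₀ (Fin d → ℝ)} {s : Finset ℕ}
    (h : p.support ⊆ s) : cosEval τ p = ∑ k ∈ s, Real.cos (k * τ) • p k := by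
  rw [cosEval_apply]
  refine Finset.sum_subset h fun k _ hk => ?_
  rw [Finsupp.notMem_support_iff.1 hk, smul_zero]

theorem hasDerivAt_cosEval (p : ℕ →₀ (Fin d → ℝ)) (τ : ℝ) :
    HasDerivAt (fun τ => cosEval τ p) (cosEvalDeriv τ p) τ := by
  simp only [cosEval_apply, cosEvalDeriv]
  refine HasDerivAt.fun_sum fun k _ => ?_
  refine HasDerivAt.smul_const ?_ _
  have h1 : HasDerivAt (fun x : ℝ => (k : ℝ) * x) k τ := by
    simpa using (hasDerivAt_id τ).const_mul (k : ℝ)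
  have h2 := (Real.hasDerivAt_cos ((k : ℝ) * τ)).comp τ h1
  rw [neg_mul] at h2
  exact h2

theorem hasDerivAt_cosEvalDeriv (p : ℕ →₀ (Fin d → ℝ)) (τ : ℝ) :
    HasDerivAt (fun τ => cosEvalDeriv τ p) (-cosEval τ (cosLaplacian p)) τ := by
  rw [cosEval_eq_sum_of_subset τ (cosLaplacian_support p), ← Finset.sum_neg_distrib]
  simp only [cosEvalDeriv]
  refine HasDerivAt.fun_sum fun k _ => ?_
  have h1 : HasDerivAt (fun x : ℝ => (k : ℝ) * x) k τ := by
    simpa using (hasDerivAt_id τ).const_mul (k : ℝ)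
  have h2 := ((((Real.hasDerivAt_sin _).comp τ h1).mul_const (k : ℝ)).fun_neg).smul_const (p k)
  refine h2.congr_deriv ?_
  rw [cosLaplacian_apply, smul_smul, ← neg_smul]
  congr 1
  ring

theorem continuous_cosEval (p : ℕ →₀ (Fin d → ℝ)) : Continuous fun τ => cosEval τ p :=
  continuous_iff_continuousAt.2 fun τ => (hasDerivAt_cosEval p τ).continuousAt

theorem iteratedDeriv_two_of_hasDerivAt {E : Type*} [NormedAddCommGroup E] [NormedSpace ℝ E]
    {f f' f'' : ℝ → E} (h : ∀ x, HasDerivAt f (f' x) x) (h' : ∀ x, HasDerivAt f' (f'' x) x)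
    (x : ℝ) : iteratedDeriv 2 f x = f'' x := by
  have e : deriv f = f' := funext fun x => (h x).deriv
  rw [iteratedDeriv_succ, iteratedDeriv_one, e, (h' x).deriv]

theorem contDiff_two_of_hasDerivAt {E : Type*} [NormedAddCommGroup E] [NormedSpace ℝ E]
    {f f' f'' : ℝ → E} (h : ∀ x, HasDerivAt f (f' x) x) (h' : ∀ x, HasDerivAt f' (f'' x) x)
    (h'' : Continuous f'') : ContDiff ℝ 2 f := by
  have e : deriv f = f' := funext fun x => (h x).deriv
  have e' : deriv f' = f'' := funext fun x => (h' x).deriv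
  rw [show (2 : WithTop ℕ∞) = 1 + 1 by norm_num, contDiff_succ_iff_deriv]
  refine ⟨fun x => (h x).differentiableAt, by simp, ?_⟩
  rw [e, contDiff_one_iff_deriv, e']
  exact ⟨fun x => (h' x).differentiableAt, h''⟩

theorem iteratedDeriv_cosEval (p : ℕ →₀ (Fin d → ℝ)) (τ : ℝ) :
    iteratedDeriv 2 (fun τ => cosEval τ p) τ = -cosEval τ (cosLaplacian p) :=
  iteratedDeriv_two_of_hasDerivAt (hasDerivAt_cosEval p) (hasDerivAt_cosEvalDeriv p) τ

theorem contDiff_cosEval (p : ℕ →₀ (Fin d → ℝ)) : ContDiff ℝ 2 fun τ => cosEval τ p :=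
  contDiff_two_of_hasDerivAt (hasDerivAt_cosEval p) (hasDerivAt_cosEvalDeriv p)
    (continuous_cosEval _).neg

/-- The product `cos (i τ) cos (j τ) cos (l τ) c` as a cosine polynomial. -/
noncomputable def cosTriple (i j l : ℕ) (c : Fin d → ℝ) : ℕ →₀ (Fin d → ℝ) :=
  Finsupp.single (i + j + l) ((1 / 4 : ℝ) • c) +
  Finsupp.single ((i : ℤ) + j - l).natAbs ((1 / 4 : ℝ) • c) +
  Finsupp.single ((i : ℤ) - j + l).natAbs ((1 / 4 : ℝ) • c) +
  Finsupp.single (-(i : ℤ) + j + l).natAbs ((1 / 4 : ℝ) • c)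

/-- The entrywise product of three cosine polynomials. -/
noncomputable def cosMul (p q r : ℕ →₀ (Fin d → ℝ)) : ℕ →₀ (Fin d → ℝ) :=
  ∑ i ∈ p.support, ∑ j ∈ q.support, ∑ l ∈ r.support, cosTriple i j l (p i * q j * r l)

theorem cos_natAbs_mul (z : ℤ) (τ : ℝ) : Real.cos (z.natAbs * τ) = Real.cos (z * τ) := by
  rw [Nat.cast_natAbs, Int.cast_abs]
  rcases abs_choice (z : ℝ) with h | h <;> rw [h]
  rw [neg_mul, Real.cos_neg]

theorem cosEval_cosTriple (τ : ℝ) (i j l : ℕ) (c : Fin d → ℝ) :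
    cosEval τ (cosTriple i j l c) =
      (Real.cos (i * τ) * Real.cos (j * τ) * Real.cos (l * τ)) • c := by
  simp only [cosTriple, map_add, cosEval_single, cos_natAbs_mul, smul_smul, ← add_smul]
  congr 1
  push_cast
  simp only [add_mul, sub_mul, neg_mul, Real.cos_add, Real.cos_sub, Real.sin_add, Real.sin_sub,
    Real.cos_neg, Real.sin_neg]
  ring

theorem cosEval_cosMul (τ : ℝ) (p q r : ℕ →₀ (Fin d → ℝ)) :
    cosEval τ (cosMul p q r) = cosEval τ p * cosEval τ q * cosEval τ r := by
  simp only [cosMul, map_sum, cosEval_cosTriple, cosEval_apply τ p, cosEval_apply τ q,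
    cosEval_apply τ r]
  rw [Finset.sum_mul_sum, Finset.sum_mul]
  refine Finset.sum_congr rfl fun i _ => ?_
  rw [Finset.sum_mul]
  refine Finset.sum_congr rfl fun j _ => ?_
  rw [Finset.mul_sum]
  refine Finset.sum_congr rfl fun l _ => ?_
  ext x
  simp only [Pi.smul_apply, Pi.mul_apply, smul_eq_mul]
  ring

/-- Cosine polynomials in which only odd frequencies occur. -/
abbrev oddCos (d : ℕ) : Submodule ℝ (ℕ →₀ (Fin d → ℝ)) :=
  Finsupp.supported (Fin d → ℝ) ℝ {k | Odd k}

/-- A signed sum of three odd numbers is odd. Frequency zero therefore never appears: means vanish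
automatically and `L` itself never has to be inverted. -/
theorem cosMul_mem_oddCos {p q r : ℕ →₀ (Fin d → ℝ)} (hp : p ∈ oddCos d) (hq : q ∈ oddCos d)
    (hr : r ∈ oddCos d) : cosMul p q r ∈ oddCos d := by
  rw [Finsupp.mem_supported] at hp hq hr
  refine Submodule.sum_mem _ fun i hi => Submodule.sum_mem _ fun j hj =>
    Submodule.sum_mem _ fun l hl => ?_
  have hi := hp hi
  have hj := hq hj
  have hl := hr hl
  simp only [Set.mem_ofPred_eq] at hi hj hl
  have hi' : Odd (i : ℤ) := by exact_mod_cast hi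
  have hj' : Odd (j : ℤ) := by exact_mod_cast hj
  have hl' : Odd (l : ℤ) := by exact_mod_cast hl
  refine Submodule.add_mem _ (Submodule.add_mem _ (Submodule.add_mem _ ?_ ?_) ?_) ?_ <;>
    refine Finsupp.single_mem_supported _ _ ?_ <;> simp only [Set.mem_ofPred_eq, Int.natAbs_odd]
  · exact (hi.add_odd hj).add_odd hl
  · exact (hi'.add_odd hj').sub_odd hl'
  · exact (hi'.sub_odd hj').add_odd hl'
  · exact (hi'.neg.add_odd hj').add_odd hl'

theorem mem_oddCos_of_support_subset {p q : ℕ →₀ (Fin d → ℝ)} (hp : p ∈ oddCos d)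
    (h : q.support ⊆ p.support) : q ∈ oddCos d := by
  rw [Finsupp.mem_supported] at hp ⊢
  exact fun k hk => hp (h hk)

/-- The norm `∑ k, w k * ν (p k)` of a cosine polynomial. -/
noncomputable def cosSeminorm (ν : Seminorm ℝ (Fin d → ℝ)) (w : ℕ → ℝ) (hw : ∀ k, 0 ≤ w k) :
    Seminorm ℝ (ℕ →₀ (Fin d → ℝ)) :=
  Seminorm.of (fun p => p.sum fun k c => w k * ν c)
    (by
      classical
      intro p q
      rw [Finsupp.sum_of_support_subset (p + q) Finsupp.support_add _ (by simp),
        Finsupp.sum_of_support_subset p Finset.subset_union_left _ (by simp),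
        Finsupp.sum_of_support_subset q Finset.subset_union_right _ (by simp),
        ← Finset.sum_add_distrib]
      refine Finset.sum_le_sum fun k _ => ?_
      rw [Finsupp.add_apply, ← mul_add]
      exact mul_le_mul_of_nonneg_left (map_add_le_add ν _ _) (hw k))
    (by
      intro a p
      rw [Finsupp.sum_of_support_subset (a • p) Finsupp.support_smul _ (by simp), Finsupp.sum,
        Finset.mul_sum]
      refine Finset.sum_congr rfl fun k _ => ?_
      rw [Finsupp.smul_apply, map_smul_eq_mul]
      ring)

variable (ν : Seminorm ℝ (Fin d → ℝ)) (w : ℕ → ℝ) (hw : ∀ k, 0 ≤ w k)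

theorem cosSeminorm_apply (p : ℕ →₀ (Fin d → ℝ)) :
    cosSeminorm ν w hw p = ∑ k ∈ p.support, w k * ν (p k) := rfl

theorem cosSeminorm_eq_of_subset {p : ℕ →₀ (Fin d → ℝ)} {s : Finset ℕ} (h : p.support ⊆ s) :
    cosSeminorm ν w hw p = ∑ k ∈ s, w k * ν (p k) :=
  Finsupp.sum_of_support_subset p h (fun k c => w k * ν c) (by simp)

theorem cosSeminorm_single (k : ℕ) (c : Fin d → ℝ) :
    cosSeminorm ν w hw (Finsupp.single k c) = w k * ν c :=
  Finsupp.sum_single_index (h := fun k c => w k * ν c) (by simp)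

theorem le_cosSeminorm (p : ℕ →₀ (Fin d → ℝ)) (k : ℕ) : w k * ν (p k) ≤ cosSeminorm ν w hw p := by
  rw [cosSeminorm_eq_of_subset ν w hw (Finset.subset_insert k p.support)]
  exact Finset.single_le_sum (f := fun k => w k * ν (p k))
    (fun k _ => mul_nonneg (hw k) (apply_nonneg ν _)) (Finset.mem_insert_self _ _)

theorem Seminorm.sum_le {E ι : Type*} [AddCommGroup E] [Module ℝ E] (N : Seminorm ℝ E)
    (s : Finset ι) (f : ι → E) : N (∑ i ∈ s, f i) ≤ ∑ i ∈ s, N (f i) :=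
  Finset.le_sum_of_subadditive N (map_zero N).le (map_add_le_add N) s f

/-- The unweighted norm of cosine polynomials. -/
noncomputable abbrev cosNorm : Seminorm ℝ (ℕ →₀ (Fin d → ℝ)) :=
  cosSeminorm ν (fun _ => 1) fun _ => zero_le_one

/-- The norm of cosine polynomials that controls two derivatives. -/
noncomputable abbrev cosNormTwo : Seminorm ℝ (ℕ →₀ (Fin d → ℝ)) :=
  cosSeminorm ν (fun k => max 1 ((k : ℝ) ^ 2)) fun _ => zero_le_one.trans (le_max_left _ _)

theorem cosNorm_le_cosNormTwo (p : ℕ →₀ (Fin d → ℝ)) : cosNorm ν p ≤ cosNormTwo ν p := by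
  rw [cosSeminorm_apply, cosSeminorm_apply]
  exact Finset.sum_le_sum fun k _ =>
    mul_le_mul_of_nonneg_right (le_max_left _ _) (apply_nonneg ν _)

theorem cosNorm_cosLaplacian_le (p : ℕ →₀ (Fin d → ℝ)) :
    cosNorm ν (cosLaplacian p) ≤ cosNormTwo ν p := by
  rw [cosSeminorm_eq_of_subset _ _ _ (cosLaplacian_support p), cosSeminorm_apply]
  refine Finset.sum_le_sum fun k _ => ?_
  rw [cosLaplacian_apply, map_smul_eq_mul, one_mul, Real.norm_of_nonneg (by positivity)]
  exact mul_le_mul_of_nonneg_right (le_max_right _ _) (apply_nonneg ν _)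

/-- Three cosines multiply to four cosines of weight `1/4`, so passing to harmonics costs no
constant and the bound is inherited from `ν`. -/
theorem cosNorm_cosMul_le (hν : ∀ a b c, ν (a * b * c) ≤ ν a * ν b * ν c)
    (p q r : ℕ →₀ (Fin d → ℝ)) :
    cosNorm ν (cosMul p q r) ≤ cosNorm ν p * cosNorm ν q * cosNorm ν r := by
  have h3 : ∀ i j l (c : Fin d → ℝ), cosNorm ν (cosTriple i j l c) ≤ ν c := by
    intro i j l c
    have h4 : ∀ k, cosNorm ν (Finsupp.single k ((1 / 4 : ℝ) • c)) = 1 / 4 * ν c := by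
      intro k
      rw [cosSeminorm_single, map_smul_eq_mul, one_mul]
      norm_num
    refine (map_add_le_add (cosNorm ν) _ _).trans ?_
    rw [h4]
    have h5 := map_add_le_add (cosNorm ν)
      (Finsupp.single (i + j + l) ((1 / 4 : ℝ) • c) +
        Finsupp.single ((i : ℤ) + j - l).natAbs ((1 / 4 : ℝ) • c))
      (Finsupp.single ((i : ℤ) - j + l).natAbs ((1 / 4 : ℝ) • c))
    have h6 := map_add_le_add (cosNorm ν) (Finsupp.single (i + j + l) ((1 / 4 : ℝ) • c))
      (Finsupp.single ((i : ℤ) + j - l).natAbs ((1 / 4 : ℝ) • c))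
    rw [h4] at h5
    rw [h4, h4] at h6
    linarith
  simp only [cosSeminorm_apply ν _ _ p, cosSeminorm_apply ν _ _ q, cosSeminorm_apply ν _ _ r]
  rw [Finset.sum_mul_sum, Finset.sum_mul]
  refine (Seminorm.sum_le _ _ _).trans (Finset.sum_le_sum fun i _ => ?_)
  rw [Finset.sum_mul]
  refine (Seminorm.sum_le _ _ _).trans (Finset.sum_le_sum fun j _ => ?_)
  rw [Finset.mul_sum]
  refine (Seminorm.sum_le _ _ _).trans (Finset.sum_le_sum fun l _ => ?_)
  simpa using (h3 i j l _).trans (hν (p i) (q j) (r l))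

variable {ν}

theorem norm_cosEval_le (hν : ∀ x, ‖x‖ ≤ ν x) (p : ℕ →₀ (Fin d → ℝ)) (τ : ℝ) :
    ‖cosEval τ p‖ ≤ cosNorm ν p := by
  rw [cosEval_apply, cosSeminorm_apply]
  refine norm_sum_le_of_le _ fun k _ => ?_
  rw [norm_smul]
  exact mul_le_mul (Real.abs_cos_le_one _) (hν _) (norm_nonneg _) zero_le_one

theorem norm_cosEvalDeriv_le (hν : ∀ x, ‖x‖ ≤ ν x) (p : ℕ →₀ (Fin d → ℝ)) (τ : ℝ) :
    ‖cosEvalDeriv τ p‖ ≤ cosNormTwo ν p := by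
  rw [cosEvalDeriv, cosSeminorm_apply]
  refine norm_sum_le_of_le _ fun k _ => ?_
  rw [norm_smul]
  refine mul_le_mul ?_ (hν _) (norm_nonneg _) (by positivity)
  rw [norm_neg, norm_mul, Real.norm_natCast]
  have h1 : ‖Real.sin (k * τ)‖ ≤ 1 := Real.abs_sin_le_one _
  have h2 : ‖Real.sin (k * τ)‖ * k ≤ k := mul_le_of_le_one_left (Nat.cast_nonneg k) h1
  refine h2.trans ?_
  rcases Nat.eq_zero_or_pos k with rfl | hk
  · simp
  · have : (1 : ℝ) ≤ k := by exact_mod_cast hk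
    refine le_trans ?_ (le_max_right _ _)
    nlinarith

theorem integral_cos_nat_mul {k : ℕ} (hk : k ≠ 0) :
    ∫ τ in (0 : ℝ)..(2 * Real.pi), Real.cos (k * τ) = 0 := by
  have hk' : (k : ℝ) ≠ 0 := by exact_mod_cast hk
  rw [intervalIntegral.integral_comp_mul_left (fun x => Real.cos x) hk', integral_cos]
  have : Real.sin (k * (2 * Real.pi)) = 0 := by
    rw [show (k : ℝ) * (2 * Real.pi) = ((2 * k : ℕ) : ℝ) * Real.pi by push_cast; ring]
    exact Real.sin_nat_mul_pi _
  simp [this]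

theorem integral_cos_mul_cos {k : ℕ} (hk : k ≠ 0) :
    ∫ τ in (0 : ℝ)..(2 * Real.pi), Real.cos τ * Real.cos (k * τ) =
      if k = 1 then Real.pi else 0 := by
  obtain ⟨j, rfl⟩ := Nat.exists_eq_succ_of_ne_zero hk
  have e : ∀ τ : ℝ, Real.cos τ * Real.cos ((j + 1 : ℕ) * τ) =
      1 / 2 * Real.cos (j * τ) + 1 / 2 * Real.cos ((j + 2 : ℕ) * τ) := by
    intro τ
    have h1 : (j : ℝ) * τ = (j + 1 : ℕ) * τ - τ := by push_cast; ring
    have h2 : ((j + 2 : ℕ) : ℝ) * τ = (j + 1 : ℕ) * τ + τ := by push_cast; ring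
    rw [h1, h2, Real.cos_add, Real.cos_sub]
    ring
  have hc : ∀ k : ℕ, Continuous fun τ : ℝ => 1 / 2 * Real.cos (k * τ) := fun k => by fun_prop
  simp only [Nat.succ_eq_add_one, e]
  rw [intervalIntegral.integral_add ((hc _).intervalIntegrable _ _)
    ((hc _).intervalIntegrable _ _), intervalIntegral.integral_const_mul,
    intervalIntegral.integral_const_mul, integral_cos_nat_mul (k := j + 2) (by omega)]
  rcases Nat.eq_zero_or_pos j with rfl | hj
  · simp
  · rw [integral_cos_nat_mul (by omega), if_neg (by omega)]
    simp

theorem integral_cosEval {p : ℕ →₀ (Fin d → ℝ)} (hp : p ∈ oddCos d) :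
    ∫ τ in (0 : ℝ)..(2 * Real.pi), cosEval τ p = 0 := by
  simp only [cosEval_apply]
  rw [intervalIntegral.integral_finsetSum]
  · refine Finset.sum_eq_zero fun k hk => ?_
    rw [intervalIntegral.integral_smul_const, integral_cos_nat_mul, zero_smul]
    rw [Finsupp.mem_supported] at hp
    rintro rfl
    simpa using hp hk
  · intro k _
    exact Continuous.intervalIntegrable (by fun_prop) _ _

/-- Only the first harmonic is seen, so orthogonality to the leading term becomes a condition on one
vector coefficient. -/
theorem perInner_single_one_cosEval {p : ℕ →₀ (Fin d → ℝ)} (hp : p ∈ oddCos d) (u : Fin d → ℝ) :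
    perInner (fun τ => cosEval τ (Finsupp.single 1 u)) (fun τ => cosEval τ p) =
      1 / 2 * (p 1 ⬝ᵥ u) := by
  have hsub := Finset.subset_insert 1 p.support
  rw [Finsupp.mem_supported] at hp
  have e : ∀ τ : ℝ, ∑ j, cosEval τ (Finsupp.single 1 u) j * cosEval τ p j =
      ∑ k ∈ insert 1 p.support, (Real.cos τ * Real.cos (k * τ)) * (p k ⬝ᵥ u) := by
    intro τ
    rw [cosEval_single, cosEval_eq_sum_of_subset τ hsub]
    simp only [Finset.sum_apply, Finset.mul_sum, dotProduct]
    rw [Finset.sum_comm]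
    refine Finset.sum_congr rfl fun k _ => Finset.sum_congr rfl fun j _ => ?_
    simp only [Pi.smul_apply, smul_eq_mul, Nat.cast_one, one_mul]
    ring
  have hk0 : ∀ k ∈ insert 1 p.support, k ≠ 0 := by
    rintro k hk rfl
    rcases Finset.mem_insert.1 hk with h | h
    · omega
    · simpa using hp h
  simp only [perInner, e]
  rw [intervalIntegral.integral_finsetSum, Finset.sum_congr rfl fun k hk => by
    rw [intervalIntegral.integral_mul_const, integral_cos_mul_cos (hk0 k hk), ite_mul, zero_mul],
    Finset.sum_ite_eq', if_pos (Finset.mem_insert_self _ _)]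
  · have := Real.pi_ne_zero
    field_simp
  · intro k _
    exact Continuous.intervalIntegrable (by fun_prop) _ _

end CosinePolynomials

/-! ### The recursion for the coefficients and the convergence of the series -/

section Expansion

open Finset

variable {d : ℕ}

/-- The coefficient of order `m` of the cube of a series of cosine polynomials. -/
noncomputable def cubeCoeff (Q : ℕ → ℕ →₀ (Fin d → ℝ)) (m : ℕ) : ℕ →₀ (Fin d → ℝ) :=
  ∑ p ∈ triplesWithSumAddTwo m, cosMul (Q p.1) (Q p.2.1) (Q p.2.2)

theorem cubeCoeff_congr {Q Q' : ℕ → ℕ →₀ (Fin d → ℝ)} {m : ℕ} (h : ∀ i < m, Q i = Q' i) :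
    cubeCoeff Q m = cubeCoeff Q' m := by
  refine Finset.sum_congr rfl fun p hp => ?_
  rw [mem_triplesWithSumAddTwo] at hp
  rw [h p.1 (by omega), h p.2.1 (by omega), h p.2.2 (by omega)]

theorem cubeCoeff_mem_oddCos {Q : ℕ → ℕ →₀ (Fin d → ℝ)} {m : ℕ} (h : ∀ i < m, Q i ∈ oddCos d) :
    cubeCoeff Q m ∈ oddCos d := by
  refine Submodule.sum_mem _ fun p hp => ?_
  rw [mem_triplesWithSumAddTwo] at hp
  exact cosMul_mem_oddCos (h _ (by omega)) (h _ (by omega)) (h _ (by omega))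

theorem cosNorm_cubeCoeff_le {ν : Seminorm ℝ (Fin d → ℝ)}
    (hν : ∀ a b c, ν (a * b * c) ≤ ν a * ν b * ν c) (Q : ℕ → ℕ →₀ (Fin d → ℝ)) (m : ℕ) :
    cosNorm ν (cubeCoeff Q m) ≤ ∑ p ∈ triplesWithSumAddTwo m,
      cosNormTwo ν (Q p.1) * cosNormTwo ν (Q p.2.1) * cosNormTwo ν (Q p.2.2) := by
  refine (Seminorm.sum_le _ _ _).trans (Finset.sum_le_sum fun p _ => ?_)
  refine (cosNorm_cosMul_le ν hν _ _ _).trans ?_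
  have h := cosNorm_le_cosNormTwo ν
  have h0 : ∀ x, 0 ≤ cosNorm ν x := fun x => apply_nonneg _ _
  have h1 : ∀ x, 0 ≤ cosNormTwo ν x := fun x => apply_nonneg _ _
  exact mul_le_mul (mul_le_mul (h _) (h _) (h0 _) (h1 _)) (h _) (h0 _) (mul_nonneg (h1 _) (h1 _))

theorem cosEval_mapRange (L : Matrix (Fin d) (Fin d) ℝ) (τ : ℝ) (p : ℕ →₀ (Fin d → ℝ)) :
    cosEval τ (Finsupp.mapRange.linearMap L.mulVecLin p) = L.mulVec (cosEval τ p) := by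
  induction p using Finsupp.induction_linear with
  | zero => simp
  | add p q hp hq => rw [map_add, map_add, hp, hq, map_add, Matrix.mulVec_add]
  | single k c =>
    rw [Finsupp.mapRange.linearMap_apply, Finsupp.mapRange_single, cosEval_single, cosEval_single,
      Matrix.mulVec_smul]
    rfl

/-- The algebraic part of the perturbation expansion: cosine polynomials `Q m` and the
coefficients `lam m` of the squared frequency. -/
theorem exists_coefficients (L : Matrix (Fin d) (Fin d) ℝ) {w : ℝ} {e : Fin d → ℝ}
    (hLe : L.mulVec e = (-w ^ 2) • e)
    (ν : Seminorm ℝ (Fin d → ℝ)) (hν : ∀ x, ‖x‖ ≤ ν x)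
    (hmul : ∀ a b c, ν (a * b * c) ≤ ν a * ν b * ν c) {g ℓ : ℝ} (hℓ0 : 0 ≤ ℓ) (hg0 : 0 ≤ g)
    (hℓ : ∀ x, |x ⬝ᵥ e| ≤ ℓ * ν x)
    (hsolve : ∀ k : ℕ, 1 ≤ k → ∀ x, ∃ v, ((k : ℝ) ^ 2 * w ^ 2) • v + L.mulVec v =
      x - (if k = 1 then (x ⬝ᵥ e) • e else 0) ∧ (k = 1 → v ⬝ᵥ e = 0) ∧
      (k : ℝ) ^ 2 * ν v ≤ g * ν x) :
    ∃ (Q : ℕ → ℕ →₀ (Fin d → ℝ)) (lam : ℕ → ℝ),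
      Q 0 = Finsupp.single 1 ((2 : ℝ) • e) ∧ (∀ m, Q m ∈ oddCos d) ∧ lam 0 = w ^ 2 ∧
      (∀ m, 1 ≤ m → Q m 1 ⬝ᵥ e = 0) ∧
      (∀ m, -∑ q ∈ antidiagonal m, lam q.1 • cosLaplacian (Q q.2) =
        Finsupp.mapRange.linearMap L.mulVecLin (Q m) + cubeCoeff Q m) ∧
      (∀ m, 1 ≤ m → |lam m| ≤ ℓ / 2 * ∑ p ∈ triplesWithSumAddTwo m,
        cosNormTwo ν (Q p.1) * cosNormTwo ν (Q p.2.1) * cosNormTwo ν (Q p.2.2)) ∧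
      (∀ m, 1 ≤ m → cosNormTwo ν (Q m) ≤ g * (∑ p ∈ triplesWithSumAddTwo m,
        cosNormTwo ν (Q p.1) * cosNormTwo ν (Q p.2.1) * cosNormTwo ν (Q p.2.2) +
        ∑ j ∈ Ico 1 m, |lam j| * cosNormTwo ν (Q (m - j)))) := by
  choose! R hR1 hR2 hR3 using hsolve
  -- The chosen inverse `R k` is not known to be linear; its bound still forces `R k 0 = 0`, so
  -- applying it coefficientwise preserves finite support.
  have hR0 : ∀ k, 1 ≤ k → R k 0 = 0 := by
    intro k hk
    have h := hR3 k hk 0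
    rw [map_zero, mul_zero] at h
    have hk' : (1 : ℝ) ≤ k := by exact_mod_cast hk
    have h2 : ν (R k 0) ≤ 0 := by
      by_contra hneg
      push Not at hneg
      have : 0 < (k : ℝ) ^ 2 * ν (R k 0) := by positivity
      linarith
    exact norm_le_zero_iff.1 ((hν _).trans h2)
  let S : (ℕ →₀ (Fin d → ℝ)) → (ℕ →₀ (Fin d → ℝ)) := fun p =>
    Finsupp.onFinset p.support (fun k => if 1 ≤ k then R k (p k) else 0) (by
      intro k hk
      rw [Finsupp.mem_support_iff]
      intro h0
      rw [h0] at hk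
      split_ifs at hk with h1
      · exact hk (hR0 k h1)
      · exact hk rfl)
  have hSapply : ∀ p k, 1 ≤ k → S p k = R k (p k) := by
    intro p k hk
    simp [S, hk]
  have hSsupp : ∀ p, (S p).support ⊆ p.support := fun p => Finsupp.support_onFinset_subset
  have hSnorm : ∀ p ∈ oddCos d, cosNormTwo ν (S p) ≤ g * cosNorm ν p := by
    intro p hp
    rw [Finsupp.mem_supported] at hp
    rw [cosSeminorm_eq_of_subset _ _ _ (hSsupp p), cosSeminorm_apply, Finset.mul_sum]
    refine Finset.sum_le_sum fun k hk => ?_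
    have hodd : Odd k := hp hk
    have hk1 : 1 ≤ k := hodd.pos
    have hk' : (1 : ℝ) ≤ k := by exact_mod_cast hk1
    rw [hSapply p k hk1, max_eq_right (by nlinarith), one_mul]
    exact hR3 k hk1 _
  clear_value S
  -- Solvability at the first harmonic. The factor `1 / 2` comes from the leading coefficient `2 e`
  -- of `Q 0`.
  let lamOf : (ℕ → ℕ →₀ (Fin d → ℝ)) → ℕ → ℝ := fun Q m =>
    if m = 0 then w ^ 2 else -(1 / 2) * (cubeCoeff Q m 1 ⬝ᵥ e)
  -- The forcing at order `m` without the term containing the still unknown `λ_m`; that term is the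
  -- projection removed inside `R 1`.
  let H : ℕ → (ℕ → ℕ →₀ (Fin d → ℝ)) → (ℕ →₀ (Fin d → ℝ)) := fun m Q =>
    cubeCoeff Q m + ∑ j ∈ Ico 1 m, lamOf Q j • cosLaplacian (Q (m - j))
  have hlamcongr : ∀ m Q Q', (∀ i < m, Q i = Q' i) → lamOf Q m = lamOf Q' m := by
    intro m Q Q' h
    simp only [lamOf, cubeCoeff_congr h]
  have hHcongr : ∀ m Q Q', (∀ i < m, Q i = Q' i) → H m Q = H m Q' := by
    intro m Q Q' h
    simp only [H]
    rw [cubeCoeff_congr h]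
    refine congrArg (cubeCoeff Q' m + ·) (Finset.sum_congr rfl fun j hj => ?_)
    rw [mem_Ico] at hj
    rw [h (m - j) (by omega), hlamcongr j Q Q' fun i hi => h i (by omega)]
  have hHdef : ∀ m Q, H m Q = cubeCoeff Q m +
    ∑ j ∈ Ico 1 m, lamOf Q j • cosLaplacian (Q (m - j)) := fun _ _ => rfl
  clear_value H
  obtain ⟨Q, hQ⟩ := exists_strong_recursion
    (fun m Q => if m = 0 then Finsupp.single 1 ((2 : ℝ) • e) else -S (H m Q)) (by
      intro m Q Q' h
      rw [hHcongr m Q Q' h])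
  have hQ0 : Q 0 = Finsupp.single 1 ((2 : ℝ) • e) := by rw [hQ]; simp
  have hQm : ∀ m, 1 ≤ m → Q m = -S (H m Q) := by
    intro m hm
    rw [hQ, if_neg (by omega)]
  have hHodd : ∀ m, (∀ i < m, Q i ∈ oddCos d) → H m Q ∈ oddCos d := by
    intro m h
    rw [hHdef]
    refine Submodule.add_mem _ (cubeCoeff_mem_oddCos h) (Submodule.sum_mem _ fun j hj => ?_)
    rw [mem_Ico] at hj
    exact Submodule.smul_mem _ _
      (mem_oddCos_of_support_subset (h (m - j) (by omega)) (cosLaplacian_support _))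
  have hodd : ∀ m, Q m ∈ oddCos d := by
    intro m
    induction m using Nat.strong_induction_on with
    | _ m ih =>
      rcases Nat.eq_zero_or_pos m with rfl | hm
      · rw [hQ0]
        exact Finsupp.single_mem_supported _ _ odd_one
      · rw [hQm m hm]
        exact Submodule.neg_mem _ (mem_oddCos_of_support_subset (hHodd m ih) (hSsupp _))
  have horth : ∀ m, 1 ≤ m → Q m 1 ⬝ᵥ e = 0 := by
    intro m hm
    rw [hQm m hm, Finsupp.neg_apply, hSapply _ 1 le_rfl, neg_dotProduct, hR2 1 le_rfl _ rfl,
      neg_zero]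
  have hcubele : ∀ m, cosNorm ν (cubeCoeff Q m) ≤ _ := cosNorm_cubeCoeff_le hmul Q
  refine ⟨Q, lamOf Q, hQ0, hodd, by simp [lamOf], horth, ?_, ?_, ?_⟩
  · intro m
    rcases Nat.eq_zero_or_pos m with rfl | hm
    · have hc : cubeCoeff Q 0 = 0 := by
        refine Finset.sum_eq_zero fun p hp => ?_
        rw [mem_triplesWithSumAddTwo] at hp
        omega
      rw [hc, add_zero]
      simp only [HasAntidiagonal.antidiagonal_zero, sum_singleton, lamOf, if_pos, hQ0]
      ext1 k
      rw [Finsupp.neg_apply, Finsupp.smul_apply, cosLaplacian_apply,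
        Finsupp.mapRange.linearMap_apply, Finsupp.mapRange_apply, Matrix.mulVecLin_apply]
      by_cases hk : k = 1
      · subst hk
        rw [Finsupp.single_eq_same, Matrix.mulVec_smul, hLe]
        simp [smul_smul]
        ring_nf
      · rw [Finsupp.single_eq_of_ne (by omega)]
        simp
    · have hsplit : ∑ q ∈ antidiagonal m, lamOf Q q.1 • cosLaplacian (Q q.2) =
          w ^ 2 • cosLaplacian (Q m) + ∑ j ∈ Ico 1 m, lamOf Q j • cosLaplacian (Q (m - j)) +
            lamOf Q m • cosLaplacian (Q 0) := by
        rw [Finset.Nat.sum_antidiagonal_eq_sum_range_succ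
          (fun a b => lamOf Q a • cosLaplacian (Q b)), Finset.sum_range_succ,
          Finset.range_eq_Ico, Finset.sum_eq_sum_Ico_succ_bot hm]
        simp [lamOf]
      rw [hsplit]
      ext1 k
      have hH : H m Q k = cubeCoeff Q m k +
          (∑ j ∈ Ico 1 m, lamOf Q j • cosLaplacian (Q (m - j))) k := by
        rw [hHdef, Finsupp.add_apply]
      simp only [Finsupp.neg_apply, Finsupp.add_apply, Finsupp.smul_apply, cosLaplacian_apply,
        Finsupp.mapRange.linearMap_apply, Finsupp.mapRange_apply, Matrix.mulVecLin_apply]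
      set T := (∑ j ∈ Ico 1 m, lamOf Q j • cosLaplacian (Q (m - j))) k with hT
      -- At even harmonics every term vanishes, so the inverse is needed only at odd ones.
      by_cases hk : Odd k
      · have hk1 : 1 ≤ k := hk.pos
        have e1 := hR1 k hk1 (H m Q k)
        have e2 : Q m k = -R k (H m Q k) := by
          rw [hQm m hm, Finsupp.neg_apply, hSapply _ k hk1]
        have e3 : (if k = 1 then (H m Q k ⬝ᵥ e) • e else 0) =
            -(lamOf Q m • (k : ℝ) ^ 2 • Q 0 k) := by
          split_ifs with hk2
          · subst hk2
            -- The lower `λ_j` multiply states of positive order, which are orthogonal to `e` at the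
            -- first harmonic; only the cubic term enters the solvability condition.
            have h0 : T ⬝ᵥ e = 0 := by
              rw [hT, Finsupp.finsetSum_apply, sum_dotProduct]
              refine Finset.sum_eq_zero fun j hj => ?_
              rw [mem_Ico] at hj
              rw [Finsupp.smul_apply, cosLaplacian_apply, smul_dotProduct, smul_dotProduct,
                horth _ (by omega), smul_zero, smul_zero]
            rw [hH, add_dotProduct, h0, hQ0, Finsupp.single_eq_same]
            simp only [lamOf, if_neg (show m ≠ 0 by omega), smul_smul, ← neg_smul]
            congr 1
            push_cast
            ring
          · rw [hQ0, Finsupp.single_eq_of_ne (by omega)]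
            simp
        rw [e3, hH, sub_neg_eq_add] at e1
        rw [e2, Matrix.mulVec_neg, hH]
        rw [smul_neg, smul_neg, smul_smul, mul_comm (w ^ 2)]
        linear_combination (exp := 1) e1
      · have hz : ∀ p ∈ oddCos d, p k = 0 := by
          intro p hp
          by_contra h0
          rw [Finsupp.mem_supported] at hp
          exact hk (hp (Finsupp.mem_support_iff.2 h0))
        have h1 := hz _ (hHodd m fun i _ => hodd i)
        have h2 := hz _ (cubeCoeff_mem_oddCos (m := m) fun i _ => hodd i)
        rw [hH, h2, zero_add] at h1
        rw [h1, h2, hz _ (hodd m), hz _ (hodd 0)]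
        simp
  · intro m hm
    simp only [lamOf, if_neg (show m ≠ 0 by omega)]
    have h1 : ν (cubeCoeff Q m 1) ≤ cosNorm ν (cubeCoeff Q m) := by
      simpa using le_cosSeminorm ν (fun _ => 1) (fun _ => zero_le_one) (cubeCoeff Q m) 1
    have h2 := (hℓ (cubeCoeff Q m 1)).trans
      (mul_le_mul_of_nonneg_left (h1.trans (hcubele m)) hℓ0)
    rw [abs_mul, abs_neg, abs_of_pos (by norm_num : (0 : ℝ) < 1 / 2)]
    linarith
  · intro m hm
    rw [hQm m hm, map_neg_eq_map]
    refine (hSnorm _ (hHodd m fun i _ => hodd i)).trans (mul_le_mul_of_nonneg_left ?_ hg0)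
    rw [hHdef]
    refine (map_add_le_add _ _ _).trans (add_le_add (hcubele m) ?_)
    refine (Seminorm.sum_le _ _ _).trans (Finset.sum_le_sum fun j _ => ?_)
    rw [map_smul_eq_mul, Real.norm_eq_abs]
    exact mul_le_mul_of_nonneg_left (cosNorm_cosLaplacian_le ν _) (abs_nonneg _)

theorem hasSum_mul_triple {f g h : ℕ → ℝ} {F G H : ℝ} (hf : Summable fun n => |f n|)
    (hg : Summable fun n => |g n|) (hh : Summable fun n => |h n|) (hF : HasSum f F)
    (hG : HasSum g G) (hH : HasSum h H) :
    HasSum (fun p : ℕ × ℕ × ℕ => f p.1 * g p.2.1 * h p.2.2) (F * G * H) := by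
  have hgh : Summable fun p : ℕ × ℕ => ‖g p.1 * h p.2‖ := Summable.mul_norm hg hh
  have h1 : HasSum (fun p : ℕ × ℕ => g p.1 * h p.2) (G * H) := hG.mul hH hgh.of_norm
  have h2 : Summable fun p : ℕ × ℕ × ℕ => ‖f p.1 * (g p.2.1 * h p.2.2)‖ := by
    have := Summable.mul_norm (f := f) (g := fun p : ℕ × ℕ => g p.1 * h p.2) hf hgh
    simpa using this
  have h3 := hF.mul h1 h2.of_norm
  simpa only [mul_assoc] using h3

theorem perNorm_le {f : ℝ → Fin d → ℝ} {C : ℝ} (hC : 0 ≤ C) (hf : ∀ τ, ‖f τ‖ ≤ C) :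
    perNorm f ≤ Real.sqrt d * C := by
  have h1 : perInner f f ≤ d * C ^ 2 := by
    have h2 : ‖∫ τ in (0 : ℝ)..(2 * Real.pi), ∑ j, f τ j * f τ j‖ ≤
        (d * C ^ 2) * |2 * Real.pi - 0| := by
      refine intervalIntegral.norm_integral_le_of_norm_le_const fun τ _ => ?_
      rw [Real.norm_of_nonneg (Finset.sum_nonneg fun j _ => mul_self_nonneg _)]
      refine (Finset.sum_le_card_nsmul _ _ (C ^ 2) fun j _ => ?_).trans_eq (by simp)
      rw [← sq, ← sq_abs]
      exact pow_le_pow_left₀ (abs_nonneg _) ((norm_le_pi_norm (f τ) j).trans (hf τ)) 2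
    rw [sub_zero, abs_of_pos Real.two_pi_pos] at h2
    rw [perInner, inv_mul_le_iff₀ Real.two_pi_pos]
    linarith [le_of_abs_le h2]
  rw [perNorm, ← Real.sqrt_sq hC, ← Real.sqrt_mul (Nat.cast_nonneg d)]
  exact Real.sqrt_le_sqrt h1

/-- Where the coefficients decay fast enough, a formal solution is a genuine one. -/
theorem exists_solution_of_summable (L : Matrix (Fin d) (Fin d) ℝ)
    (Q : ℕ → ℕ →₀ (Fin d → ℝ)) (ω : ℕ → ℝ) {ν : Seminorm ℝ (Fin d → ℝ)} (hν : ∀ x, ‖x‖ ≤ ν x)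
    (horder : ∀ m τ, ∑ p ∈ triplesWithSum m, (ω p.1 * ω p.2.1) •
        iteratedDeriv 2 (fun τ => cosEval τ (Q p.2.2)) τ =
      L.mulVec (cosEval τ (Q m)) + ∑ p ∈ triplesWithSumAddTwo m,
        cosEval τ (Q p.1) * cosEval τ (Q p.2.1) * cosEval τ (Q p.2.2)) {ε : ℝ}
    (hω : Summable fun m => |ω m| * |ε| ^ m)
    (hQ : Summable fun m => cosNormTwo ν (Q m) * |ε| ^ m) :
    Summable (fun m => |ε| ^ (m + 1) * perNorm fun τ => cosEval τ (Q m)) ∧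
    ∃ q : ℝ → Fin d → ℝ, IsEvenPeriodicSolution L (∑' m, ε ^ m * ω m) q ∧
      Filter.Tendsto (fun M : ℕ => perNorm fun τ =>
        (∑ m ∈ Finset.range M, ε ^ (m + 1) • cosEval τ (Q m)) - q τ) Filter.atTop (nhds 0) := by
  -- One summable sequence dominates the terms together with their first and second derivatives,
  -- uniformly in `τ`, which permits differentiating termwise twice.
  let b : ℕ → ℝ := fun m => |ε| ^ (m + 1) * cosNormTwo ν (Q m)
  have hb : Summable b := by
    refine (hQ.mul_left |ε|).congr fun m => ?_
    simp only [b]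
    ring
  have hb0 : ∀ m, 0 ≤ b m := fun m => mul_nonneg (by positivity) (apply_nonneg _ _)
  have habs : ∀ m, |ε ^ (m + 1)| = |ε| ^ (m + 1) := fun m => abs_pow _ _
  have hval : ∀ m τ, ‖cosEval τ (Q m)‖ ≤ cosNormTwo ν (Q m) := fun m τ =>
    (norm_cosEval_le hν _ τ).trans (cosNorm_le_cosNormTwo ν _)
  have b0 : ∀ m τ, ‖ε ^ (m + 1) • cosEval τ (Q m)‖ ≤ b m := by
    intro m τ
    rw [norm_smul, Real.norm_eq_abs, habs]
    exact mul_le_mul_of_nonneg_left (hval m τ) (by positivity)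
  have b1 : ∀ m τ, ‖ε ^ (m + 1) • cosEvalDeriv τ (Q m)‖ ≤ b m := by
    intro m τ
    rw [norm_smul, Real.norm_eq_abs, habs]
    exact mul_le_mul_of_nonneg_left (norm_cosEvalDeriv_le hν _ τ) (by positivity)
  have b2 : ∀ m τ, ‖ε ^ (m + 1) • -cosEval τ (cosLaplacian (Q m))‖ ≤ b m := by
    intro m τ
    rw [norm_smul, Real.norm_eq_abs, habs, norm_neg]
    exact mul_le_mul_of_nonneg_left
      ((norm_cosEval_le hν _ τ).trans (cosNorm_cosLaplacian_le ν _)) (by positivity)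
  have s0 : ∀ τ, Summable fun m => ε ^ (m + 1) • cosEval τ (Q m) := fun τ =>
    Summable.of_norm_bounded hb fun m => b0 m τ
  have s1 : ∀ τ, Summable fun m => ε ^ (m + 1) • cosEvalDeriv τ (Q m) := fun τ =>
    Summable.of_norm_bounded hb fun m => b1 m τ
  have s2 : ∀ τ, Summable fun m => ε ^ (m + 1) • -cosEval τ (cosLaplacian (Q m)) := fun τ =>
    Summable.of_norm_bounded hb fun m => b2 m τ
  let q : ℝ → Fin d → ℝ := fun τ => ∑' m, ε ^ (m + 1) • cosEval τ (Q m)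
  let q1 : ℝ → Fin d → ℝ := fun τ => ∑' m, ε ^ (m + 1) • cosEvalDeriv τ (Q m)
  let q2 : ℝ → Fin d → ℝ := fun τ => ∑' m, ε ^ (m + 1) • -cosEval τ (cosLaplacian (Q m))
  have d0 : ∀ τ, HasDerivAt q (q1 τ) τ := hasDerivAt_tsum hb
    (fun m τ => (hasDerivAt_cosEval (Q m) τ).const_smul (ε ^ (m + 1))) b1 (s0 0)
  have d1 : ∀ τ, HasDerivAt q1 (q2 τ) τ := hasDerivAt_tsum hb
    (fun m τ => (hasDerivAt_cosEvalDeriv (Q m) τ).const_smul (ε ^ (m + 1))) b2 (s1 0)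
  have c2 : Continuous q2 := continuous_tsum
    (fun m => by have := continuous_cosEval (cosLaplacian (Q m)); fun_prop) hb b2
  refine ⟨?_, q, ⟨contDiff_two_of_hasDerivAt d0 d1 c2, ?_, ?_, ?_⟩, ?_⟩
  · refine Summable.of_nonneg_of_le (fun m => mul_nonneg (by positivity) (Real.sqrt_nonneg _))
      (fun m => ?_) (hb.mul_left (Real.sqrt d))
    have := perNorm_le (apply_nonneg (cosNormTwo ν) (Q m)) (hval m)
    calc _ ≤ |ε| ^ (m + 1) * (Real.sqrt d * cosNormTwo ν (Q m)) :=
          mul_le_mul_of_nonneg_left this (by positivity)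
      _ = _ := by simp only [b]; ring
  · intro τ
    simp only [q, cosEval_periodic (Q _) τ]
  · intro τ
    simp only [q, cosEval_even (Q _) τ]
  · intro τ
    rw [iteratedDeriv_two_of_hasDerivAt d0 d1]
    have hωs : Summable fun m => |ε ^ m * ω m| := by
      refine hω.congr fun m => ?_
      rw [abs_mul, abs_pow, mul_comm]
    have hωsum := hωs.of_abs.hasSum
    ext j
    have t0 : HasSum (fun m => ε ^ (m + 1) * cosEval τ (Q m) j) (q τ j) :=
      Pi.hasSum.1 (s0 τ).hasSum j
    have t2 : HasSum (fun m => ε ^ (m + 1) * (-cosEval τ (cosLaplacian (Q m)) j)) (q2 τ j) :=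
      Pi.hasSum.1 (s2 τ).hasSum j
    have a0 : Summable fun m => |ε ^ (m + 1) * cosEval τ (Q m) j| :=
      Summable.of_nonneg_of_le (fun m => abs_nonneg _)
        (fun m => (norm_le_pi_norm (ε ^ (m + 1) • cosEval τ (Q m)) j).trans (b0 m τ)) hb
    have a2 : Summable fun m => |ε ^ (m + 1) * (-cosEval τ (cosLaplacian (Q m)) j)| :=
      Summable.of_nonneg_of_le (fun m => abs_nonneg _)
        (fun m => (norm_le_pi_norm (ε ^ (m + 1) • -cosEval τ (cosLaplacian (Q m))) j).trans
          (b2 m τ)) hb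
    -- Both triple products regroup to the power `ε ^ (m + 1)`: two frequencies and one state carry
    -- one extra `ε`, while three states carry three, matched by the shift of two in the index set.
    have e1 := (hasSum_mul_triple hωs hωs a2 hωsum hωsum t2).triplesWithSum
    have e2 := (hasSum_mul_triple a0 a0 a0 t0 t0 t0).triplesWithSumAddTwo
    have e3 : HasSum (fun m => ε ^ (m + 1) * (L.mulVec (cosEval τ (Q m))) j)
        (L.mulVec (q τ) j) := by
      have h := (s0 τ).hasSum.mapL (Matrix.mulVecLin L).toContinuousLinearMap
      have h' := Pi.hasSum.1 h j
      simpa [Matrix.mulVec_smul] using h'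
    have e4 := e3.add e2
    have e5 : ∀ m, ∑ p ∈ triplesWithSum m, ε ^ p.1 * ω p.1 * (ε ^ p.2.1 * ω p.2.1) *
        (ε ^ (p.2.2 + 1) * (-cosEval τ (cosLaplacian (Q p.2.2)) j)) =
        ε ^ (m + 1) * (L.mulVec (cosEval τ (Q m))) j +
        ∑ p ∈ triplesWithSumAddTwo m, ε ^ (p.1 + 1) * cosEval τ (Q p.1) j *
          (ε ^ (p.2.1 + 1) * cosEval τ (Q p.2.1) j) *
          (ε ^ (p.2.2 + 1) * cosEval τ (Q p.2.2) j) := by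
      intro m
      have h := congrArg (fun v => ε ^ (m + 1) * v j) (horder m τ)
      simp only [Pi.add_apply, Finset.sum_apply, Pi.smul_apply, Pi.mul_apply, smul_eq_mul,
        iteratedDeriv_cosEval, Pi.neg_apply, mul_add, Finset.mul_sum] at h
      convert h using 1
      · refine Finset.sum_congr rfl fun p hp => ?_
        rw [mem_triplesWithSum] at hp
        rw [← hp]
        ring
      · congr 1
        refine Finset.sum_congr rfl fun p hp => ?_
        rw [mem_triplesWithSumAddTwo] at hp
        rw [← hp]
        ring
    have e6 := (e1.congr_fun fun m => (e5 m).symm).unique e4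
    simp only [Pi.smul_apply, Pi.add_apply, Pi.pow_apply, smul_eq_mul]
    linear_combination (exp := 1) e6
  · have hbs := hb.hasSum
    have htail : ∀ M τ, ‖(∑ m ∈ Finset.range M, ε ^ (m + 1) • cosEval τ (Q m)) - q τ‖ ≤
        ∑' m, b (m + M) := by
      intro M τ
      rw [norm_sub_rev]
      have h1 : q τ - ∑ m ∈ Finset.range M, ε ^ (m + 1) • cosEval τ (Q m) =
          ∑' m, ε ^ (m + M + 1) • cosEval τ (Q (m + M)) := by
        rw [sub_eq_iff_eq_add']
        exact ((s0 τ).sum_add_tsum_nat_add M).symm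
      rw [h1]
      exact tsum_of_norm_bounded ((summable_nat_add_iff M).2 hb).hasSum fun m => b0 (m + M) τ
    have hlim : Filter.Tendsto (fun M => Real.sqrt d * ∑' m, b (m + M)) Filter.atTop (nhds 0) := by
      simpa using (tendsto_sum_nat_add b).const_mul (Real.sqrt d)
    refine squeeze_zero (fun M => Real.sqrt_nonneg _) (fun M => ?_) hlim
    exact perNorm_le (tsum_nonneg fun m => hb0 _) (htail M)

/-- Existence and convergence of the expansion, given bounds for the linear problem. -/
theorem exists_expansion (L : Matrix (Fin d) (Fin d) ℝ) {w : ℝ} (hw : 0 < w) {u e : Fin d → ℝ}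
    (hue : e = (1 / Real.sqrt (∑ j, u j ^ 2)) • u)
    (hLe : L.mulVec e = (-w ^ 2) • e)
    (ν : Seminorm ℝ (Fin d → ℝ)) (hν : ∀ x, ‖x‖ ≤ ν x)
    (hmul : ∀ a b c, ν (a * b * c) ≤ ν a * ν b * ν c) {g ℓ : ℝ} (hℓ0 : 0 ≤ ℓ) (hg0 : 0 ≤ g)
    (hℓ : ∀ x, |x ⬝ᵥ e| ≤ ℓ * ν x)
    (hsolve : ∀ k : ℕ, 1 ≤ k → ∀ x, ∃ v, ((k : ℝ) ^ 2 * w ^ 2) • v + L.mulVec v =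
      x - (if k = 1 then (x ⬝ᵥ e) • e else 0) ∧ (k = 1 → v ⬝ᵥ e = 0) ∧
      (k : ℝ) ^ 2 * ν v ≤ g * ν x) :
    ∃ (ω : ℕ → ℝ) (Q : ℕ → ℝ → Fin d → ℝ), IsFormalExpansion L w u ω Q ∧
      ∀ ε s : ℝ, 0 ≤ s →
        g * (ε ^ 2 * (2 * ν e + s) ^ 3 + ℓ / 2 * (ε ^ 2 * (2 * ν e + s) ^ 3) * s) ≤ s →
        ℓ / 2 * (ε ^ 2 * (2 * ν e + s) ^ 3) ≤ w ^ 2 →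
        Summable (fun m => ε ^ m * ω m) ∧
        Summable (fun m => |ε| ^ (m + 1) * perNorm (Q m)) ∧
        ∃ q : ℝ → Fin d → ℝ, IsEvenPeriodicSolution L (∑' m, ε ^ m * ω m) q ∧
          Filter.Tendsto (fun M : ℕ => perNorm fun τ =>
            (∑ m ∈ Finset.range M, ε ^ (m + 1) • Q m τ) - q τ) Filter.atTop (nhds 0) := by
  obtain ⟨Q, lam, hQ0, hodd, hlam0, horth, hrec, hlam, hQ⟩ :=
    exists_coefficients L hLe ν hν hmul hℓ0 hg0 hℓ hsolve
  -- The recursion produced the coefficients of `ω²`; `ω` is their formal square root with positive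
  -- constant term.
  obtain ⟨ω, hω0, hωsq, hωsum⟩ := exists_sqrt_series hw lam hlam0
  have horder : ∀ m τ, ∑ p ∈ triplesWithSum m, (ω p.1 * ω p.2.1) •
        iteratedDeriv 2 (fun τ => cosEval τ (Q p.2.2)) τ =
      L.mulVec (cosEval τ (Q m)) + ∑ p ∈ triplesWithSumAddTwo m,
        cosEval τ (Q p.1) * cosEval τ (Q p.2.1) * cosEval τ (Q p.2.2) := by
    intro m τ
    have h := congrArg (cosEval τ) (hrec m)
    rw [map_neg, map_add, cosEval_mapRange, cubeCoeff, map_sum, map_sum] at h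
    simp only [cosEval_cosMul] at h
    rw [← h, sum_triplesWithSum (fun a b c => (ω a * ω b) •
      iteratedDeriv 2 (fun τ => cosEval τ (Q c)) τ), ← Finset.sum_neg_distrib]
    refine Finset.sum_congr rfl fun q _ => ?_
    rw [← Finset.sum_smul, hωsq, iteratedDeriv_cosEval, map_smul, smul_neg]
  refine ⟨ω, fun m τ => cosEval τ (Q m), ⟨fun m => contDiff_cosEval _, fun m => cosEval_periodic _,
    fun m => cosEval_even _, fun m => integral_cosEval (hodd m), hω0, ?_, ?_, horder⟩, ?_⟩
  · intro τ
    rw [hQ0, cosEval_single, hue, smul_smul, smul_smul]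
    congr 1
    push_cast
    rw [one_mul]
    ring
  · intro m hm
    rw [hQ0, perInner_single_one_cosEval (hodd m), dotProduct_smul, horth m hm]
    simp
  · intro ε s hs hs1 hs2
    have hx0 : cosNormTwo ν (Q 0) ≤ 2 * ν e := by
      rw [hQ0, cosSeminorm_single, map_smul_eq_mul]
      norm_num
    rw [← sq_abs ε] at hs1 hs2
    -- The majorant is evaluated at radius `|ε|`. Its second conclusion keeps the correction to `ω²`
    -- below `w²`, as the square root requires.
    have hmaj := majorant_bound (x := fun m => cosNormTwo ν (Q m)) (l := fun m => |lam m|)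
      (fun m => apply_nonneg _ _) (fun m => abs_nonneg _) hg0 (by positivity) (abs_nonneg ε) hs hx0
      hlam hQ hs1
    have hS1 : Summable fun m => |ω m| * |ε| ^ m :=
      hωsum |ε| (abs_nonneg ε) fun M => (hmaj M).2.trans hs2
    have hS2 : Summable fun m => cosNormTwo ν (Q m) * |ε| ^ m :=
      summable_of_sum_Ico_le (fun m => mul_nonneg (apply_nonneg _ _) (by positivity))
        fun M => (hmaj M).1
    refine ⟨?_, exists_solution_of_summable L Q ω hν horder hS1 hS2⟩
    refine Summable.of_abs (hS1.congr fun m => ?_)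
    rw [abs_mul, abs_pow, mul_comm]

end Expansion

/-! ### Uniqueness of the formal expansion through cosine coefficients -/

section Uniqueness

open Finset

/-- Evenness kills the sine integrals through `τ ↦ 2π - τ`. All complex Fourier coefficients then
vanish, hence are summable, and a continuous function with summable coefficients is the sum of its
Fourier series. -/
theorem eq_zero_of_integral_cos_eq_zero {f : ℝ → ℝ} (hc : Continuous f)
    (hp : Function.Periodic f (2 * Real.pi)) (he : Function.Even f)
    (h : ∀ k : ℕ, ∫ τ in (0 : ℝ)..(2 * Real.pi), Real.cos (k * τ) * f τ = 0) : f = 0 := by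
  have : Fact (0 < 2 * Real.pi) := ⟨Real.two_pi_pos⟩
  have hsin : ∀ n : ℤ, ∫ τ in (0 : ℝ)..(2 * Real.pi), Real.sin (n * τ) * f τ = 0 := by
    intro n
    have h1 := intervalIntegral.integral_comp_sub_left (a := 0) (b := 2 * Real.pi)
      (fun τ => Real.sin (n * τ) * f τ) (2 * Real.pi)
    have h2 : ∀ τ, Real.sin (n * (2 * Real.pi - τ)) * f (2 * Real.pi - τ) =
        -(Real.sin (n * τ) * f τ) := by
      intro τ
      rw [hp.sub_eq', he, mul_sub, Real.sin_int_mul_two_pi_sub]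
      ring
    simp only [h2, sub_self, sub_zero, intervalIntegral.integral_neg] at h1
    linarith
  have hcos : ∀ n : ℤ, ∫ τ in (0 : ℝ)..(2 * Real.pi), Real.cos (n * τ) * f τ = 0 := by
    intro n
    refine Eq.trans ?_ (h n.natAbs)
    simp only [cos_natAbs_mul]
  have hcp : Function.Periodic (fun τ => (f τ : ℂ)) (2 * Real.pi) := fun τ => by simp only [hp τ]
  let F : C(AddCircle (2 * Real.pi), ℂ) := ⟨hcp.lift, by
    refine continuous_coinduced_dom.2 ?_
    exact Complex.continuous_ofReal.comp hc⟩
  have hF : ∀ τ : ℝ, F (τ : AddCircle (2 * Real.pi)) = f τ := fun τ => hcp.lift_coe τ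
  have hcoef : ∀ n, fourierCoeff F n = 0 := by
    intro n
    rw [fourierCoeff_eq_intervalIntegral F n 0, zero_add]
    have e : ∀ τ : ℝ, fourier (-n) (τ : AddCircle (2 * Real.pi)) • F τ =
        ((Real.cos (n * τ) * f τ : ℝ) : ℂ) - Complex.I * ((Real.sin (n * τ) * f τ : ℝ) : ℂ) := by
      intro τ
      have hpi : (Real.pi : ℂ) ≠ 0 := by exact_mod_cast Real.pi_ne_zero
      rw [hF, fourier_coe_apply, smul_eq_mul]
      have e1 : 2 * (Real.pi : ℂ) * Complex.I * ((-n : ℤ) : ℂ) * (τ : ℂ) / ((2 * Real.pi : ℝ) : ℂ) =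
          ((-(n * τ) : ℝ) : ℂ) * Complex.I := by
        push_cast
        field_simp
      rw [e1, Complex.exp_mul_I, ← Complex.ofReal_cos, ← Complex.ofReal_sin, Real.cos_neg,
        Real.sin_neg]
      push_cast
      ring
    simp only [e]
    rw [intervalIntegral.integral_sub, intervalIntegral.integral_const_mul,
      intervalIntegral.integral_ofReal, intervalIntegral.integral_ofReal, hcos, hsin]
    · simp
    · exact Continuous.intervalIntegrable (by fun_prop) _ _
    · exact Continuous.intervalIntegrable (by fun_prop) _ _
  have hs := hasSum_fourier_series_of_summable (f := F)
    (summable_zero.congr fun n => (hcoef n).symm)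
  simp only [hcoef, zero_smul] at hs
  have hF0 : F = 0 := hs.unique hasSum_zero
  ext τ
  have := hF τ
  rw [hF0] at this
  simpa using this.symm

variable {d : ℕ}

/-- The `k`-th cosine coefficient of a function of period `2π`. -/
noncomputable def cosCoeff (k : ℕ) (f : ℝ → Fin d → ℝ) : Fin d → ℝ :=
  ∫ τ in (0 : ℝ)..(2 * Real.pi), Real.cos (k * τ) • f τ

theorem cosCoeff_apply (k : ℕ) {f : ℝ → Fin d → ℝ} (hf : Continuous f) (j : Fin d) :
    cosCoeff k f j = ∫ τ in (0 : ℝ)..(2 * Real.pi), Real.cos (k * τ) * f τ j := by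
  have hi : IntervalIntegrable (fun τ => Real.cos (k * τ) • f τ) MeasureTheory.volume 0
      (2 * Real.pi) := Continuous.intervalIntegrable (by fun_prop) _ _
  have := (ContinuousLinearMap.proj (R := ℝ) (φ := fun _ : Fin d => ℝ) j).intervalIntegral_comp_comm
    hi
  simpa [cosCoeff] using this.symm

theorem cosCoeff_add (k : ℕ) {f g : ℝ → Fin d → ℝ} (hf : Continuous f) (hg : Continuous g) :
    cosCoeff k (fun τ => f τ + g τ) = cosCoeff k f + cosCoeff k g := by
  simp only [cosCoeff, smul_add]
  exact intervalIntegral.integral_add (Continuous.intervalIntegrable (by fun_prop) _ _)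
    (Continuous.intervalIntegrable (by fun_prop) _ _)

theorem cosCoeff_sub (k : ℕ) {f g : ℝ → Fin d → ℝ} (hf : Continuous f) (hg : Continuous g) :
    cosCoeff k (fun τ => f τ - g τ) = cosCoeff k f - cosCoeff k g := by
  simp only [cosCoeff, smul_sub]
  exact intervalIntegral.integral_sub (Continuous.intervalIntegrable (by fun_prop) _ _)
    (Continuous.intervalIntegrable (by fun_prop) _ _)

theorem cosCoeff_const_smul (k : ℕ) (c : ℝ) (f : ℝ → Fin d → ℝ) :
    cosCoeff k (fun τ => c • f τ) = c • cosCoeff k f := by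
  simp only [cosCoeff, smul_comm _ c, intervalIntegral.integral_smul]

theorem cosCoeff_mulVec (L : Matrix (Fin d) (Fin d) ℝ) (k : ℕ) {f : ℝ → Fin d → ℝ}
    (hf : Continuous f) : cosCoeff k (fun τ => L.mulVec (f τ)) = L.mulVec (cosCoeff k f) := by
  have hi : IntervalIntegrable (fun τ => Real.cos (k * τ) • f τ) MeasureTheory.volume 0
      (2 * Real.pi) := Continuous.intervalIntegrable (by fun_prop) _ _
  have := (Matrix.mulVecLin L).toContinuousLinearMap.intervalIntegral_comp_comm hi
  simpa [cosCoeff, Matrix.mulVec_smul] using this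

theorem cosCoeff_iteratedDeriv_two (k : ℕ) {f : ℝ → Fin d → ℝ} (hf : ContDiff ℝ 2 f)
    (hp : Function.Periodic f (2 * Real.pi)) :
    cosCoeff k (iteratedDeriv 2 f) = -((k : ℝ) ^ 2) • cosCoeff k f := by
  have h2 : ContDiff ℝ 1 (deriv f) := by
    rw [show (2 : WithTop ℕ∞) = 1 + 1 by norm_num, contDiff_succ_iff_deriv] at hf
    exact hf.2.2
  have hd : ∀ x, HasDerivAt f (deriv f x) x := fun x =>
    (hf.differentiable (by norm_num) x).hasDerivAt
  have hd2 : ∀ x, HasDerivAt (deriv f) (iteratedDeriv 2 f x) x := by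
    intro x
    rw [iteratedDeriv_succ, iteratedDeriv_one]
    exact (h2.differentiable (by norm_num) x).hasDerivAt
  have hc2 : Continuous (iteratedDeriv 2 f) := hf.continuous_iteratedDeriv 2 (by norm_num)
  have hc : Continuous f := hf.continuous
  have hp' : deriv f (2 * Real.pi) = deriv f 0 := by
    have h := deriv_comp_add_const f (2 * Real.pi) 0
    rw [zero_add] at h
    rw [← h]
    congr 1
    exact funext hp
  have hcosd : ∀ x : ℝ, HasDerivAt (fun τ : ℝ => Real.cos (k * τ)) (-Real.sin (k * x) * k) x := by
    intro x
    have h1 : HasDerivAt (fun x : ℝ => (k : ℝ) * x) k x := by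
      simpa using (hasDerivAt_id x).const_mul (k : ℝ)
    exact (Real.hasDerivAt_cos ((k : ℝ) * x)).comp x h1
  have hsind : ∀ x : ℝ, HasDerivAt (fun τ : ℝ => Real.sin (k * τ)) (Real.cos (k * x) * k) x := by
    intro x
    have h1 : HasDerivAt (fun x : ℝ => (k : ℝ) * x) k x := by
      simpa using (hasDerivAt_id x).const_mul (k : ℝ)
    exact (Real.hasDerivAt_sin ((k : ℝ) * x)).comp x h1
  -- Two integrations by parts in one: the primitive `cos (kτ) f' + k sin (kτ) f` takes equal values
  -- at both ends of the period.
  have key := intervalIntegral.integral_eq_sub_of_hasDerivAt (a := 0) (b := 2 * Real.pi)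
    (f := fun τ => Real.cos (k * τ) • deriv f τ + (k * Real.sin (k * τ)) • f τ)
    (f' := fun τ => Real.cos (k * τ) • iteratedDeriv 2 f τ + ((k : ℝ) ^ 2 * Real.cos (k * τ)) • f τ)
    (fun x _ => by
      refine (((hcosd x).smul (hd2 x)).add (((hsind x).const_mul (k : ℝ)).smul (hd x))).congr_deriv ?_
      module)
    (Continuous.intervalIntegrable (by fun_prop) _ _)
  have hk1 : Real.cos (k * (2 * Real.pi)) = 1 := Real.cos_nat_mul_two_pi k
  have hk2 : Real.sin (k * (2 * Real.pi)) = 0 := by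
    rw [show (k : ℝ) * (2 * Real.pi) = ((2 * k : ℕ) : ℝ) * Real.pi by push_cast; ring]
    exact Real.sin_nat_mul_pi _
  simp only [hk1, hk2, hp', mul_zero, Real.cos_zero, Real.sin_zero, zero_smul, add_zero,
    sub_self] at key
  rw [intervalIntegral.integral_add (Continuous.intervalIntegrable (by fun_prop) _ _)
    (Continuous.intervalIntegrable (by fun_prop) _ _)] at key
  simp only [mul_smul, intervalIntegral.integral_smul] at key
  rw [neg_smul]
  exact eq_neg_of_add_eq_zero_left key

/-- Under the nonresonance conditions the formal expansion is unique. -/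
theorem IsFormalExpansion.unique {L : Matrix (Fin d) (Fin d) ℝ} (hL : L.IsSymm) {w : ℝ}
    (hw : 0 < w) {u : Fin d → ℝ} (hu : u ≠ 0) (hLu : L.mulVec u = (-w ^ 2) • u)
    (hker : ∀ v, w ^ 2 • v + L.mulVec v = 0 → ∃ c : ℝ, v = c • u)
    (hres : ∀ k : ℕ, 2 ≤ k → ∀ v, ((k : ℝ) ^ 2 * w ^ 2) • v + L.mulVec v = 0 → v = 0)
    {ω ω' : ℕ → ℝ} {Q Q' : ℕ → ℝ → Fin d → ℝ} (h : IsFormalExpansion L w u ω Q)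
    (h' : IsFormalExpansion L w u ω' Q') : ω' = ω ∧ Q' = Q := by
  have huu : 0 < ∑ j, u j ^ 2 := by
    obtain ⟨j, hj⟩ := Function.ne_iff.1 hu
    exact Finset.sum_pos' (fun j _ => sq_nonneg _) ⟨j, mem_univ j, by
      have : u j ≠ 0 := hj
      positivity⟩
  set a : ℝ := 2 / Real.sqrt (∑ j, u j ^ 2) with ha
  have ha0 : 0 < a := div_pos two_pos (Real.sqrt_pos.2 huu)
  have hQ0 : ∀ τ, Q 0 τ = Real.cos τ • a • u := by
    intro τ
    rw [h.state_zero, smul_smul, ha]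
    congr 1
    ring
  have hQ0' : Q' 0 = Q 0 := funext fun τ => by rw [h.state_zero, h'.state_zero]
  have hω0 : ω' 0 = ω 0 := by rw [h.freq_zero, h'.freq_zero]
  have hcoef0 : ∀ k : ℕ, k ≠ 0 → cosCoeff k (Q 0) = (if k = 1 then Real.pi else 0) • a • u := by
    intro k hk
    have e : ∀ τ, Real.cos (k * τ) • Q 0 τ = (Real.cos τ * Real.cos (k * τ)) • a • u := by
      intro τ
      rw [hQ0, smul_smul, mul_comm]
    simp only [cosCoeff, e]
    rw [intervalIntegral.integral_smul_const, integral_cos_mul_cos hk]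
  have hinner : ∀ f : ℝ → Fin d → ℝ, Continuous f →
      perInner (Q 0) f = (2 * Real.pi)⁻¹ * (a * (u ⬝ᵥ cosCoeff 1 f)) := by
    intro f hf
    rw [perInner]
    congr 1
    rw [intervalIntegral.integral_finsetSum fun j _ => by
      have := (h.contDiff 0).continuous
      exact Continuous.intervalIntegrable (by fun_prop) _ _]
    simp only [dotProduct, Finset.mul_sum]
    refine Finset.sum_congr rfl fun j _ => ?_
    rw [cosCoeff_apply 1 hf, ← intervalIntegral.integral_const_mul,
      ← intervalIntegral.integral_const_mul]
    congr 1
    ext τ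
    rw [hQ0]
    simp only [Pi.smul_apply, smul_eq_mul, Nat.cast_one, one_mul]
    ring
  have main : ∀ m, ω' m = ω m ∧ Q' m = Q m := by
    intro m
    induction m using Nat.strong_induction_on with
    | _ m ih =>
      rcases Nat.eq_zero_or_pos m with rfl | hm
      · exact ⟨hω0, hQ0'⟩
      have hc := (h.contDiff m).continuous
      have hc' := (h'.contDiff m).continuous
      have hd := (h.contDiff m).continuous_iteratedDeriv 2 (by norm_num)
      have hd' := (h'.contDiff m).continuous_iteratedDeriv 2 (by norm_num)
      have hd0 := (h.contDiff 0).continuous_iteratedDeriv 2 (by norm_num)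
      have hpt : ∀ τ, (2 * w * (ω' m - ω m)) • iteratedDeriv 2 (Q 0) τ +
          w ^ 2 • (iteratedDeriv 2 (Q' m) τ - iteratedDeriv 2 (Q m) τ) =
          L.mulVec (Q' m τ - Q m τ) := by
        intro τ
        have e1 := h.order m τ
        have e2 := h'.order m τ
        have e3 : ∑ p ∈ triplesWithSumAddTwo m, Q' p.1 τ * Q' p.2.1 τ * Q' p.2.2 τ =
            ∑ p ∈ triplesWithSumAddTwo m, Q p.1 τ * Q p.2.1 τ * Q p.2.2 τ := by
          refine Finset.sum_congr rfl fun p hp => ?_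
          rw [mem_triplesWithSumAddTwo] at hp
          rw [(ih p.1 (by omega)).2, (ih p.2.1 (by omega)).2, (ih p.2.2 (by omega)).2]
        -- Triples with all indices below `m` agree by induction. The three that contain `m` leave
        -- `2 w (ω' m - ω m)` times the second derivative of `Q 0`, plus `w²` times that of the
        -- difference of states.
        have e4 : ∑ p ∈ triplesWithSum m, ((ω' p.1 * ω' p.2.1) • iteratedDeriv 2 (Q' p.2.2) τ -
            (ω p.1 * ω p.2.1) • iteratedDeriv 2 (Q p.2.2) τ) =
            ∑ p ∈ ({(0, 0, m), (0, m, 0), (m, 0, 0)} : Finset (ℕ × ℕ × ℕ)),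
            ((ω' p.1 * ω' p.2.1) • iteratedDeriv 2 (Q' p.2.2) τ -
            (ω p.1 * ω p.2.1) • iteratedDeriv 2 (Q p.2.2) τ) := by
          symm
          refine Finset.sum_subset ?_ fun p hp hp' => ?_
          · intro p hp
            simp only [mem_insert, mem_singleton] at hp
            rw [mem_triplesWithSum]
            rcases hp with rfl | rfl | rfl <;> simp
          · obtain ⟨x, y, z⟩ := p
            rw [mem_triplesWithSum] at hp
            simp only [mem_insert, mem_singleton, Prod.mk.injEq] at hp' hp
            rw [(ih x (by omega)).1, (ih y (by omega)).1, (ih z (by omega)).2, sub_self]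
        rw [Finset.sum_sub_distrib, e1, e2, e3, sum_insert, sum_insert, sum_singleton] at e4
        · simp only [hω0, hQ0', h.freq_zero] at e4
          rw [Matrix.mulVec_sub]
          rw [add_sub_add_right_eq_sub] at e4
          rw [e4]
          module
        · simp only [mem_singleton, Prod.mk.injEq]
          omega
        · simp only [mem_insert, mem_singleton, Prod.mk.injEq]
          omega
      have hk : ∀ k : ℕ, (-((k : ℝ) ^ 2 * (2 * w * (ω' m - ω m)))) • cosCoeff k (Q 0) =
          ((k : ℝ) ^ 2 * w ^ 2) • (cosCoeff k (Q' m) - cosCoeff k (Q m)) +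
          L.mulVec (cosCoeff k (Q' m) - cosCoeff k (Q m)) := by
        intro k
        have e := congrArg (cosCoeff k) (funext hpt)
        rw [cosCoeff_add k (by fun_prop) (by fun_prop), cosCoeff_const_smul, cosCoeff_const_smul,
          cosCoeff_sub k hd' hd, cosCoeff_mulVec L k (by fun_prop), cosCoeff_sub k hc' hc,
          cosCoeff_iteratedDeriv_two k (h.contDiff 0) (h.periodic 0),
          cosCoeff_iteratedDeriv_two k (h.contDiff m) (h.periodic m),
          cosCoeff_iteratedDeriv_two k (h'.contDiff m) (h'.periodic m)] at e
        rw [← e]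
        module
      -- Pairing the first harmonic with `u` annihilates `w² + L` by symmetry, leaving a nonzero
      -- multiple of the frequency difference.
      have hδ : ω' m = ω m := by
        have e := congrArg (fun v => u ⬝ᵥ v) (hk 1)
        have e2 : u ⬝ᵥ L.mulVec (cosCoeff 1 (Q' m) - cosCoeff 1 (Q m)) =
            (-w ^ 2) * (u ⬝ᵥ (cosCoeff 1 (Q' m) - cosCoeff 1 (Q m))) := by
          rw [Matrix.dotProduct_mulVec, ← Matrix.mulVec_transpose, hL.eq, hLu, smul_dotProduct,
            smul_eq_mul]
        simp only [dotProduct_add, e2, dotProduct_smul, hcoef0 1 one_ne_zero, if_true,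
          smul_eq_mul, Nat.cast_one] at e
        have e3 : u ⬝ᵥ u = ∑ j, u j ^ 2 := by
          simp only [dotProduct, sq]
        rw [e3] at e
        have e4 : (ω' m - ω m) * (w * Real.pi * a * ∑ j, u j ^ 2) = 0 := by linarith
        rcases mul_eq_zero.1 e4 with e5 | e5
        · linarith
        · have := Real.pi_pos
          have : 0 < w * Real.pi * a * ∑ j, u j ^ 2 := by positivity
          linarith
      refine ⟨hδ, ?_⟩
      have hzero : ∀ k : ℕ, cosCoeff k (Q' m) - cosCoeff k (Q m) = 0 := by
        intro k
        have e := hk k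
        rw [hδ, sub_self, mul_zero, mul_zero, neg_zero, zero_smul] at e
        -- Each harmonic has its own reason: zero mean for `k = 0`, a one-dimensional kernel
        -- together with orthogonality for `k = 1`, nonresonance for `k ≥ 2`.
        rcases lt_or_ge k 2 with hk2 | hk2
        · interval_cases k
          · have e1 := h.mean_zero m
            have e2 := h'.mean_zero m
            simp [cosCoeff, e1, e2]
          · rw [Nat.cast_one, one_pow, one_mul] at e
            obtain ⟨c, hc1⟩ := hker _ e.symm
            have e1 := h.orthogonal m hm
            have e2 := h'.orthogonal m hm
            rw [hQ0'] at e2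
            rw [hinner _ hc] at e1
            rw [hinner _ hc', ← e1] at e2
            have hpi := Real.pi_pos
            have e3 := mul_left_cancel₀ ha0.ne' (mul_left_cancel₀ (by positivity) e2)
            have e4 : u ⬝ᵥ (cosCoeff 1 (Q' m) - cosCoeff 1 (Q m)) = 0 := by
              rw [dotProduct_sub, e3, sub_self]
            rw [hc1, dotProduct_smul, smul_eq_mul] at e4
            have e5 : u ⬝ᵥ u = ∑ j, u j ^ 2 := by
              simp only [dotProduct, sq]
            rcases mul_eq_zero.1 e4 with e6 | e6
            · rw [hc1, e6, zero_smul]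
            · linarith
        · exact hres k hk2 _ e.symm
      have hD : ∀ j, (fun τ => Q' m τ j - Q m τ j) = 0 := by
        intro j
        refine eq_zero_of_integral_cos_eq_zero (by fun_prop) ?_ ?_ fun k => ?_
        · intro τ
          simp only [h.periodic m τ, h'.periodic m τ]
        · intro τ
          simp only [h.even m τ, h'.even m τ]
        · have e := congrFun (hzero k) j
          rw [← cosCoeff_sub k hc' hc, cosCoeff_apply k (by fun_prop)] at e
          simpa using e
      ext τ j
      have := congrFun (hD j) τ
      simp only [Pi.zero_apply] at this
      linarith
  exact ⟨funext fun m => (main m).1, funext fun m => (main m).2⟩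

end Uniqueness

/-! ### The chain matrix: rows, kernel, reflection, higher harmonics -/

section ChainMatrix

/-- A vector as a sequence, extended by zero. -/
def vecExt {d : ℕ} (v : Fin d → ℝ) (i : ℕ) : ℝ := if h : i < d then v ⟨i, h⟩ else 0

theorem vecExt_of_lt {d : ℕ} (v : Fin d → ℝ) {i : ℕ} (h : i < d) : vecExt v i = v ⟨i, h⟩ :=
  dif_pos h

theorem vecExt_val {d : ℕ} (v : Fin d → ℝ) (i : Fin d) : vecExt v i = v i :=
  dif_pos i.2

theorem vecExt_of_le {d : ℕ} (v : Fin d → ℝ) {i : ℕ} (h : d ≤ i) : vecExt v i = 0 :=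
  dif_neg (by omega)

theorem abs_vecExt_le {d : ℕ} (v : Fin d → ℝ) (i : ℕ) : |vecExt v i| ≤ ‖v‖ := by
  by_cases h : i < d
  · rw [vecExt_of_lt v h]
    exact norm_le_pi_norm v _
  · rw [vecExt_of_le v (by omega), abs_zero]
    exact norm_nonneg v

theorem vecExt_add {d : ℕ} (v w : Fin d → ℝ) (i : ℕ) :
    vecExt (v + w) i = vecExt v i + vecExt w i := by
  unfold vecExt
  split_ifs <;> simp

theorem vecExt_smul {d : ℕ} (c : ℝ) (v : Fin d → ℝ) (i : ℕ) :
    vecExt (c • v) i = c * vecExt v i := by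
  unfold vecExt
  split_ifs <;> simp

theorem vecExt_sub {d : ℕ} (v w : Fin d → ℝ) (i : ℕ) :
    vecExt (v - w) i = vecExt v i - vecExt w i := by
  unfold vecExt
  split_ifs <;> simp

theorem sum_ite_val_eq {d : ℕ} (a : ℕ) (c : ℝ) :
    ∑ j : Fin d, (if (j : ℕ) = a then c else 0) = if a < d then c else 0 := by
  rw [Fin.sum_univ_eq_sum_range (fun j => if j = a then c else 0) d, Finset.sum_ite_eq']
  simp

variable {n : ℕ} {k₁ k₂ k₃₁ k₃₂ : ℝ}

theorem bondStiffness_even (m : ℕ) : bondStiffness k₁ k₂ (2 * m) = k₁ := by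
  simp [bondStiffness]

theorem bondStiffness_odd (m : ℕ) : bondStiffness k₁ k₂ (2 * m + 1) = k₂ := by
  simp [bondStiffness]

/-- The missing right neighbour is handled by the extension by zero. The left one needs an explicit
case, since `i - 1` truncates to `0` at the first mass. -/
theorem chainMatrix_mulVec_apply (v : Fin (2 * n) → ℝ) (i : Fin (2 * n)) :
    (chainMatrix n k₁ k₂ k₃₁ k₃₂).mulVec v i =
      -(leftStiffness k₁ k₂ k₃₁ i + rightStiffness n k₁ k₂ k₃₂ i) * v i +
      (if (i : ℕ) = 0 then 0 else bondStiffness k₁ k₂ (i - 1) * vecExt v (i - 1)) +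
      bondStiffness k₁ k₂ i * vecExt v (i + 1) := by
  have e : ∀ j : Fin (2 * n), chainMatrix n k₁ k₂ k₃₁ k₃₂ i j * v j =
      (if (j : ℕ) = i then
        -(leftStiffness k₁ k₂ k₃₁ i + rightStiffness n k₁ k₂ k₃₂ i) * v i else 0) +
      (if (j : ℕ) = i - 1 then
        (if (i : ℕ) = 0 then 0 else bondStiffness k₁ k₂ (i - 1) * vecExt v (i - 1)) else 0) +
      (if (j : ℕ) = i + 1 then bondStiffness k₁ k₂ i * vecExt v (i + 1) else 0) := by
    intro j
    rw [chainMatrix, Matrix.of_apply]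
    by_cases h1 : i = j
    · subst h1
      by_cases h0 : (i : ℕ) = 0
      · simp [h0]
      · rw [if_pos rfl, if_pos rfl, if_neg (by omega), if_neg (by omega)]
        ring
    · have h1' : ¬ (j : ℕ) = i := fun h => h1 (Fin.ext h.symm)
      rw [if_neg h1, if_neg h1']
      by_cases h2 : (i : ℕ) + 1 = j
      · rw [if_pos h2, if_neg (by omega), if_pos h2.symm, h2, vecExt_val]
        ring
      · rw [if_neg h2, if_neg (by omega : ¬ (j : ℕ) = i + 1)]
        by_cases h3 : (j : ℕ) + 1 = i
        · have h4 : (i : ℕ) - 1 = j := by omega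
          rw [if_pos h3, h4, if_pos rfl, if_neg (by omega), vecExt_val]
          ring
        · rw [if_neg h3]
          by_cases h0 : (i : ℕ) = 0
          · simp [h0]
          · rw [if_neg (by omega)]
            ring
  simp only [Matrix.mulVec, dotProduct, e, Finset.sum_add_distrib, sum_ite_val_eq]
  rw [if_pos i.2, if_pos (by omega)]
  congr 1
  split_ifs with h
  · rfl
  · rw [vecExt_of_le v (by omega), mul_zero]

theorem chainMatrix_isSymm : (chainMatrix n k₁ k₂ k₃₁ k₃₂).IsSymm := by
  ext i j
  simp only [Matrix.transpose_apply, chainMatrix, Matrix.of_apply]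
  by_cases h1 : i = j
  · subst h1
    rfl
  · rw [if_neg h1, if_neg (Ne.symm h1)]
    by_cases h2 : (i : ℕ) + 1 = j
    · rw [if_pos h2, if_neg (by omega), if_pos h2]
    · rw [if_neg h2]
      by_cases h3 : (j : ℕ) + 1 = i
      · simp [h2, h3]
      · simp [h2, h3]

theorem dotProduct_mulVec_comm {d : ℕ} {L : Matrix (Fin d) (Fin d) ℝ} (hL : L.IsSymm)
    (v w : Fin d → ℝ) : L.mulVec v ⬝ᵥ w = v ⬝ᵥ L.mulVec w := by
  rw [Matrix.dotProduct_mulVec, ← Matrix.mulVec_transpose, hL.eq]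

theorem row_zero (hn : 1 ≤ n) {s : ℝ} {v h : Fin (2 * n) → ℝ}
    (hv : s • v + (chainMatrix n k₁ k₂ k₃₁ k₃₂).mulVec v = h) :
    (s - k₃₁ - k₁) * vecExt v 0 + k₁ * vecExt v 1 = vecExt h 0 := by
  have hi : 0 < 2 * n := by omega
  have e := congrFun hv ⟨0, hi⟩
  rw [Pi.add_apply, chainMatrix_mulVec_apply] at e
  rw [Pi.smul_apply, smul_eq_mul] at e
  simp only [leftStiffness, rightStiffness, if_true, zero_add,
    if_neg (show ¬ 1 = 2 * n by omega), ← vecExt_of_lt _ hi] at e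
  have := bondStiffness_even (k₁ := k₁) (k₂ := k₂) 0
  rw [mul_zero] at this
  rw [this] at e
  linarith

theorem row_even {s : ℝ} {v h : Fin (2 * n) → ℝ}
    (hv : s • v + (chainMatrix n k₁ k₂ k₃₁ k₃₂).mulVec v = h) {m : ℕ} (hm : m + 1 < n) :
    (s - k₁ - k₂) * vecExt v (2 * (m + 1)) + k₂ * vecExt v (2 * m + 1) +
      k₁ * vecExt v (2 * (m + 1) + 1) = vecExt h (2 * (m + 1)) := by
  have hi : 2 * (m + 1) < 2 * n := by omega
  have e := congrFun hv ⟨2 * (m + 1), hi⟩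
  rw [Pi.add_apply, chainMatrix_mulVec_apply] at e
  rw [Pi.smul_apply, smul_eq_mul] at e
  simp only [leftStiffness, rightStiffness,
    if_neg (show ¬ 2 * (m + 1) + 1 = 2 * n by omega), if_neg (show ¬ 2 * (m + 1) = 0 by omega),
    ← vecExt_of_lt _ hi, show 2 * (m + 1) - 1 = 2 * m + 1 by omega, bondStiffness_even,
    bondStiffness_odd] at e
  linarith

theorem row_odd {s : ℝ} {v h : Fin (2 * n) → ℝ}
    (hv : s • v + (chainMatrix n k₁ k₂ k₃₁ k₃₂).mulVec v = h) {m : ℕ} (hm : m + 1 < n) :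
    (s - k₁ - k₂) * vecExt v (2 * m + 1) + k₁ * vecExt v (2 * m) +
      k₂ * vecExt v (2 * (m + 1)) = vecExt h (2 * m + 1) := by
  have hi : 2 * m + 1 < 2 * n := by omega
  have e := congrFun hv ⟨2 * m + 1, hi⟩
  rw [Pi.add_apply, chainMatrix_mulVec_apply] at e
  rw [Pi.smul_apply, smul_eq_mul] at e
  simp only [leftStiffness, rightStiffness,
    if_neg (show ¬ 2 * (m + 1) = 2 * n by omega), if_neg (show ¬ 2 * m + 1 = 0 by omega),
    ← vecExt_of_lt _ hi, show 2 * m + 1 - 1 = 2 * m by omega, bondStiffness_even,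
    bondStiffness_odd, show 2 * m + 1 + 1 = 2 * (m + 1) by ring] at e
  linarith

theorem row_last {s : ℝ} {v h : Fin (2 * (n + 1)) → ℝ}
    (hv : s • v + (chainMatrix (n + 1) k₁ k₂ k₃₁ k₃₂).mulVec v = h) :
    (s - k₁ - k₃₂) * vecExt v (2 * n + 1) + k₁ * vecExt v (2 * n) = vecExt h (2 * n + 1) := by
  have hi : 2 * n + 1 < 2 * (n + 1) := by omega
  have e := congrFun hv ⟨2 * n + 1, hi⟩
  rw [Pi.add_apply, chainMatrix_mulVec_apply] at e
  rw [Pi.smul_apply, smul_eq_mul] at e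
  simp only [leftStiffness, rightStiffness,
    if_pos (show 2 * n + 1 + 1 = 2 * (n + 1) by omega), if_neg (show ¬ 2 * n + 1 = 0 by omega),
    ← vecExt_of_lt _ hi, show 2 * n + 1 - 1 = 2 * n by omega, bondStiffness_even,
    vecExt_of_le v (show 2 * (n + 1) ≤ 2 * n + 1 + 1 by omega)] at e
  linarith

theorem bondStiffness_pos (hk₁ : 0 < k₁) (hk₂ : k₁ < k₂) (i : ℕ) : 0 < bondStiffness k₁ k₂ i := by
  unfold bondStiffness
  split_ifs <;> linarith

/-- A vector that vanishes at the first mass and satisfies every row of the eigenvalue equation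
but the last is zero. -/
theorem eq_zero_of_rows (hk₁ : 0 < k₁) (hk₂ : k₁ < k₂) {s : ℝ} {v : Fin (2 * n) → ℝ}
    (hv : ∀ i, i + 1 < 2 * n →
      vecExt (s • v + (chainMatrix n k₁ k₂ k₃₁ k₃₂).mulVec v) i = 0)
    (h0 : vecExt v 0 = 0) : v = 0 := by
  have h : ∀ i, vecExt v i = 0 := by
    intro i
    induction i using Nat.strong_induction_on with
    | _ i ih =>
      rcases i with _ | i
      · exact h0
      by_cases hi : i + 1 < 2 * n
      · have hi' : i < 2 * n := by omega
        have e := hv i hi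
        rw [vecExt_of_lt _ hi', Pi.add_apply, chainMatrix_mulVec_apply, Pi.smul_apply,
          ← vecExt_of_lt v hi'] at e
        simp only [ih i (by omega), ih (i - 1) (by omega), mul_zero, smul_zero, ite_self,
          zero_add] at e
        exact (mul_eq_zero.1 e).resolve_left (bondStiffness_pos hk₁ hk₂ i).ne'
      · exact vecExt_of_le v (by omega)
  ext i
  rw [← vecExt_val v i, h, Pi.zero_apply]

theorem eq_zero_of_apply_zero (hk₁ : 0 < k₁) (hk₂ : k₁ < k₂) {s : ℝ} {v : Fin (2 * n) → ℝ}
    (hv : s • v + (chainMatrix n k₁ k₂ k₃₁ k₃₂).mulVec v = 0) (h0 : vecExt v 0 = 0) : v = 0 :=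
  eq_zero_of_rows hk₁ hk₂ (fun i _ => by rw [hv]; simp [vecExt]) h0

/-- The kernel is at most one-dimensional. -/
theorem exists_smul_of_mem_ker (hk₁ : 0 < k₁) (hk₂ : k₁ < k₂) {s : ℝ} {u v : Fin (2 * n) → ℝ}
    (hu : s • u + (chainMatrix n k₁ k₂ k₃₁ k₃₂).mulVec u = 0) (hu0 : u ≠ 0)
    (hv : s • v + (chainMatrix n k₁ k₂ k₃₁ k₃₂).mulVec v = 0) : ∃ c : ℝ, v = c • u := by
  have h0 : vecExt u 0 ≠ 0 := fun h => hu0 (eq_zero_of_apply_zero hk₁ hk₂ hu h)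
  refine ⟨vecExt v 0 / vecExt u 0, ?_⟩
  rw [← sub_eq_zero]
  refine eq_zero_of_apply_zero (s := s) (k₃₁ := k₃₁) (k₃₂ := k₃₂) hk₁ hk₂ ?_ ?_
  · rw [smul_sub, Matrix.mulVec_sub, Matrix.mulVec_smul, smul_comm s, sub_add_sub_comm, hv,
      ← smul_add, hu, smul_zero, sub_zero]
  · rw [vecExt_sub, vecExt_smul]
    field_simp
    ring

/-- The `2n - 1` inner bonds alternate and begin and end with `k₁`, so reflection only exchanges the
walls. Statements about the right end thereby follow from those about the left. -/
theorem chainMatrix_rev (i j : Fin (2 * n)) :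
    chainMatrix n k₁ k₂ k₃₂ k₃₁ i.rev j.rev = chainMatrix n k₁ k₂ k₃₁ k₃₂ i j := by
  have hb : ∀ a b : ℕ, a + b + 2 = 2 * n → bondStiffness k₁ k₂ a = bondStiffness k₁ k₂ b := by
    intro a b hab
    unfold bondStiffness
    have : Even a ↔ Even b := by
      rw [Nat.even_iff, Nat.even_iff]
      omega
    simp only [this]
  have hi := i.2
  have hj := j.2
  simp only [chainMatrix, Matrix.of_apply, Fin.rev_inj, Fin.val_rev]
  split_ifs with h1 h2 h3 h4 h5 h6 h7
  · subst h1
    rw [add_comm (leftStiffness _ _ _ _)]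
    congr 2
    · unfold rightStiffness leftStiffness
      split_ifs
      · rfl
      · omega
      · omega
      · exact hb _ _ (by omega)
    · unfold rightStiffness leftStiffness
      split_ifs
      · rfl
      · omega
      · omega
      · exact hb _ _ (by omega)
  all_goals first | omega | rfl | exact hb _ _ (by omega)

theorem chainMatrix_mulVec_rev (v : Fin (2 * n) → ℝ) :
    (chainMatrix n k₁ k₂ k₃₂ k₃₁).mulVec (v ∘ Fin.rev) =
      (chainMatrix n k₁ k₂ k₃₁ k₃₂).mulVec v ∘ Fin.rev := by
  ext i
  simp only [Matrix.mulVec, dotProduct, Function.comp_apply]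
  rw [← Equiv.sum_comp Fin.revPerm]
  refine Finset.sum_congr rfl fun j _ => ?_
  rw [Fin.revPerm_apply, Fin.rev_rev, ← chainMatrix_rev i.rev j, Fin.rev_rev]

/-- The hypothesis makes `(2 k₁ + 2 k₂) + L` positive semidefinite, so its diagonal is nonnegative.
The resulting bounds on the wall springs make all later constants uniform in them. -/
theorem NoFrequencyAboveOpticalBand.diag_le
    (h : NoFrequencyAboveOpticalBand n k₁ k₂ k₃₁ k₃₂) (i : Fin (2 * n)) :
    leftStiffness k₁ k₂ k₃₁ i + rightStiffness n k₁ k₂ k₃₂ i ≤ 2 * k₁ + 2 * k₂ := by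
  set L := chainMatrix n k₁ k₂ k₃₁ k₃₂ with hL
  set A : Matrix (Fin (2 * n)) (Fin (2 * n)) ℝ := (2 * k₁ + 2 * k₂) • (1 : Matrix _ _ ℝ) + L with hA
  have hherm : A.IsHermitian := by
    rw [Matrix.IsHermitian, Matrix.conjTranspose_eq_transpose_of_trivial, hA,
      Matrix.transpose_add, Matrix.transpose_smul, Matrix.transpose_one, hL, chainMatrix_isSymm.eq]
  have hpsd : A.PosSemidef := by
    rw [hherm.posSemidef_iff_eigenvalues_nonneg]
    intro j
    have e := hherm.mulVec_eigenvectorBasis j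
    set v : Fin (2 * n) → ℝ := (hherm.eigenvectorBasis j).ofLp with hv
    have hv0 : v ≠ 0 := by
      intro h0
      apply hherm.eigenvectorBasis.toBasis.ne_zero j
      rw [OrthonormalBasis.coe_toBasis]
      ext i
      exact congrFun h0 i
    have e' : A.mulVec v = (2 * k₁ + 2 * k₂) • v + L.mulVec v := by
      rw [hA, Matrix.add_mulVec, Matrix.smul_mulVec, Matrix.one_mulVec]
    rw [e'] at e
    have := h (2 * k₁ + 2 * k₂ - hherm.eigenvalues j) v hv0 (by
      rw [neg_sub, sub_smul, ← e, hL]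
      module)
    simpa using this
  have hd := hpsd.diag_nonneg (i := i)
  simp only [hA, hL, Matrix.add_apply, Matrix.smul_apply, Matrix.one_apply_eq, chainMatrix,
    Matrix.of_apply, if_true, smul_eq_mul, mul_one] at hd
  linarith

theorem NoFrequencyAboveOpticalBand.left_le (hn : 1 ≤ n)
    (h : NoFrequencyAboveOpticalBand n k₁ k₂ k₃₁ k₃₂) : k₃₁ ≤ k₁ + 2 * k₂ := by
  have := h.diag_le ⟨0, by omega⟩
  simp only [leftStiffness, rightStiffness, if_true, zero_add,
    if_neg (show ¬ 1 = 2 * n by omega)] at this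
  have e := bondStiffness_even (k₁ := k₁) (k₂ := k₂) 0
  rw [mul_zero] at e
  linarith

theorem NoFrequencyAboveOpticalBand.right_le (hn : 1 ≤ n)
    (h : NoFrequencyAboveOpticalBand n k₁ k₂ k₃₁ k₃₂) : k₃₂ ≤ k₁ + 2 * k₂ := by
  obtain ⟨n, rfl⟩ := Nat.exists_eq_succ_of_ne_zero (show n ≠ 0 by omega)
  have := h.diag_le ⟨2 * n + 1, by omega⟩
  simp only [leftStiffness, rightStiffness, Nat.succ_eq_add_one,
    if_neg (show ¬ 2 * n + 1 = 0 by omega), if_pos (show 2 * n + 1 + 1 = 2 * (n + 1) by ring),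
    show 2 * n + 1 - 1 = 2 * n by omega, bondStiffness_even] at this
  linarith

/-- Diagonal dominance at the higher harmonics. -/
theorem norm_le_of_higher_harmonic (hn : 1 ≤ n) (hk₁ : 0 < k₁) (hk₂ : k₁ < k₂)
    (h₃₁ : 0 ≤ k₃₁) (h₃₂ : 0 ≤ k₃₂) (h₃₁' : k₃₁ ≤ k₁ + 2 * k₂) (h₃₂' : k₃₂ ≤ k₁ + 2 * k₂) {s : ℝ} (hs : 2 * k₂ < s) {k : ℕ}
    (hk : 2 ≤ k) {v h : Fin (2 * n) → ℝ}
    (hv : ((k : ℝ) ^ 2 * s) • v + (chainMatrix n k₁ k₂ k₃₁ k₃₂).mulVec v = h) :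
    3 / 4 * k₂ * ((k : ℝ) ^ 2 * ‖v‖) ≤ ‖h‖ := by
  have : Nonempty (Fin (2 * n)) := ⟨⟨0, by omega⟩⟩
  -- The row at an entry of largest modulus carries the estimate.
  obtain ⟨i, hi⟩ := Finite.exists_max fun i => |v i|
  have hvi : ‖v‖ = |v i| :=
    le_antisymm ((pi_norm_le_iff_of_nonneg (abs_nonneg _)).2 hi) (norm_le_pi_norm v i)
  have e := congrFun hv i
  rw [Pi.add_apply, chainMatrix_mulVec_apply, Pi.smul_apply, smul_eq_mul] at e
  have hb := bondStiffness_pos hk₁ hk₂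
  have hbs : ∀ j, bondStiffness k₁ k₂ j + bondStiffness k₁ k₂ (j + 1) = k₁ + k₂ := by
    intro j
    rcases Nat.even_or_odd' j with ⟨m, rfl | rfl⟩
    · rw [bondStiffness_even, bondStiffness_odd]
    · rw [show 2 * m + 1 + 1 = 2 * (m + 1) by ring, bondStiffness_even, bondStiffness_odd]
      ring
  have hk4 : (4 : ℝ) ≤ (k : ℝ) ^ 2 := by
    have : (2 : ℝ) ≤ k := by exact_mod_cast hk
    nlinarith
  set l := leftStiffness k₁ k₂ k₃₁ i with hl
  set r := rightStiffness n k₁ k₂ k₃₂ i with hr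
  set P := (if (i : ℕ) = 0 then 0 else bondStiffness k₁ k₂ (i - 1) * vecExt v (i - 1)) with hP
  set R := bondStiffness k₁ k₂ i * vecExt v (i + 1) with hR
  have hRle : |R| ≤ bondStiffness k₁ k₂ i * ‖v‖ := by
    rw [hR, abs_mul, abs_of_pos (hb _)]
    exact mul_le_mul_of_nonneg_left (abs_vecExt_le _ _) (hb _).le
  -- Interior rows give `2 (k₁ + k₂)`; wall rows give at most `(k₁ + 2 k₂) + 2 k₁`. Both are below
  -- `5 k₂`, and since `k² ≥ 4` this is at most `5/4 k² k₂`, leaving `3/4` of the available `2 k²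
  -- k₂`.
  have hsum : (l + r) * ‖v‖ + |P| + |R| ≤ 5 * k₂ * ‖v‖ := by
    have hv0 := norm_nonneg v
    by_cases h0 : (i : ℕ) = 0
    · have hb0 := bondStiffness_even (k₁ := k₁) (k₂ := k₂) 0
      rw [mul_zero] at hb0
      have e1 : l = k₃₁ := by simp [hl, leftStiffness, h0]
      have e2 : r = k₁ := by
        rw [hr, rightStiffness, if_neg (by omega), h0, hb0]
      have e3 : P = 0 := by rw [hP, if_pos h0]
      rw [h0, hb0] at hRle
      rw [e1, e2, e3, abs_zero]
      nlinarith
    · have hPle : |P| ≤ bondStiffness k₁ k₂ (i - 1) * ‖v‖ := by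
        rw [hP, if_neg h0, abs_mul, abs_of_pos (hb _)]
        exact mul_le_mul_of_nonneg_left (abs_vecExt_le _ _) (hb _).le
      have e1 : l = bondStiffness k₁ k₂ (i - 1) := by rw [hl, leftStiffness, if_neg h0]
      have e3 := hbs (i - 1)
      rw [Nat.sub_add_cancel (by omega)] at e3
      by_cases hlast : (i : ℕ) + 1 = 2 * n
      · have e2 : r = k₃₂ := by rw [hr, rightStiffness, if_pos hlast]
        have e4 : bondStiffness k₁ k₂ (i - 1) = k₁ := by
          rw [show (i : ℕ) - 1 = 2 * (n - 1) by omega, bondStiffness_even]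
        have e5 : R = 0 := by rw [hR, vecExt_of_le v (by omega), mul_zero]
        rw [e1, e2, e5, e4, abs_zero]
        rw [e4] at hPle
        nlinarith
      · have e2 : r = bondStiffness k₁ k₂ i := by rw [hr, rightStiffness, if_neg hlast]
        rw [e1, e2, e3]
        have : |P| + |R| ≤ (k₁ + k₂) * ‖v‖ := by
          rw [← e3, add_mul]
          exact add_le_add hPle hRle
        nlinarith
  have hhi : |h i| ≤ ‖h‖ := norm_le_pi_norm h i
  have e6 : (k : ℝ) ^ 2 * s * v i = h i + (l + r) * v i - P - R := by linarith
  have e7 : (k : ℝ) ^ 2 * s * |v i| ≤ |h i| + |(l + r) * v i| + |P| + |R| := by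
    rw [← abs_of_pos (show 0 < (k : ℝ) ^ 2 * s by nlinarith), ← abs_mul, e6]
    have := abs_sub (h i + (l + r) * v i - P) R
    have := abs_sub (h i + (l + r) * v i) P
    have := abs_add_le (h i) ((l + r) * v i)
    linarith
  have hl0 : 0 ≤ l := by
    rw [hl, leftStiffness]
    split_ifs
    exacts [h₃₁, (hb _).le]
  have hr0 : 0 ≤ r := by
    rw [hr, rightStiffness]
    split_ifs
    exacts [h₃₂, (hb _).le]
  rw [abs_mul, abs_of_nonneg (add_nonneg hl0 hr0), ← hvi] at e7
  have hv0 := norm_nonneg v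
  have h6 : (k : ℝ) ^ 2 * (2 * k₂) * ‖v‖ ≤ (k : ℝ) ^ 2 * s * ‖v‖ := by gcongr
  have h7 : 4 * (k₂ * ‖v‖) ≤ (k : ℝ) ^ 2 * (k₂ * ‖v‖) :=
    mul_le_mul_of_nonneg_right hk4 (by nlinarith)
  linarith

end ChainMatrix

/-! ### A multiplicative norm measuring the variation of the envelope -/

section EnvelopeSeminorm

variable {d : ℕ}

/-- The sign pattern `+ + - - + + ⋯` of the mode at the lower edge of the optical band. -/
def edgeSign (i : ℕ) : ℝ := (-1) ^ (i / 2)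

theorem edgeSign_mul_self (i : ℕ) : edgeSign i * edgeSign i = 1 := by
  rw [edgeSign, ← mul_pow]
  norm_num

theorem abs_edgeSign (i : ℕ) : |edgeSign i| = 1 := by
  rw [edgeSign, abs_pow]
  norm_num

theorem edgeSign_two_mul (m : ℕ) : edgeSign (2 * m) = (-1) ^ m := by
  rw [edgeSign]
  congr 1
  omega

theorem edgeSign_two_mul_add_one (m : ℕ) : edgeSign (2 * m + 1) = (-1) ^ m := by
  rw [edgeSign]
  congr 1
  omega

/-- The differences of consecutive entries of the envelope of a vector. -/
def envelopeDiff (v : Fin d → ℝ) : Fin d → ℝ := fun i =>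
  if (i : ℕ) + 1 < d then edgeSign (i + 1) * vecExt v (i + 1) - edgeSign i * vecExt v i else 0

theorem envelopeDiff_add (v w : Fin d → ℝ) :
    envelopeDiff (v + w) = envelopeDiff v + envelopeDiff w := by
  ext i
  simp only [envelopeDiff, Pi.add_apply, vecExt_add]
  split_ifs <;> ring

theorem envelopeDiff_smul (c : ℝ) (v : Fin d → ℝ) :
    envelopeDiff (c • v) = c • envelopeDiff v := by
  ext i
  simp only [envelopeDiff, Pi.smul_apply, vecExt_smul, smul_eq_mul]
  split_ifs <;> ring

/-- The largest difference of consecutive entries of the envelope. -/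
noncomputable def envelopeLip : Seminorm ℝ (Fin d → ℝ) :=
  Seminorm.of (fun v => ‖envelopeDiff v‖)
    (fun v w => by rw [envelopeDiff_add]; exact norm_add_le _ _)
    (fun c v => by rw [envelopeDiff_smul, norm_smul])

theorem envelopeLip_apply (v : Fin d → ℝ) : envelopeLip v = ‖envelopeDiff v‖ := rfl

theorem abs_envelope_sub_le (v : Fin d → ℝ) {i : ℕ} (hi : i + 1 < d) :
    |edgeSign (i + 1) * vecExt v (i + 1) - edgeSign i * vecExt v i| ≤ envelopeLip v := by
  have h := norm_le_pi_norm (envelopeDiff v) ⟨i, by omega⟩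
  rw [envelopeLip_apply]
  simpa [envelopeDiff, hi] using h

theorem envelopeLip_le {v : Fin d → ℝ} {C : ℝ} (hC : 0 ≤ C) (h : ∀ i, i + 1 < d →
    |edgeSign (i + 1) * vecExt v (i + 1) - edgeSign i * vecExt v i| ≤ C) : envelopeLip v ≤ C := by
  rw [envelopeLip_apply, pi_norm_le_iff_of_nonneg hC]
  intro i
  simp only [envelopeDiff]
  split_ifs with hi
  · exact h i hi
  · simpa using hC

theorem envelopeLip_le_two_mul_norm (v : Fin d → ℝ) : envelopeLip v ≤ 2 * ‖v‖ := by
  refine envelopeLip_le (by positivity) fun i _ => ?_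
  refine (abs_sub _ _).trans ?_
  rw [abs_mul, abs_mul, abs_edgeSign, abs_edgeSign]
  linarith [abs_vecExt_le v i, abs_vecExt_le v (i + 1)]

theorem vecExt_mul (v w : Fin d → ℝ) (i : ℕ) : vecExt (v * w) i = vecExt v i * vecExt w i := by
  unfold vecExt
  split_ifs <;> simp

/-- The cube of a sign is that sign, so the envelope of a triple product is the product of the
envelopes and the Leibniz rule for differences applies. A product of two factors would not behave
this way. -/
theorem envelopeLip_mul_le (a b c : Fin d → ℝ) : envelopeLip (a * b * c) ≤
    envelopeLip a * ‖b‖ * ‖c‖ + ‖a‖ * envelopeLip b * ‖c‖ + ‖a‖ * ‖b‖ * envelopeLip c := by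
  have hL : ∀ v : Fin d → ℝ, 0 ≤ envelopeLip v := fun v => apply_nonneg _ _
  refine envelopeLip_le (by have := hL a; have := hL b; have := hL c; positivity) fun i hi => ?_
  have ha := abs_envelope_sub_le a hi
  have hb := abs_envelope_sub_le b hi
  have hc := abs_envelope_sub_le c hi
  have key : ∀ (v : Fin d → ℝ) j, |edgeSign j * vecExt v j| ≤ ‖v‖ := by
    intro v j
    rw [abs_mul, abs_edgeSign, one_mul]
    exact abs_vecExt_le v j
  have hcube : ∀ j, edgeSign j * vecExt (a * b * c) j =
      (edgeSign j * vecExt a j) * (edgeSign j * vecExt b j) * (edgeSign j * vecExt c j) := by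
    intro j
    rw [vecExt_mul, vecExt_mul]
    linear_combination (-(edgeSign j * vecExt a j * vecExt b j * vecExt c j)) * edgeSign_mul_self j
  rw [hcube, hcube]
  set a1 := edgeSign (i + 1) * vecExt a (i + 1)
  set b1 := edgeSign (i + 1) * vecExt b (i + 1) with hb1
  set c1 := edgeSign (i + 1) * vecExt c (i + 1) with hc1
  set a0 := edgeSign i * vecExt a i with ha0
  set b0 := edgeSign i * vecExt b i with hb0
  set c0 := edgeSign i * vecExt c i
  have e : a1 * b1 * c1 - a0 * b0 * c0 =
      (a1 - a0) * b1 * c1 + a0 * (b1 - b0) * c1 + a0 * b0 * (c1 - c0) := by ring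
  rw [e]
  refine (abs_add_le _ _).trans (add_le_add ((abs_add_le _ _).trans (add_le_add ?_ ?_)) ?_) <;>
    rw [abs_mul, abs_mul]
  · exact mul_le_mul (mul_le_mul ha (key b _) (abs_nonneg _) (hL a)) (key c _) (abs_nonneg _)
      (mul_nonneg (hL a) (norm_nonneg _))
  · exact mul_le_mul (mul_le_mul (key a _) hb (abs_nonneg _) (norm_nonneg _)) (key c _)
      (abs_nonneg _) (mul_nonneg (norm_nonneg _) (hL b))
  · exact mul_le_mul (mul_le_mul (key a _) (key b _) (abs_nonneg _) (norm_nonneg _)) hc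
      (abs_nonneg _) (mul_nonneg (norm_nonneg _) (norm_nonneg _))

/-- The norm `‖v‖ + c Lip v`, where `Lip v` measures the variation of the envelope. -/
noncomputable def envelopeNorm (c : NNReal) : Seminorm ℝ (Fin d → ℝ) :=
  normSeminorm ℝ (Fin d → ℝ) + c • envelopeLip

theorem envelopeNorm_apply (c : NNReal) (v : Fin d → ℝ) :
    envelopeNorm c v = ‖v‖ + c * envelopeLip v := rfl

theorem norm_le_envelopeNorm (c : NNReal) (v : Fin d → ℝ) : ‖v‖ ≤ envelopeNorm c v := by
  rw [envelopeNorm_apply]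
  have := apply_nonneg (envelopeLip (d := d)) v
  have : 0 ≤ c * envelopeLip v := by positivity
  linarith

/-- The product of the three norms contains the Leibniz terms, and what is left over is nonnegative.
No constant is lost, whatever the weight `γ`. -/
theorem envelopeNorm_mul_le (γ : NNReal) (a b c : Fin d → ℝ) :
    envelopeNorm γ (a * b * c) ≤ envelopeNorm γ a * envelopeNorm γ b * envelopeNorm γ c := by
  simp only [envelopeNorm_apply]
  have hL : ∀ v : Fin d → ℝ, 0 ≤ γ * envelopeLip v := fun v =>
    mul_nonneg γ.2 (apply_nonneg _ _)
  have h1 := mul_le_mul_of_nonneg_left (envelopeLip_mul_le a b c) γ.2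
  have h2 : ‖a * b * c‖ ≤ ‖a‖ * ‖b‖ * ‖c‖ :=
    (norm_mul_le _ _).trans (mul_le_mul_of_nonneg_right (norm_mul_le _ _) (norm_nonneg _))
  have ha := hL a
  have hb := hL b
  have hc := hL c
  have na := norm_nonneg a
  have nb := norm_nonneg b
  have nc := norm_nonneg c
  set A := γ * envelopeLip a
  set B := γ * envelopeLip b
  set C := γ * envelopeLip c
  have h3 : (γ : ℝ) * (envelopeLip a * ‖b‖ * ‖c‖ + ‖a‖ * envelopeLip b * ‖c‖ +
      ‖a‖ * ‖b‖ * envelopeLip c) = A * ‖b‖ * ‖c‖ + ‖a‖ * B * ‖c‖ + ‖a‖ * ‖b‖ * C := by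
    simp only [A, B, C]
    ring
  have h4 : γ * envelopeLip (a * b * c) ≤ A * ‖b‖ * ‖c‖ + ‖a‖ * B * ‖c‖ + ‖a‖ * ‖b‖ * C :=
    h1.trans_eq h3
  have h5 : 0 ≤ A * B * ‖c‖ + A * ‖b‖ * C + ‖a‖ * B * C + A * B * C := by positivity
  linear_combination h2 + h4 + h5

theorem vecExt_rev (v : Fin d → ℝ) {i : ℕ} (hi : i < d) :
    vecExt (v ∘ Fin.rev) i = vecExt v (d - 1 - i) := by
  rw [vecExt_of_lt _ hi, vecExt_of_lt _ (by omega), Function.comp_apply]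
  congr 1
  ext
  simp only [Fin.val_rev]
  omega

theorem norm_comp_rev (v : Fin d → ℝ) : ‖v ∘ Fin.rev‖ = ‖v‖ := by
  have h : ∀ w : Fin d → ℝ, ‖w ∘ Fin.rev‖ ≤ ‖w‖ := fun w =>
    (pi_norm_le_iff_of_nonneg (norm_nonneg w)).2 fun i => norm_le_pi_norm w _
  refine le_antisymm (h v) ?_
  have := h (v ∘ Fin.rev)
  rwa [Function.comp_assoc, Fin.rev_involutive.comp_self, Function.comp_id] at this

/-- Reversal changes the sign pattern by the global factor `(-1) ^ (n - 1)` only. -/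
theorem envelopeLip_comp_rev {n : ℕ} (v : Fin (2 * n) → ℝ) :
    envelopeLip (v ∘ Fin.rev) = envelopeLip v := by
  have h : ∀ w : Fin (2 * n) → ℝ, envelopeLip (w ∘ Fin.rev) ≤ envelopeLip w := by
    intro w
    refine envelopeLip_le (apply_nonneg _ _) fun i hi => ?_
    rw [vecExt_rev w hi, vecExt_rev w (show i < 2 * n by omega)]
    have hs : ∀ j, j < 2 * n → edgeSign j = (-1) ^ (n - 1) * edgeSign (2 * n - 1 - j) := by
      intro j hj
      rw [edgeSign, edgeSign, ← pow_add]
      refine neg_one_pow_congr ?_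
      rw [Nat.even_iff, Nat.even_iff]
      omega
    obtain ⟨k, hk⟩ : ∃ k, k + 1 = 2 * n - 1 - i := ⟨2 * n - 1 - i - 1, by omega⟩
    have hk' : 2 * n - 1 - (i + 1) = k := by omega
    rw [hs i (by omega), hs (i + 1) hi, hk', ← hk, mul_assoc, mul_assoc, ← mul_sub, abs_mul,
      abs_pow, abs_neg, abs_one, one_pow, one_mul, abs_sub_comm]
    exact abs_envelope_sub_le w (by omega)
  refine le_antisymm (h v) ?_
  have := h (v ∘ Fin.rev)
  rwa [Function.comp_assoc, Fin.rev_involutive.comp_self, Function.comp_id] at this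

end EnvelopeSeminorm

/-! ### Explicit waves and the characteristic equation -/

section Wave

open Real

/-- The envelope on the even sublattice of a solution of the linear chain away from the right
wall. -/
noncomputable def waveSeq (β φ : ℝ) (m : ℕ) : ℝ := sin ((m + 1) * φ) - β * sin (m * φ)

theorem waveSeq_rec (β φ : ℝ) (m : ℕ) :
    waveSeq β φ (m + 2) + waveSeq β φ m = 2 * cos φ * waveSeq β φ (m + 1) := by
  have g : ∀ x, sin (x + φ) + sin (x - φ) = 2 * cos φ * sin x := by
    intro x
    rw [sin_add, sin_sub]
    ring
  have g1 := g ((m + 1 + 1) * φ)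
  have g2 := g ((m + 1) * φ)
  simp only [waveSeq]
  push_cast
  rw [show ((m : ℝ) + 2 + 1) * φ = (m + 1 + 1) * φ + φ by ring,
    show ((m : ℝ) + 2) * φ = (m + 1) * φ + φ by ring,
    show (m : ℝ) * φ = (m + 1) * φ - φ by ring]
  rw [show ((m : ℝ) + 1 + 1) * φ - φ = (m + 1) * φ by ring] at g1
  linear_combination g1 - β * g2

/-- The vector that satisfies every row of the eigenvalue equation but the last. -/
noncomputable def leftWave (n : ℕ) (k₁ k₂ D β φ : ℝ) : Fin (2 * n) → ℝ := fun i =>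
  edgeSign i * if Even (i : ℕ) then waveSeq β φ (i / 2)
    else (k₂ * waveSeq β φ (i / 2 + 1) - k₁ * waveSeq β φ (i / 2)) / D

variable {n : ℕ} {k₁ k₂ k₃₁ k₃₂ D β φ δ : ℝ}

theorem vecExt_leftWave_even {m : ℕ} (hm : m < n) :
    vecExt (leftWave n k₁ k₂ D β φ) (2 * m) = (-1) ^ m * waveSeq β φ m := by
  rw [vecExt_of_lt _ (by omega), leftWave]
  simp only [edgeSign_two_mul, even_two_mul, if_true]
  rw [Nat.mul_div_cancel_left _ two_pos]

theorem vecExt_leftWave_odd {m : ℕ} (hm : m < n) :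
    vecExt (leftWave n k₁ k₂ D β φ) (2 * m + 1) =
      (-1) ^ m * ((k₂ * waveSeq β φ (m + 1) - k₁ * waveSeq β φ m) / D) := by
  rw [vecExt_of_lt _ (by omega), leftWave]
  have h : (2 * m + 1) / 2 = m := by omega
  have h' : ¬ Even (2 * m + 1) := by simp
  simp only [edgeSign_two_mul_add_one, h, if_neg h']

/-- The first row determines `β`, odd rows define the odd entries, and the remaining even rows
reduce to the recurrence of `waveSeq` by the dispersion relation. -/
theorem leftWave_row (hk₁ : 0 < k₁) (hD : D ≠ 0) (hk₂ : k₂ ≠ 0)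
    (hD2 : D ^ 2 = k₁ ^ 2 + k₂ ^ 2 - 2 * k₁ * k₂ * cos φ)
    (hβ : β = (D * (k₂ - k₃₁) + k₂ ^ 2) / (k₁ * k₂)) (i : ℕ) (hi : i + 1 < 2 * n) :
    vecExt ((D + k₁ + k₂) • leftWave n k₁ k₂ D β φ +
      (chainMatrix n k₁ k₂ k₃₁ k₃₂).mulVec (leftWave n k₁ k₂ D β φ)) i = 0 := by
  rcases Nat.even_or_odd' i with ⟨m, rfl | rfl⟩
  · rcases m with _ | m
    · have e := row_zero (by omega) (rfl : (D + k₁ + k₂) • leftWave n k₁ k₂ D β φ +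
        (chainMatrix n k₁ k₂ k₃₁ k₃₂).mulVec (leftWave n k₁ k₂ D β φ) = _)
      have e0 := vecExt_leftWave_even (k₁ := k₁) (k₂ := k₂) (D := D) (β := β) (φ := φ)
        (show 0 < n by omega)
      have e1 := vecExt_leftWave_odd (k₁ := k₁) (k₂ := k₂) (D := D) (β := β) (φ := φ)
        (show 0 < n by omega)
      rw [mul_zero] at e0 e1 ⊢
      rw [zero_add] at e1
      rw [← e, e0, e1]
      have hw0 : waveSeq β φ 0 = sin φ := by simp [waveSeq]
      have hw1 : waveSeq β φ (0 + 1) = sin φ * (2 * cos φ - β) := by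
        simp only [waveSeq]
        push_cast
        rw [show ((1 : ℝ) + 1) * φ = 2 * φ by ring, sin_two_mul, one_mul]
        ring
      have hβ' : β * (k₁ * k₂) = D * (k₂ - k₃₁) + k₂ ^ 2 := by
        rw [hβ]
        field_simp
      rw [hw0, hw1]
      field_simp
      linear_combination (sin φ) * hD2 - (sin φ) * hβ'
    · have e := row_even (rfl : (D + k₁ + k₂) • leftWave n k₁ k₂ D β φ +
        (chainMatrix n k₁ k₂ k₃₁ k₃₂).mulVec (leftWave n k₁ k₂ D β φ) = _)
        (show m + 1 < n by omega)
      rw [← e, vecExt_leftWave_even (by omega), vecExt_leftWave_odd (by omega),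
        vecExt_leftWave_odd (by omega)]
      have h := waveSeq_rec β φ m
      have h' : waveSeq β φ (m + 1 + 1) = 2 * cos φ * waveSeq β φ (m + 1) - waveSeq β φ m := by
        linarith
      rw [h', pow_succ]
      field_simp
      linear_combination (-waveSeq β φ (m + 1) * (-1) ^ m) * hD2
  · have e := row_odd (rfl : (D + k₁ + k₂) • leftWave n k₁ k₂ D β φ +
      (chainMatrix n k₁ k₂ k₃₁ k₃₂).mulVec (leftWave n k₁ k₂ D β φ) = _)
      (show m + 1 < n by omega)
    rw [← e, vecExt_leftWave_even (by omega), vecExt_leftWave_odd (by omega),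
      vecExt_leftWave_even (by omega), pow_succ]
    field_simp
    ring

/-- The residual of the last row. -/
noncomputable def rightResidual (n : ℕ) (k₁ k₂ k₃₂ D β φ : ℝ) : ℝ :=
  k₂ * (D + k₂ - k₃₂) * waveSeq β φ (n + 1) - k₁ * (k₂ - k₃₂) * waveSeq β φ n

theorem leftWave_last_row (hD : D ≠ 0) :
    vecExt ((D + k₁ + k₂) • leftWave (n + 1) k₁ k₂ D β φ +
      (chainMatrix (n + 1) k₁ k₂ k₃₁ k₃₂).mulVec (leftWave (n + 1) k₁ k₂ D β φ)) (2 * n + 1) =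
      (-1) ^ n * (rightResidual n k₁ k₂ k₃₂ D β φ / D) := by
  have e := row_last (rfl : (D + k₁ + k₂) • leftWave (n + 1) k₁ k₂ D β φ +
      (chainMatrix (n + 1) k₁ k₂ k₃₁ k₃₂).mulVec (leftWave (n + 1) k₁ k₂ D β φ) = _)
  rw [← e, vecExt_leftWave_even (by omega), vecExt_leftWave_odd (by omega), rightResidual]
  field_simp
  ring

/-- The coefficient of `sin (n φ)` in the residual of the last row. -/
noncomputable def sinCoeff (k₁ k₂ k₃₂ D β c : ℝ) : ℝ :=
  (k₂ * (D + k₂ - k₃₂) + β * (k₁ * (k₂ - k₃₂))) * c - k₂ * (D + k₂ - k₃₂) * β - k₁ * (k₂ - k₃₂)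

/-- Expansion about the phase `(n + 1) φ`, where `n + 1` is the number of cells. Near the band edge
the first term dominates, because the second carries the small factor `sin φ`. -/
theorem rightResidual_eq : rightResidual n k₁ k₂ k₃₂ D β φ =
    sinCoeff k₁ k₂ k₃₂ D β (cos φ) * sin ((n + 1 : ℕ) * φ) +
      (k₂ * (D + k₂ - k₃₂) - k₁ * (k₂ - k₃₂) * β) * sin φ * cos ((n + 1 : ℕ) * φ) := by
  simp only [rightResidual, sinCoeff, waveSeq]
  push_cast
  have h1 : ((n : ℝ) + 1 + 1) * φ = (n + 1) * φ + φ := by ring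
  have h2 : (n : ℝ) * φ = (n + 1) * φ - φ := by ring
  rw [h1, h2, sin_add, sin_sub]
  ring

/-- The limit of `sinCoeff` at the lower edge of the band. -/
noncomputable def edgeSinCoeff (k₁ k₂ k₃₁ k₃₂ : ℝ) : ℝ :=
  -((k₂ - k₁) ^ 2 * (2 * k₂ - k₃₂) * (2 * k₂ - k₃₁) / (k₁ * k₂))

/-- The distance `δ` from `2 k₂` enters here: a wall spring equal to `2 k₂` would cancel the leading
term of the characteristic equation. -/
theorem le_abs_edgeSinCoeff (hk₁ : 0 < k₁) (hk₂ : k₁ < k₂) (hδ : 0 < δ)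
    (h₁ : δ ≤ |k₃₁ - 2 * k₂|) (h₂ : δ ≤ |k₃₂ - 2 * k₂|) :
    (k₂ - k₁) ^ 2 * δ ^ 2 / (k₁ * k₂) ≤ |edgeSinCoeff k₁ k₂ k₃₁ k₃₂| := by
  have hk : 0 < k₂ := hk₁.trans hk₂
  rw [edgeSinCoeff, abs_neg, abs_div, abs_of_pos (mul_pos hk₁ hk), abs_mul, abs_mul, abs_pow,
    sq_abs, abs_sub_comm (2 * k₂), abs_sub_comm (2 * k₂), mul_assoc, sq δ]
  gcongr

/-- `D² - (k₂ - k₁)² = 2 k₁ k₂ (1 - c)`, and the left side is at least `2 (k₂ - k₁) (D - (k₂ -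
k₁))`. The offset from the band edge is thus quadratic in the phase. -/
theorem sub_edge_le (hk₂ : k₁ < k₂) {c : ℝ}
    (hD2 : D ^ 2 = k₁ ^ 2 + k₂ ^ 2 - 2 * k₁ * k₂ * c) :
    D - (k₂ - k₁) ≤ k₁ * k₂ / (k₂ - k₁) * (1 - c) := by
  have h : 0 < k₂ - k₁ := sub_pos.2 hk₂
  rw [div_mul_eq_mul_div, le_div_iff₀ h]
  nlinarith [sq_nonneg (D - (k₂ - k₁))]

theorem exists_sinCoeff_bound (hk₁ : 0 < k₁) (hk₂ : k₁ < k₂) :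
    ∃ C : ℝ, 0 < C ∧ ∀ k₃₁ k₃₂ D β c : ℝ, 0 ≤ k₃₁ → 0 ≤ k₃₂ → k₃₁ ≤ k₁ + 2 * k₂ →
      k₃₂ ≤ k₁ + 2 * k₂ → k₂ - k₁ ≤ D → D ≤ k₁ + k₂ → c ≤ 1 →
      D ^ 2 = k₁ ^ 2 + k₂ ^ 2 - 2 * k₁ * k₂ * c →
      β = (D * (k₂ - k₃₁) + k₂ ^ 2) / (k₁ * k₂) →
      |sinCoeff k₁ k₂ k₃₂ D β c - edgeSinCoeff k₁ k₂ k₃₁ k₃₂| ≤ C * (1 - c) ∧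
      |k₂ * (D + k₂ - k₃₂) - k₁ * (k₂ - k₃₂) * β| ≤ C ∧ |β| ≤ C := by
  have hk : 0 < k₂ := hk₁.trans hk₂
  have h : 0 < k₂ - k₁ := sub_pos.2 hk₂
  refine ⟨10 * k₂ ^ 2 / k₁ * (k₁ * k₂ / (k₂ - k₁)) + 14 * k₂ ^ 2 + 5 * k₂ / k₁, by positivity, ?_⟩
  intro k₃₁ k₃₂ D β c h1 h2 h3 h4 hD hD' hc hD2 hβ
  set d := D - (k₂ - k₁) with hd
  have hd0 : 0 ≤ d := sub_nonneg.2 hD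
  have hd1 : d ≤ k₁ * k₂ / (k₂ - k₁) * (1 - c) := sub_edge_le hk₂ hD2
  have hd2 : d ≤ 2 * k₂ := by linarith
  have hx : |k₂ - k₃₁| ≤ 2 * k₂ := abs_le.2 ⟨by linarith, by linarith⟩
  have hz : |k₂ - k₃₂| ≤ 2 * k₂ := abs_le.2 ⟨by linarith, by linarith⟩
  have hx2 : |2 * k₂ - k₃₁| ≤ 2 * k₂ := abs_le.2 ⟨by linarith, by linarith⟩
  have hz2 : |2 * k₂ - k₃₂| ≤ 2 * k₂ := abs_le.2 ⟨by linarith, by linarith⟩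
  have hβ' : |β * k₁| ≤ 5 * k₂ := by
    have : β * k₁ = (D * (k₂ - k₃₁) + k₂ ^ 2) / k₂ := by
      rw [hβ]
      field_simp
    rw [this, abs_div, abs_of_pos hk, div_le_iff₀ hk]
    refine (abs_add_le _ _).trans ?_
    rw [abs_mul, abs_of_nonneg (by linarith : 0 ≤ D), abs_of_nonneg (sq_nonneg k₂)]
    nlinarith [abs_nonneg (k₂ - k₃₁)]
  have hβk : |β| ≤ 5 * k₂ / k₁ := by
    rw [le_div_iff₀ hk₁]
    rwa [abs_mul, abs_of_pos hk₁] at hβ'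
  have hP1β : |k₁ * (k₂ - k₃₂) * β| ≤ 10 * k₂ ^ 2 := by
    have : k₁ * (k₂ - k₃₂) * β = (β * k₁) * (k₂ - k₃₂) := by ring
    rw [this, abs_mul]
    nlinarith [abs_nonneg (β * k₁), abs_nonneg (k₂ - k₃₂)]
  have hP2 : |k₂ * (D + k₂ - k₃₂)| ≤ 4 * k₂ ^ 2 := by
    rw [abs_mul, abs_of_pos hk]
    have : |D + k₂ - k₃₂| ≤ 4 * k₂ := by
      rw [add_sub_assoc]
      refine (abs_add_le _ _).trans ?_
      rw [abs_of_nonneg (by linarith : 0 ≤ D)]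
      linarith
    nlinarith
  have hA : 0 ≤ 10 * k₂ ^ 2 / k₁ * (k₁ * k₂ / (k₂ - k₁)) := by positivity
  have hA' : 0 ≤ 5 * k₂ / k₁ := by positivity
  refine ⟨?_, ?_, ?_⟩
  · have e : sinCoeff k₁ k₂ k₃₂ D β c - edgeSinCoeff k₁ k₂ k₃₁ k₃₂ =
        d * (-(k₂ * ((k₂ - k₁) * (2 * k₂ - k₃₁) / (k₁ * k₂))) -
          (k₂ - k₁) * (2 * k₂ - k₃₂) * ((k₂ - k₃₁) / (k₁ * k₂)) -
          k₂ * d * ((k₂ - k₃₁) / (k₁ * k₂))) -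
        (1 - c) * (k₂ * (D + k₂ - k₃₂) + k₁ * (k₂ - k₃₂) * β) := by
      have hDd : D = d + (k₂ - k₁) := by rw [hd]; ring
      simp only [sinCoeff, edgeSinCoeff]
      rw [hβ, hDd]
      field_simp
      ring
    have hkk : 0 < k₁ * k₂ := mul_pos hk₁ hk
    have hr : |(k₂ - k₃₁) / (k₁ * k₂)| ≤ 2 / k₁ := by
      rw [abs_div, abs_of_pos hkk, div_le_div_iff₀ hkk hk₁]
      nlinarith
    have hr2 : |(k₂ - k₁) * (2 * k₂ - k₃₁) / (k₁ * k₂)| ≤ 2 * k₂ / k₁ := by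
      rw [abs_div, abs_of_pos hkk, div_le_div_iff₀ hkk hk₁, abs_mul, abs_of_pos h]
      have : (k₂ - k₁) * |2 * k₂ - k₃₁| ≤ k₂ * (2 * k₂) :=
        mul_le_mul (by linarith) hx2 (abs_nonneg _) hk.le
      nlinarith
    have t1 : |-(k₂ * ((k₂ - k₁) * (2 * k₂ - k₃₁) / (k₁ * k₂)))| ≤ 2 * k₂ ^ 2 / k₁ := by
      rw [abs_neg, abs_mul, abs_of_pos hk]
      calc _ ≤ k₂ * (2 * k₂ / k₁) := mul_le_mul_of_nonneg_left hr2 hk.le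
        _ = _ := by ring
    have t2 : |(k₂ - k₁) * (2 * k₂ - k₃₂) * ((k₂ - k₃₁) / (k₁ * k₂))| ≤ 4 * k₂ ^ 2 / k₁ := by
      rw [abs_mul, abs_mul, abs_of_pos h]
      calc _ ≤ k₂ * (2 * k₂) * (2 / k₁) := by gcongr; linarith
        _ = _ := by ring
    have t3 : |k₂ * d * ((k₂ - k₃₁) / (k₁ * k₂))| ≤ 4 * k₂ ^ 2 / k₁ := by
      rw [abs_mul, abs_mul, abs_of_pos hk, abs_of_nonneg hd0]
      calc _ ≤ k₂ * (2 * k₂) * (2 / k₁) := by gcongr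
        _ = _ := by ring
    rw [e]
    refine (abs_sub _ _).trans ?_
    rw [abs_mul, abs_mul, abs_of_nonneg hd0, abs_of_nonneg (sub_nonneg.2 hc)]
    have t4 : |-(k₂ * ((k₂ - k₁) * (2 * k₂ - k₃₁) / (k₁ * k₂))) -
          (k₂ - k₁) * (2 * k₂ - k₃₂) * ((k₂ - k₃₁) / (k₁ * k₂)) -
          k₂ * d * ((k₂ - k₃₁) / (k₁ * k₂))| ≤ 10 * k₂ ^ 2 / k₁ := by
      refine (abs_sub _ _).trans ((add_le_add ((abs_sub _ _).trans (add_le_add t1 t2)) t3).trans ?_)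
      exact le_of_eq (by ring)
    have t5 := (abs_add_le (k₂ * (D + k₂ - k₃₂)) (k₁ * (k₂ - k₃₂) * β)).trans (add_le_add hP2 hP1β)
    have t6 := mul_le_mul hd1 t4 (abs_nonneg _) (hd0.trans hd1)
    have t7 := mul_le_mul_of_nonneg_left t5 (sub_nonneg.2 hc)
    have t8 : 0 ≤ 5 * k₂ / k₁ * (1 - c) := mul_nonneg hA' (sub_nonneg.2 hc)
    linarith
  · have := (abs_sub (k₂ * (D + k₂ - k₃₂)) (k₁ * (k₂ - k₃₂) * β)).trans (add_le_add hP2 hP1β)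
    linarith
  · linarith [sq_nonneg k₂]

/-- The frequency offset `w ^ 2 - k₁ - k₂` as a function of the phase. -/
noncomputable def bandOffset (k₁ k₂ φ : ℝ) : ℝ := √(k₁ ^ 2 + k₂ ^ 2 - 2 * k₁ * k₂ * cos φ)

theorem bandOffset_sq (hk₁ : 0 < k₁) (hk₂ : k₁ < k₂) (φ : ℝ) :
    bandOffset k₁ k₂ φ ^ 2 = k₁ ^ 2 + k₂ ^ 2 - 2 * k₁ * k₂ * cos φ := by
  refine sq_sqrt ?_
  nlinarith [cos_le_one φ, mul_pos hk₁ (hk₁.trans hk₂), sq_nonneg (k₂ - k₁)]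

theorem bandOffset_lower (hk₁ : 0 < k₁) (hk₂ : k₁ < k₂) (h0 : 0 < φ) (hπ : φ < π) :
    k₂ - k₁ < bandOffset k₁ k₂ φ := by
  refine lt_sqrt_of_sq_lt ?_
  have : cos φ < 1 := by
    rw [← cos_zero]
    exact cos_lt_cos_of_nonneg_of_le_pi le_rfl hπ.le h0
  nlinarith [mul_pos hk₁ (hk₁.trans hk₂)]

theorem bandOffset_upper (hk₁ : 0 < k₁) (hk₂ : k₁ < k₂) (h0 : 0 < φ) (hπ : φ < π) :
    bandOffset k₁ k₂ φ < k₁ + k₂ := by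
  rw [bandOffset, sqrt_lt' (by linarith)]
  have : -1 < cos φ := by
    rw [← cos_pi]
    exact cos_lt_cos_of_nonneg_of_le_pi h0.le le_rfl hπ
  nlinarith [mul_pos hk₁ (hk₁.trans hk₂)]

theorem one_sub_cos_le (φ : ℝ) : 1 - cos φ ≤ φ ^ 2 / 2 := by
  linarith [one_sub_sq_div_two_le_cos (x := φ)]

/-- The characteristic equation of the chain has a root near the lowest optical phase. -/
theorem exists_phase (hk₁ : 0 < k₁) (hk₂ : k₁ < k₂) (hδ : 0 < δ) :
    ∃ N : ℕ, 2 ≤ N ∧ ∀ n, N ≤ n + 1 → ∀ k₃₁ k₃₂ : ℝ, 0 ≤ k₃₁ → 0 ≤ k₃₂ → k₃₁ ≤ k₁ + 2 * k₂ →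
      k₃₂ ≤ k₁ + 2 * k₂ → δ ≤ |k₃₁ - 2 * k₂| → δ ≤ |k₃₂ - 2 * k₂| →
      ∃ φ : ℝ, 0 < φ ∧ (n + 1 : ℕ) * φ ≤ 3 * π / 2 ∧ rightResidual n k₁ k₂ k₃₂ (bandOffset k₁ k₂ φ)
        ((bandOffset k₁ k₂ φ * (k₂ - k₃₁) + k₂ ^ 2) / (k₁ * k₂)) φ = 0 := by
  obtain ⟨C, hC, hbound⟩ := exists_sinCoeff_bound hk₁ hk₂
  have hk : 0 < k₂ := hk₁.trans hk₂
  set b := (k₂ - k₁) ^ 2 * δ ^ 2 / (k₁ * k₂) with hb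
  have hb0 : 0 < b := by
    have : 0 < k₂ - k₁ := sub_pos.2 hk₂
    positivity
  obtain ⟨N, hN⟩ := exists_nat_ge (C * 32 / b)
  refine ⟨N + 2, by omega, fun n hn k₃₁ k₃₂ h1 h2 h3 h4 h5 h6 => ?_⟩
  have hnN : (N : ℝ) + 2 ≤ (n + 1 : ℕ) := by exact_mod_cast hn
  set x : ℝ := ((n + 1 : ℕ) : ℝ) with hx
  have hx2 : 2 ≤ x := by
    have : (0 : ℝ) ≤ N := Nat.cast_nonneg N
    linarith
  have hx0 : 0 < x := by linarith
  have hpi := pi_pos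
  have hpi4 := pi_lt_four
  set β : ℝ → ℝ := fun φ => (bandOffset k₁ k₂ φ * (k₂ - k₃₁) + k₂ ^ 2) / (k₁ * k₂) with hβ
  set B : ℝ → ℝ := fun φ => sinCoeff k₁ k₂ k₃₂ (bandOffset k₁ k₂ φ) (β φ) (cos φ) with hB
  set B0 := edgeSinCoeff k₁ k₂ k₃₁ k₃₂ with hB0
  have hB0b : b ≤ |B0| := le_abs_edgeSinCoeff hk₁ hk₂ hδ h5 h6
  -- Since `t ≤ 6` and `x ≥ 2`, `1 - cos (t / x) ≤ 18 / x`; the choice of `N` makes the error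
  -- smaller than `|B0|`, so `B` keeps the sign of `B0`.
  have hnear : ∀ t, 0 < t → t ≤ 3 * π / 2 → |B (t / x) - B0| < |B0| := by
    intro t ht0 ht
    have hφ0 : 0 < t / x := by positivity
    have hφ : t / x < π := by
      rw [div_lt_iff₀ hx0]
      nlinarith
    have h := (hbound k₃₁ k₃₂ _ (β (t / x)) (cos (t / x)) h1 h2 h3 h4
      (bandOffset_lower hk₁ hk₂ hφ0 hφ).le (bandOffset_upper hk₁ hk₂ hφ0 hφ).le (cos_le_one _)
      (bandOffset_sq hk₁ hk₂ _) rfl).1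
    have hcos := one_sub_cos_le (t / x)
    have ht6 : t ≤ 6 := by linarith
    have hsq : (t / x) ^ 2 / 2 ≤ 18 / x := by
      rw [div_pow, div_div, div_le_div_iff₀ (by positivity) hx0]
      have : t ^ 2 ≤ 36 := by nlinarith
      nlinarith [sq_nonneg (x - 2)]
    have h7 : C * (18 / x) < b := by
      rw [mul_div_assoc', div_lt_iff₀ hx0]
      rw [div_le_iff₀ hb0] at hN
      nlinarith
    calc |B (t / x) - B0| ≤ C * (1 - cos (t / x)) := h
      _ ≤ C * (18 / x) := by gcongr; linarith
      _ < b := h7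
      _ ≤ |B0| := hB0b
  have hsign : 0 < B (π / 2 / x) * B (3 * π / 2 / x) := by
    have ha := hnear (π / 2) (by positivity) (by linarith)
    have hb' := hnear (3 * π / 2) (by positivity) le_rfl
    rw [abs_lt] at ha hb'
    rcases le_total 0 B0 with h | h
    · rw [abs_of_nonneg h] at ha hb'
      exact mul_pos (by linarith) (by linarith)
    · rw [abs_of_nonpos h] at ha hb'
      exact mul_pos_of_neg_of_neg (by linarith) (by linarith)
  set R : ℝ → ℝ := fun φ => rightResidual n k₁ k₂ k₃₂ (bandOffset k₁ k₂ φ) (β φ) φ with hR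
  have hcont : Continuous R := by
    simp only [hR, hβ, rightResidual, bandOffset, waveSeq]
    fun_prop
  -- At `(n + 1) φ = π/2` and `3π/2` the cosine term drops out and the sine is `1` and `-1`, so the
  -- residual changes sign in between.
  have hRa : R (π / 2 / x) = B (π / 2 / x) := by
    simp only [hR]
    rw [rightResidual_eq, ← hx, mul_div_cancel₀ _ hx0.ne', sin_pi_div_two, cos_pi_div_two]
    ring
  have hRb : R (3 * π / 2 / x) = -B (3 * π / 2 / x) := by
    simp only [hR]
    rw [rightResidual_eq, ← hx, mul_div_cancel₀ _ hx0.ne',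
      show 3 * π / 2 = π / 2 + π by ring, sin_add_pi, cos_add_pi, sin_pi_div_two, cos_pi_div_two]
    ring
  have h0 : (0 : ℝ) ∈ Set.uIcc (R (π / 2 / x)) (R (3 * π / 2 / x)) := by
    rw [hRa, hRb, Set.mem_uIcc]
    rcases pos_and_pos_or_neg_and_neg_of_mul_pos hsign with ⟨p, q⟩ | ⟨p, q⟩
    · right; constructor <;> linarith
    · left; constructor <;> linarith
  obtain ⟨φ, hφ, hφ0⟩ := intermediate_value_uIcc hcont.continuousOn h0
  have hle : π / 2 / x ≤ 3 * π / 2 / x := by gcongr; linarith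
  rw [Set.uIcc_of_le hle] at hφ
  refine ⟨φ, lt_of_lt_of_le (by positivity) hφ.1, ?_, hφ0⟩
  have := (le_div_iff₀ hx0).1 hφ.2
  linarith

end Wave

/-! ### Phase and shape of the lowest optical mode -/

section ModeAsymptotics

open Real

variable {n : ℕ} {k₁ k₂ k₃₁ k₃₂ D β φ δ : ℝ}

theorem IsOpticalMode.smul_add_eq {w : ℝ} {u : Fin (2 * n) → ℝ}
    (h : IsOpticalMode n k₁ k₂ k₃₁ k₃₂ w u) :
    w ^ 2 • u + (chainMatrix n k₁ k₂ k₃₁ k₃₂).mulVec u = 0 := by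
  rw [h.eigen]
  module

/-- Inside the band the dispersion relation has a phase in `(0, π)`. The wave has first entry `sin φ
≠ 0`, and an eigenvector is determined by its first entry, so the mode is a multiple of the wave and
the last row must hold. -/
theorem IsOpticalMode.exists_phase (hk₁ : 0 < k₁) (hk₂ : k₁ < k₂) {w : ℝ}
    {u : Fin (2 * (n + 1)) → ℝ} (h : IsOpticalMode (n + 1) k₁ k₂ k₃₁ k₃₂ w u) :
    ∃ φ c : ℝ, 0 < φ ∧ φ < π ∧ w ^ 2 = bandOffset k₁ k₂ φ + k₁ + k₂ ∧
      u = c • leftWave (n + 1) k₁ k₂ (bandOffset k₁ k₂ φ)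
        ((bandOffset k₁ k₂ φ * (k₂ - k₃₁) + k₂ ^ 2) / (k₁ * k₂)) φ ∧
      rightResidual n k₁ k₂ k₃₂ (bandOffset k₁ k₂ φ)
        ((bandOffset k₁ k₂ φ * (k₂ - k₃₁) + k₂ ^ 2) / (k₁ * k₂)) φ = 0 := by
  have hk : 0 < k₂ := hk₁.trans hk₂
  have hkk : 0 < 2 * k₁ * k₂ := by positivity
  set D := w ^ 2 - k₁ - k₂ with hD
  have hD1 : k₂ - k₁ < D := by linarith [h.lower]
  have hD2 : D < k₁ + k₂ := by linarith [h.upper]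
  have hD0 : 0 < D := by linarith
  set c := (k₁ ^ 2 + k₂ ^ 2 - D ^ 2) / (2 * k₁ * k₂) with hc
  have hc1 : c < 1 := by
    rw [hc, div_lt_one hkk]
    nlinarith
  have hc2 : -1 < c := by
    rw [hc, lt_div_iff₀ hkk]
    nlinarith
  have hcos : cos (arccos c) = c := cos_arccos hc2.le hc1.le
  have hoff : bandOffset k₁ k₂ (arccos c) = D := by
    rw [bandOffset, hcos]
    have : k₁ ^ 2 + k₂ ^ 2 - 2 * k₁ * k₂ * c = D ^ 2 := by
      rw [hc]
      field_simp
      ring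
    rw [this, sqrt_sq hD0.le]
  have hφ0 : 0 < arccos c := arccos_pos.2 hc1
  have hφπ : arccos c < π := by
    refine lt_of_le_of_ne (arccos_le_pi c) fun he => ?_
    rw [he, cos_pi] at hcos
    linarith
  have hsq := bandOffset_sq hk₁ hk₂ (arccos c)
  set φ := arccos c with hφ
  rw [hoff] at hsq
  set β := (D * (k₂ - k₃₁) + k₂ ^ 2) / (k₁ * k₂) with hβ
  set v := leftWave (n + 1) k₁ k₂ D β φ with hv
  have hs : w ^ 2 = D + k₁ + k₂ := by rw [hD]; ring
  have hrow := leftWave_row (n := n + 1) (k₃₂ := k₃₂) hk₁ hD0.ne' hk.ne' hsq hβ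
  have hsin : 0 < sin φ := sin_pos_of_pos_of_lt_pi hφ0 hφπ
  have hv0 : vecExt v 0 = sin φ := by
    have := vecExt_leftWave_even (n := n + 1) (k₁ := k₁) (k₂ := k₂) (D := D) (β := β) (φ := φ)
      (show 0 < n + 1 by omega)
    rw [mul_zero] at this
    rw [hv, this]
    simp [waveSeq]
  have hu := h.smul_add_eq
  have huv : u = (vecExt u 0 / sin φ) • v := by
    rw [← sub_eq_zero]
    refine eq_zero_of_rows (s := w ^ 2) (k₃₁ := k₃₁) (k₃₂ := k₃₂) hk₁ hk₂ (fun i hi => ?_) ?_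
    · have e : w ^ 2 • (u - (vecExt u 0 / sin φ) • v) +
          (chainMatrix (n + 1) k₁ k₂ k₃₁ k₃₂).mulVec (u - (vecExt u 0 / sin φ) • v) =
          (-(vecExt u 0 / sin φ)) • ((D + k₁ + k₂) • v +
            (chainMatrix (n + 1) k₁ k₂ k₃₁ k₃₂).mulVec v) := by
        rw [Matrix.mulVec_sub, Matrix.mulVec_smul, ← hs]
        have : (chainMatrix (n + 1) k₁ k₂ k₃₁ k₃₂).mulVec u = -(w ^ 2 • u) :=
          eq_neg_of_add_eq_zero_right hu
        rw [this]
        module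
      rw [e, vecExt_smul, hrow i hi, mul_zero]
    · rw [vecExt_sub, vecExt_smul, hv0, div_mul_cancel₀ _ hsin.ne', sub_self]
  have hc0 : vecExt u 0 / sin φ ≠ 0 := by
    intro h0
    rw [h0, zero_smul] at huv
    exact h.ne_zero huv
  refine ⟨φ, vecExt u 0 / sin φ, hφ0, hφπ, by rw [hoff, hs], by rw [hoff]; exact huv, ?_⟩
  rw [hoff]
  have hlast := leftWave_last_row (n := n) (k₁ := k₁) (k₂ := k₂) (k₃₁ := k₃₁) (k₃₂ := k₃₂)
    (β := β) (φ := φ) hD0.ne'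
  have hvz : (D + k₁ + k₂) • v + (chainMatrix (n + 1) k₁ k₂ k₃₁ k₃₂).mulVec v = 0 := by
    rw [huv, hs, Matrix.mulVec_smul, smul_comm, ← smul_add] at hu
    exact (smul_eq_zero.1 hu).resolve_left hc0
  rw [← hv, hvz] at hlast
  have hz : vecExt (0 : Fin (2 * (n + 1)) → ℝ) (2 * n + 1) = 0 := by simp [vecExt]
  rw [hz] at hlast
  rcases mul_eq_zero.1 hlast.symm with h1 | h1
  · exact absurd h1 (pow_ne_zero _ (by norm_num))
  · exact (div_eq_zero_iff.1 h1).resolve_right hD0.ne'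

theorem isOpticalMode_of_phase (hk₁ : 0 < k₁) (hk₂ : k₁ < k₂) (h0 : 0 < φ) (hπ : φ < π)
    (h : rightResidual n k₁ k₂ k₃₂ (bandOffset k₁ k₂ φ)
        ((bandOffset k₁ k₂ φ * (k₂ - k₃₁) + k₂ ^ 2) / (k₁ * k₂)) φ = 0) :
    ∃ w u, IsOpticalMode (n + 1) k₁ k₂ k₃₁ k₃₂ w u ∧ w ^ 2 = bandOffset k₁ k₂ φ + k₁ + k₂ := by
  have hk : 0 < k₂ := hk₁.trans hk₂
  have hD1 := bandOffset_lower hk₁ hk₂ h0 hπ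
  have hD2 := bandOffset_upper hk₁ hk₂ h0 hπ
  have hsq := bandOffset_sq hk₁ hk₂ φ
  set D := bandOffset k₁ k₂ φ with hD
  have hD0 : 0 < D := by linarith
  set β := (D * (k₂ - k₃₁) + k₂ ^ 2) / (k₁ * k₂) with hβ
  set v := leftWave (n + 1) k₁ k₂ D β φ with hv
  have hrow := leftWave_row (n := n + 1) (k₃₂ := k₃₂) hk₁ hD0.ne' hk.ne' hsq hβ
  have hlast := leftWave_last_row (n := n) (k₁ := k₁) (k₂ := k₂) (k₃₁ := k₃₁) (k₃₂ := k₃₂)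
    (β := β) (φ := φ) hD0.ne'
  rw [h, zero_div, mul_zero] at hlast
  have hs : 0 ≤ D + k₁ + k₂ := by positivity
  have hv0 : vecExt v 0 = sin φ := by
    have := vecExt_leftWave_even (n := n + 1) (k₁ := k₁) (k₂ := k₂) (D := D) (β := β) (φ := φ)
      (show 0 < n + 1 by omega)
    rw [mul_zero] at this
    rw [hv, this]
    simp [waveSeq]
  have hvz : (D + k₁ + k₂) • v + (chainMatrix (n + 1) k₁ k₂ k₃₁ k₃₂).mulVec v = 0 := by
    ext i
    rw [← vecExt_val ((D + k₁ + k₂) • v + (chainMatrix (n + 1) k₁ k₂ k₃₁ k₃₂).mulVec v) i]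
    by_cases hi : (i : ℕ) + 1 < 2 * (n + 1)
    · exact hrow i hi
    · have : (i : ℕ) = 2 * n + 1 := by omega
      rw [this]
      exact hlast
  refine ⟨√(D + k₁ + k₂), v, ⟨sqrt_pos.2 (by positivity), ?_, ?_, ?_, ?_⟩, sq_sqrt hs⟩
  · intro hz
    rw [hz] at hv0
    have : 0 < sin φ := sin_pos_of_pos_of_lt_pi h0 hπ
    have hz : vecExt (0 : Fin (2 * (n + 1)) → ℝ) 0 = 0 := by simp [vecExt]
    linarith
  · rw [sq_sqrt hs, neg_smul]
    exact eq_neg_of_add_eq_zero_right hvz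
  · rw [sq_sqrt hs]
    linarith
  · rw [sq_sqrt hs]
    linarith

theorem exists_lowestOpticalMode {w : ℝ} {u : Fin (2 * n) → ℝ}
    (h : IsOpticalMode n k₁ k₂ k₃₁ k₃₂ w u) :
    ∃ w' u', IsLowestOpticalMode n k₁ k₂ k₃₁ k₃₂ w' u' := by
  have hfin : {w | ∃ u, IsOpticalMode n k₁ k₂ k₃₁ k₃₂ w u}.Finite := by
    have h1 := Module.End.finite_hasEigenvalue (Matrix.toLin' (chainMatrix n k₁ k₂ k₃₁ k₃₂))
    refine Set.Finite.of_finite_image (f := fun w => -w ^ 2) (h1.subset ?_) ?_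
    · rintro _ ⟨w, ⟨u, hu⟩, rfl⟩
      refine Module.End.hasEigenvalue_of_hasEigenvector (x := u) ⟨?_, hu.ne_zero⟩
      rw [Module.End.mem_eigenspace_iff, Matrix.toLin'_apply]
      exact hu.eigen
    · rintro a ⟨u, hu⟩ b ⟨v, hv⟩ hab
      simp only [neg_inj] at hab
      exact (pow_left_inj₀ hu.pos.le hv.pos.le two_ne_zero).1 hab
  obtain ⟨w', ⟨u', hu'⟩, hmin⟩ := Set.exists_min_image _ id hfin ⟨w, u, h⟩
  exact ⟨w', u', hu', fun a b hab => hmin a ⟨b, hab⟩⟩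

set_option maxHeartbeats 1000000 in
/-- Phases at most `3π / 2n` that satisfy the characteristic equation are close to `π / n`. -/
theorem exists_phase_asymptotics (hk₁ : 0 < k₁) (hk₂ : k₁ < k₂) (hδ : 0 < δ) :
    ∃ (C : ℝ) (N : ℕ), 0 < C ∧ 4 ≤ N ∧ ∀ n, N ≤ n + 1 → ∀ k₃₁ k₃₂ φ : ℝ, 0 ≤ k₃₁ → 0 ≤ k₃₂ →
      k₃₁ ≤ k₁ + 2 * k₂ → k₃₂ ≤ k₁ + 2 * k₂ → δ ≤ |k₃₁ - 2 * k₂| → δ ≤ |k₃₂ - 2 * k₂| →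
      0 < φ → (n + 1 : ℕ) * φ ≤ 3 * π / 2 → rightResidual n k₁ k₂ k₃₂ (bandOffset k₁ k₂ φ)
        ((bandOffset k₁ k₂ φ * (k₂ - k₃₁) + k₂ ^ 2) / (k₁ * k₂)) φ = 0 →
      |sin ((n + 1 : ℕ) * φ)| ≤ C * φ ∧ |(n + 1 : ℕ) * φ - π| ≤ C / (n + 1 : ℕ) := by
  obtain ⟨C, hC, hbound⟩ := exists_sinCoeff_bound hk₁ hk₂
  have hk : 0 < k₂ := hk₁.trans hk₂
  set b := (k₂ - k₁) ^ 2 * δ ^ 2 / (k₁ * k₂) with hb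
  have hb0 : 0 < b := by
    have : 0 < k₂ - k₁ := sub_pos.2 hk₂
    positivity
  obtain ⟨N, hN⟩ := exists_nat_ge (C * 64 / b)
  set C1 := 2 * C / b with hC1
  have hC10 : 0 < C1 := by positivity
  -- The factor `10` bounds `(π / 2) · 6 = 3π`, from Jordan's inequality and `φ ≤ 6 / x`.
  refine ⟨10 * C1, N + 4, by positivity, by omega, ?_⟩
  intro n hn k₃₁ k₃₂ φ h1 h2 h3 h4 h5 h6 hφ0 hφn hR
  have hnN : (N : ℝ) + 4 ≤ (n + 1 : ℕ) := by exact_mod_cast hn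
  set x : ℝ := ((n + 1 : ℕ) : ℝ) with hx
  have hN0 : (0 : ℝ) ≤ N := Nat.cast_nonneg N
  have hx4 : 4 ≤ x := by linarith
  have hx0 : 0 < x := by linarith
  have hpi := pi_pos
  have hpi4 := pi_lt_four
  have hpi3 := pi_gt_three
  have hφ6 : φ ≤ 6 / x := by
    rw [le_div_iff₀ hx0]
    linarith
  have hφx : φ * 4 ≤ φ * x := mul_le_mul_of_nonneg_left hx4 hφ0.le
  have hφπ : φ < π := by linarith
  have hB := hbound k₃₁ k₃₂ _ _ (cos φ) h1 h2 h3 h4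
    (bandOffset_lower hk₁ hk₂ hφ0 hφπ).le (bandOffset_upper hk₁ hk₂ hφ0 hφπ).le (cos_le_one _)
    (bandOffset_sq hk₁ hk₂ _) rfl
  set D := bandOffset k₁ k₂ φ
  set β := (D * (k₂ - k₃₁) + k₂ ^ 2) / (k₁ * k₂)
  set B := sinCoeff k₁ k₂ k₃₂ D β (cos φ)
  have hB0b := le_abs_edgeSinCoeff hk₁ hk₂ hδ h5 h6
  rw [← hb] at hB0b
  have hcos := one_sub_cos_le φ
  have hsq : φ ^ 2 / 2 ≤ 18 / x := by
    have : φ ^ 2 ≤ (6 / x) ^ 2 := pow_le_pow_left₀ hφ0.le hφ6 2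
    have h36 : (6 / x) ^ 2 / 2 ≤ 18 / x := by
      rw [div_pow, div_div, div_le_div_iff₀ (by positivity) hx0]
      nlinarith
    linarith
  have h7 : C * (18 / x) ≤ b / 2 := by
    rw [mul_div_assoc', div_le_iff₀ hx0]
    rw [div_le_iff₀ hb0] at hN
    nlinarith
  have hBb : b / 2 ≤ |B| := by
    have e1 : C * (1 - cos φ) ≤ C * (18 / x) := by gcongr; linarith
    have e2 := abs_sub_abs_le_abs_sub (edgeSinCoeff k₁ k₂ k₃₁ k₃₂) B
    rw [abs_sub_comm] at e2
    linarith [hB.1]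
  rw [rightResidual_eq, ← hx] at hR
  have hsinle : |sin (x * φ)| ≤ C1 * φ := by
    have e : |B| * |sin (x * φ)| ≤ C * φ := by
      rw [← abs_mul, eq_neg_of_add_eq_zero_left hR, abs_neg, abs_mul, abs_mul]
      calc _ ≤ C * φ * 1 := by
            refine mul_le_mul (mul_le_mul hB.2.1 ?_ (abs_nonneg _) hC.le) (abs_cos_le_one _)
              (abs_nonneg _) (by positivity)
            have := abs_sin_le_abs (x := φ)
            rwa [abs_of_pos hφ0] at this
        _ = C * φ := mul_one _
    rw [hC1, div_mul_eq_mul_div, le_div_iff₀ hb0]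
    nlinarith [abs_nonneg (sin (x * φ))]
  have hxφ0 : 0 < x * φ := by positivity
  -- Excludes the branch near the trivial root `φ = 0`: below `π/2` Jordan's inequality makes the
  -- sine at least `(2/π) x φ`, which exceeds `C1 φ` for large `x`.
  have hlow : π / 2 < x * φ := by
    by_contra hneg
    push Not at hneg
    have e := mul_le_sin hxφ0.le hneg
    have e2 := (le_abs_self _).trans hsinle
    have e3 : 2 / π * (x * φ) ≤ C1 * φ := e.trans e2
    have e4 : 2 / π * x ≤ C1 := by
      have : (2 / π * x) * φ ≤ C1 * φ := by linarith
      exact le_of_mul_le_mul_right this hφ0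
    rw [div_mul_eq_mul_div, div_le_iff₀ hpi, hC1, div_mul_eq_mul_div, le_div_iff₀ hb0] at e4
    rw [div_le_iff₀ hb0] at hN
    nlinarith
  have hCle : C1 * φ ≤ 10 * C1 * φ := mul_le_mul_of_nonneg_right (by linarith) hφ0.le
  refine ⟨hsinle.trans hCle, ?_⟩
  have e1 : 2 / π * |x * φ - π| ≤ |sin (x * φ)| := by
    have := mul_abs_le_abs_sin (x := x * φ - π) (abs_le.2 ⟨by linarith, by linarith⟩)
    rwa [sin_sub_pi, abs_neg] at this
  have e2 : |x * φ - π| ≤ π / 2 * (C1 * (6 / x)) := by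
    have e3 := e1.trans (hsinle.trans (mul_le_mul_of_nonneg_left hφ6 hC10.le))
    rw [div_mul_eq_mul_div, div_le_iff₀ hpi] at e3
    linarith
  refine e2.trans ?_
  rw [le_div_iff₀ hx0]
  have : π / 2 * (C1 * (6 / x)) * x = 3 * π * C1 := by
    field_simp
    ring
  rw [this]
  have hpi315 : π ≤ 3.15 := pi_lt_d2.le
  have : 3 * π * C1 ≤ 10 * C1 := mul_le_mul_of_nonneg_right (by linarith) hC10.le
  exact this

/-- The sequence is the imaginary part of `z e^{imφ}` with `z = e^{iφ} - β`. Normalizing by `A =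
|z|` makes later bounds independent of `β`. -/
theorem exists_polar_waveSeq (β : ℝ) (hφ : 0 < sin φ) :
    ∃ A α : ℝ, 0 < A ∧ ∀ m : ℕ, waveSeq β φ m = A * sin (m * φ + α) := by
  set z : ℂ := ⟨cos φ - β, sin φ⟩ with hz
  have h1 := Complex.norm_mul_cos_arg z
  have h2 := Complex.norm_mul_sin_arg z
  refine ⟨‖z‖, z.arg, ?_, fun m => ?_⟩
  · rw [norm_pos_iff]
    intro h0
    have := congrArg Complex.im h0
    simp only [hz, Complex.zero_im] at this
    linarith
  · rw [sin_add, mul_add, mul_left_comm, h1, mul_left_comm, h2, waveSeq, add_mul, one_mul, sin_add]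
    ring

theorem abs_sin_sub_sin_le_abs (x y : ℝ) : |sin x - sin y| ≤ |x - y| := by
  rw [sin_sub_sin, abs_mul, abs_mul, abs_two]
  have h1 := abs_sin_le_abs (x := (x - y) / 2)
  rw [abs_div, abs_two] at h1
  have h2 := abs_cos_le_one ((x + y) / 2)
  nlinarith [abs_nonneg (sin ((x - y) / 2)), abs_nonneg (cos ((x + y) / 2))]

theorem two_sin_mul_sum_cos (n : ℕ) (φ α : ℝ) :
    sin φ * ∑ m ∈ Finset.range n, cos (2 * (m * φ + α)) =
      sin (n * φ) * cos ((n - 1) * φ + 2 * α) := by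
  induction n with
  | zero => simp
  | succ n ih =>
    rw [Finset.sum_range_succ, mul_add, ih]
    push_cast
    have e1 : ((n : ℝ) + 1) * φ = n * φ + φ := by ring
    have e2 : ((n : ℝ) - 1) * φ + 2 * α = (n * φ + 2 * α) - φ := by ring
    have e3 : ((n : ℝ) + 1 - 1) * φ + 2 * α = n * φ + 2 * α := by ring
    have e4 : 2 * ((n : ℝ) * φ + α) = n * φ + (n * φ + 2 * α) := by ring
    rw [e1, e2, e3, e4]
    generalize (n : ℝ) * φ + 2 * α = b
    rw [sin_add, cos_sub, cos_add]
    ring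

theorem sum_range_two_mul (f : ℕ → ℝ) (n : ℕ) :
    ∑ i ∈ Finset.range (2 * n), f i = ∑ m ∈ Finset.range n, (f (2 * m) + f (2 * m + 1)) := by
  induction n with
  | zero => simp
  | succ n ih =>
    rw [Finset.sum_range_succ, ← ih, mul_add, mul_one, Finset.sum_range_succ,
      Finset.sum_range_succ, add_assoc]

theorem sum_fin_eq_sum_vecExt {d : ℕ} (v : Fin d → ℝ) (f : ℝ → ℝ) :
    ∑ i, f (v i) = ∑ i ∈ Finset.range d, f (vecExt v i) := by
  rw [← Fin.sum_univ_eq_sum_range (fun i => f (vecExt v i)) d]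
  simp only [vecExt_val]

/-- Size, variation and Euclidean norm of a wave of small phase. -/
theorem leftWave_estimates (hk₁ : 0 < k₁) (hk₂ : k₁ < k₂) (C₁ : ℝ) (hC₁ : 0 < C₁) :
    ∃ C : ℝ, 0 < C ∧ ∀ (n : ℕ) (φ β : ℝ), 0 < φ → 4 ≤ n → n * φ ≤ 3 * π / 2 →
      |sin (n * φ)| ≤ C₁ * φ → ∃ A : ℝ, 0 < A ∧
        ‖leftWave n k₁ k₂ (bandOffset k₁ k₂ φ) β φ‖ ≤ A * (1 + C * φ) ∧
        envelopeLip (leftWave n k₁ k₂ (bandOffset k₁ k₂ φ) β φ) ≤ A * (C * φ) ∧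
        A ^ 2 * (n - C) ≤ ∑ i, leftWave n k₁ k₂ (bandOffset k₁ k₂ φ) β φ i ^ 2 := by
  have hk : 0 < k₂ := hk₁.trans hk₂
  have h : 0 < k₂ - k₁ := sub_pos.2 hk₂
  set c1 := k₁ * k₂ / (k₂ - k₁) with hc1
  have hc10 : 0 < c1 := by positivity
  set C0 := (k₂ + 2 * c1) / (k₂ - k₁) with hC0
  have hC00 : 0 < C0 := by positivity
  refine ⟨12 * C0 + 2 * C₁ + 1, by positivity, fun n φ β hφ0 hn hφn hsin => ?_⟩
  have hpi := pi_pos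
  have hpi4 := pi_lt_four
  have hpi3 := pi_gt_three
  have hn4 : (4 : ℝ) ≤ n := by exact_mod_cast hn
  have hφx : 4 * φ ≤ n * φ := mul_le_mul_of_nonneg_right hn4 hφ0.le
  have hφπ2 : φ ≤ π / 2 := by linarith
  have hφπ : φ < π := by linarith
  have hφ2 : φ ≤ 2 := by linarith
  have hsinφ : 0 < sin φ := sin_pos_of_pos_of_lt_pi hφ0 hφπ
  obtain ⟨A, α, hA, hY⟩ := exists_polar_waveSeq β hsinφ
  have hD1 := bandOffset_lower hk₁ hk₂ hφ0 hφπ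
  have hDs := sub_edge_le hk₂ (bandOffset_sq hk₁ hk₂ φ)
  set D := bandOffset k₁ k₂ φ with hD
  have hD0 : 0 < D := by linarith
  set Z : ℕ → ℝ := fun m => (k₂ * waveSeq β φ (m + 1) - k₁ * waveSeq β φ m) / D with hZ
  have hYle : ∀ m, |waveSeq β φ m| ≤ A := by
    intro m
    rw [hY, abs_mul, abs_of_pos hA]
    exact mul_le_of_le_one_right hA.le (abs_sin_le_one _)
  have hYdiff : ∀ m, |waveSeq β φ (m + 1) - waveSeq β φ m| ≤ A * φ := by
    intro m
    rw [hY, hY, ← mul_sub, abs_mul, abs_of_pos hA]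
    refine mul_le_mul_of_nonneg_left ((abs_sin_sub_sin_le_abs _ _).trans_eq ?_) hA.le
    push_cast
    rw [show ((m : ℝ) + 1) * φ + α - (m * φ + α) = φ by ring, abs_of_pos hφ0]
  have hd : D - (k₂ - k₁) ≤ 2 * c1 * φ := by
    have e := one_sub_cos_le φ
    have e2 : φ ^ 2 / 2 ≤ 2 * φ := by nlinarith
    have e3 : c1 * (1 - cos φ) ≤ c1 * (2 * φ) := by gcongr; linarith
    linarith
  -- At the band edge `D = k₂ - k₁` and a constant envelope has equal values on both sublattices;
  -- the discrepancy is of first order in `φ`.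
  have hZY : ∀ m, |Z m - waveSeq β φ m| ≤ A * (C0 * φ) := by
    intro m
    have e : Z m - waveSeq β φ m = (k₂ * (waveSeq β φ (m + 1) - waveSeq β φ m) -
        (D - (k₂ - k₁)) * waveSeq β φ m) / D := by
      simp only [hZ]
      field_simp
      ring
    rw [e, abs_div, abs_of_pos hD0, div_le_iff₀ hD0]
    refine (abs_sub _ _).trans ?_
    rw [abs_mul, abs_mul, abs_of_pos hk, abs_of_nonneg (by linarith : 0 ≤ D - (k₂ - k₁))]
    have e1 := mul_le_mul_of_nonneg_left (hYdiff m) hk.le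
    have e2 := mul_le_mul hd (hYle m) (abs_nonneg _) (by positivity)
    have e3 : A * (C0 * φ) * (k₂ - k₁) ≤ A * (C0 * φ) * D := by gcongr
    have e4 : A * (C0 * φ) * (k₂ - k₁) = k₂ * (A * φ) + 2 * c1 * φ * A := by
      rw [hC0]
      field_simp
    linarith
  have hZle : ∀ m, |Z m| ≤ A * (1 + C0 * φ) := by
    intro m
    have e := abs_add_le (Z m - waveSeq β φ m) (waveSeq β φ m)
    rw [sub_add_cancel] at e
    linarith [hZY m, hYle m]
  set v := leftWave n k₁ k₂ D β φ with hv
  have hsgn : ∀ m : ℕ, ((-1 : ℝ) ^ m) * (-1) ^ m = 1 := fun m => by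
    rw [← mul_pow]
    norm_num
  have hpos1 : 0 ≤ A * (C0 * φ) := by positivity
  have hpos2 : 0 ≤ A * (C₁ * φ) := by positivity
  have hpos3 : 0 ≤ A * φ := by positivity
  refine ⟨A, hA, ?_, ?_, ?_⟩
  · refine (pi_norm_le_iff_of_nonneg (by positivity)).2 fun i => ?_
    have hi := i.2
    rw [← vecExt_val v i, Real.norm_eq_abs]
    rcases Nat.even_or_odd' (i : ℕ) with ⟨m, hm | hm⟩
    · rw [hm, hv, vecExt_leftWave_even (by omega), abs_mul, abs_pow, abs_neg, abs_one, one_pow,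
        one_mul]
      linarith [hYle m]
    · rw [hm, hv, vecExt_leftWave_odd (by omega), abs_mul, abs_pow, abs_neg, abs_one, one_pow,
        one_mul]
      linarith [hZle m]
  · refine envelopeLip_le (by positivity) fun i hi => ?_
    rcases Nat.even_or_odd' i with ⟨m, rfl | rfl⟩
    · rw [hv, vecExt_leftWave_even (by omega), vecExt_leftWave_odd (by omega), edgeSign_two_mul,
        edgeSign_two_mul_add_one, ← mul_assoc, ← mul_assoc, hsgn, one_mul, one_mul]
      have := hZY m
      simp only [hZ] at this
      linarith
    · rw [hv, show 2 * m + 1 + 1 = 2 * (m + 1) by ring, vecExt_leftWave_even (by omega),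
        vecExt_leftWave_odd (by omega), edgeSign_two_mul, edgeSign_two_mul_add_one, ← mul_assoc,
        ← mul_assoc, hsgn, hsgn, one_mul, one_mul]
      have e := abs_sub (waveSeq β φ (m + 1) - waveSeq β φ m) (Z m - waveSeq β φ m)
      rw [sub_sub_sub_cancel_right] at e
      simp only [hZ] at e hZY
      linarith [hZY m, hYdiff m]
  · rw [sum_fin_eq_sum_vecExt v (fun x => x ^ 2), sum_range_two_mul]
    -- The squared entries of a cell add up to `2 A² sin²`, with mean `A²`, up to the discrepancy of
    -- the sublattices.
    have e1 : ∀ m ∈ Finset.range n, A ^ 2 - A ^ 2 * cos (2 * (m * φ + α)) - 2 * C0 * φ * A ^ 2 ≤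
        vecExt v (2 * m) ^ 2 + vecExt v (2 * m + 1) ^ 2 := by
      intro m hm
      rw [Finset.mem_range] at hm
      rw [hv, vecExt_leftWave_even hm, vecExt_leftWave_odd hm, mul_pow, mul_pow, ← pow_mul,
        mul_comm m 2, pow_mul, neg_one_sq, one_pow, one_mul, one_mul]
      change _ ≤ waveSeq β φ m ^ 2 + Z m ^ 2
      have e2 : 2 * waveSeq β φ m ^ 2 = A ^ 2 - A ^ 2 * cos (2 * (m * φ + α)) := by
        rw [hY, cos_two_mul, mul_pow]
        linear_combination (2 * A ^ 2) * sin_sq_add_cos_sq ((m : ℝ) * φ + α)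
      have e3 : |waveSeq β φ m * (Z m - waveSeq β φ m)| ≤ A * (A * (C0 * φ)) := by
        rw [abs_mul]
        exact mul_le_mul (hYle m) (hZY m) (abs_nonneg _) hA.le
      have e4 := neg_abs_le (waveSeq β φ m * (Z m - waveSeq β φ m))
      nlinarith [sq_nonneg (Z m - waveSeq β φ m)]
    refine le_trans ?_ (Finset.sum_le_sum e1)
    rw [Finset.sum_sub_distrib, Finset.sum_sub_distrib, ← Finset.mul_sum, Finset.sum_const,
      Finset.sum_const, Finset.card_range, nsmul_eq_mul, nsmul_eq_mul]
    have e5 := two_sin_mul_sum_cos n φ α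
    set S := ∑ m ∈ Finset.range n, cos (2 * (m * φ + α)) with hS
    -- The oscillating sum is `sin (n φ) / sin φ` times a cosine, bounded because `sin (n φ) =
    -- O(φ)`. It costs `2 C₁`, and the sublattice discrepancy costs `12 C0` because `n φ ≤ 6`.
    have e6 : sin φ * S ≤ C₁ * φ := by
      rw [e5]
      refine (le_abs_self _).trans ?_
      rw [abs_mul]
      exact (mul_le_of_le_one_right (abs_nonneg _) (abs_cos_le_one _)).trans hsin
    have e7 : S ≤ 2 * C₁ := by
      have e8 := mul_le_sin hφ0.le hφπ2
      rw [div_mul_eq_mul_div, div_le_iff₀ hpi] at e8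
      have e9 : φ / 2 ≤ sin φ := by nlinarith
      by_contra hneg
      push Not at hneg
      nlinarith
    have e10 : n * (2 * C0 * φ * A ^ 2) ≤ 12 * C0 * A ^ 2 := by
      have : n * (2 * C0 * φ * A ^ 2) = (n * φ) * (2 * C0 * A ^ 2) := by ring
      rw [this]
      have h6 : (n : ℝ) * φ ≤ 6 := by linarith
      have := mul_le_mul_of_nonneg_right h6 (by positivity : 0 ≤ 2 * C0 * A ^ 2)
      linarith
    have e11 := mul_le_mul_of_nonneg_left e7 (sq_nonneg A)
    nlinarith [sq_nonneg A]

set_option maxHeartbeats 2000000 in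
/-- The lowest optical mode: existence, phase, and shape of the normalized eigenvector. -/
theorem lowestOpticalMode_estimates (hk₁ : 0 < k₁) (hk₂ : k₁ < k₂) (hδ : 0 < δ) :
    ∃ (C : ℝ) (N : ℕ), 0 < C ∧ 4 ≤ N ∧ ∀ n, N ≤ n → ∀ k₃₁ k₃₂ : ℝ, 0 ≤ k₃₁ → 0 ≤ k₃₂ →
      k₃₁ ≤ k₁ + 2 * k₂ → k₃₂ ≤ k₁ + 2 * k₂ → δ ≤ |k₃₁ - 2 * k₂| → δ ≤ |k₃₂ - 2 * k₂| →
      (∃ w u, IsLowestOpticalMode n k₁ k₂ k₃₁ k₃₂ w u) ∧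
      ∀ w u, IsLowestOpticalMode n k₁ k₂ k₃₁ k₃₂ w u → ∃ φ : ℝ, 0 < φ ∧ |n * φ - π| ≤ C / n ∧
        w ^ 2 = bandOffset k₁ k₂ φ + k₁ + k₂ ∧
        ‖(1 / √(∑ j, u j ^ 2)) • u‖ ≤ 1.01 / √n ∧
        envelopeLip ((1 / √(∑ j, u j ^ 2)) • u) ≤ C / (n * √n) := by
  obtain ⟨N₁, hN₁, hex⟩ := exists_phase hk₁ hk₂ hδ
  obtain ⟨C₁, N₂, hC₁, hN₂, hasym⟩ := exists_phase_asymptotics hk₁ hk₂ hδ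
  obtain ⟨C, hC, hwave⟩ := leftWave_estimates hk₁ hk₂ C₁ hC₁
  -- With `n ≥ 1500 C` one has `n - C ≥ 0.999 n` and `C φ ≤ 0.005`; the two errors together stay
  -- below one percent.
  obtain ⟨N₃, hN₃⟩ := exists_nat_ge (1500 * C)
  refine ⟨C₁ + 12 * C, N₁ + N₂ + N₃, by positivity, by omega, ?_⟩
  intro n hn k₃₁ k₃₂ h1 h2 h3 h4 h5 h6
  obtain ⟨n, rfl⟩ := Nat.exists_eq_succ_of_ne_zero (show n ≠ 0 by omega)
  rw [Nat.succ_eq_add_one] at *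
  have hpi := pi_pos
  have hpi4 := pi_lt_four
  have hn4 : (4 : ℝ) ≤ (n + 1 : ℕ) := by exact_mod_cast (by omega : 4 ≤ n + 1)
  have hnC : 1500 * C ≤ (n + 1 : ℕ) := hN₃.trans (by exact_mod_cast (by omega : N₃ ≤ n + 1))
  have hlt : ∀ t : ℝ, 0 < t → (n + 1 : ℕ) * t ≤ 3 * π / 2 → t < π := by
    intro t ht ht2
    have := mul_le_mul_of_nonneg_right hn4 ht.le
    linarith
  obtain ⟨φ₀, hφ₀, hφ₀n, hφ₀R⟩ := hex n (by omega) k₃₁ k₃₂ h1 h2 h3 h4 h5 h6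
  obtain ⟨w₀, u₀, hmode, hw₀⟩ := isOpticalMode_of_phase hk₁ hk₂ hφ₀ (hlt _ hφ₀ hφ₀n) hφ₀R
  refine ⟨exists_lowestOpticalMode hmode, fun w u hu => ?_⟩
  obtain ⟨φ, c, hφ0, hφπ, hw, huc, hR⟩ := hu.1.exists_phase hk₁ hk₂
  have hww : w ^ 2 ≤ w₀ ^ 2 := pow_le_pow_left₀ hu.1.pos.le (hu.2 w₀ u₀ hmode) 2
  -- The frequency increases with the phase on `[0, π]`, so minimality of the mode passes to its
  -- phase.
  have hφle : φ ≤ φ₀ := by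
    by_contra hneg
    push Not at hneg
    have hcos := cos_lt_cos_of_nonneg_of_le_pi hφ₀.le hφπ.le hneg
    have hoff : bandOffset k₁ k₂ φ₀ < bandOffset k₁ k₂ φ := by
      refine lt_of_pow_lt_pow_left₀ 2 (sqrt_nonneg _) ?_
      rw [bandOffset_sq hk₁ hk₂, bandOffset_sq hk₁ hk₂]
      have : 0 < 2 * k₁ * k₂ := by
        have := hk₁.trans hk₂
        positivity
      nlinarith
    linarith
  have hφn : (n + 1 : ℕ) * φ ≤ 3 * π / 2 :=
    (mul_le_mul_of_nonneg_left hφle (by linarith)).trans hφ₀n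
  obtain ⟨ha1, ha2⟩ := hasym n (by omega) k₃₁ k₃₂ φ h1 h2 h3 h4 h5 h6 hφ0 hφn hR
  obtain ⟨A, hA, hv1, hv2, hv3⟩ := hwave (n + 1) φ
    ((bandOffset k₁ k₂ φ * (k₂ - k₃₁) + k₂ ^ 2) / (k₁ * k₂)) hφ0 (by omega) hφn ha1
  set v := leftWave (n + 1) k₁ k₂ (bandOffset k₁ k₂ φ)
    ((bandOffset k₁ k₂ φ * (k₂ - k₃₁) + k₂ ^ 2) / (k₁ * k₂)) φ with hv
  set x : ℝ := ((n + 1 : ℕ) : ℝ) with hx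
  have hx0 : 0 < x := by linarith
  have hc0 : c ≠ 0 := by
    rintro rfl
    rw [zero_smul] at huc
    exact hu.1.ne_zero huc
  have hsum : ∑ j, u j ^ 2 = c ^ 2 * ∑ j, v j ^ 2 := by
    rw [huc, Finset.mul_sum]
    simp only [Pi.smul_apply, smul_eq_mul, mul_pow]
  have hVpos : A ^ 2 * (x * 0.999) ≤ ∑ j, v j ^ 2 := by
    refine le_trans (mul_le_mul_of_nonneg_left ?_ (sq_nonneg A)) hv3
    linarith
  set V := ∑ j, v j ^ 2 with hV
  have hV0 : 0 < V := lt_of_lt_of_le (by positivity) hVpos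
  have hAV : A * (√x * 0.999) ≤ √V := by
    refine le_sqrt_of_sq_le (le_trans ?_ hVpos)
    rw [mul_pow, mul_pow, sq_sqrt hx0.le]
    have : 0 ≤ A ^ 2 * x := by positivity
    nlinarith
  have hxs : 0 < √x := sqrt_pos.2 hx0
  have hAV2 : A / √V ≤ 1.0011 / √x := by
    rw [div_le_div_iff₀ (sqrt_pos.2 hV0) hxs]
    nlinarith [mul_pos hA hxs]
  have hscale : ∀ p : Seminorm ℝ (Fin (2 * (n + 1)) → ℝ),
      p ((1 / √(∑ j, u j ^ 2)) • u) = p v / √V := by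
    intro p
    rw [hsum, sqrt_mul (sq_nonneg c), sqrt_sq_eq_abs, huc, smul_smul, map_smul_eq_mul, norm_mul,
      norm_div, norm_one, Real.norm_eq_abs, Real.norm_eq_abs, abs_mul, abs_abs,
      abs_of_nonneg (sqrt_nonneg V)]
    have := abs_pos.2 hc0
    have := sqrt_pos.2 hV0
    field_simp
  have hφ6 : φ ≤ 6 / x := by
    rw [le_div_iff₀ hx0]
    linarith
  have hCφ : C * φ ≤ 0.005 := by
    have : C * φ ≤ C * (6 / x) := by gcongr
    have e : C * (6 / x) ≤ 0.005 := by
      rw [mul_div_assoc', div_le_iff₀ hx0]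
      linarith
    linarith
  refine ⟨φ, hφ0, ha2.trans ?_, hw, ?_, ?_⟩
  · gcongr
    linarith
  · have e := hscale (normSeminorm ℝ _)
    simp only [coe_normSeminorm] at e
    rw [e]
    calc ‖v‖ / √V ≤ A * (1 + C * φ) / √V := by gcongr
      _ = A / √V * (1 + C * φ) := by ring
      _ ≤ 1.0011 / √x * 1.005 := by gcongr; linarith
      _ ≤ 1.01 / √x := by
        rw [div_mul_eq_mul_div]
        gcongr
        norm_num
  · rw [hscale envelopeLip]
    calc envelopeLip v / √V ≤ A * (C * φ) / √V := by gcongr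
      _ = A / √V * (C * φ) := by ring
      _ ≤ 1.0011 / √x * (C * (6 / x)) := by gcongr
      _ = 6.0066 * C / (x * √x) := by
        field_simp
        norm_num
      _ ≤ (C₁ + 12 * C) / (x * √x) := by
        gcongr
        linarith

end ModeAsymptotics

/-! ### Discrete variation of constants for the forced chain -/

section ForcedChain

open Real

/-- Variation of constants for the operator `y (l+2) - 2 cos φ y (l+1) + y l`, with Green function
`sin ((m - l) φ) / sin φ`. -/
theorem sin_mul_eq_sum_of_apply_zero (φ : ℝ) {y : ℕ → ℝ} (h0 : y 0 = 0) (m : ℕ) :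
    sin φ * y (m + 1) = sin ((m + 1) * φ) * y 1 +
      ∑ l ∈ Finset.range m, sin ((m - l) * φ) * (y (l + 2) - 2 * cos φ * y (l + 1) + y l) := by
  have g : ∀ x, sin (x + φ + φ) = 2 * cos φ * sin (x + φ) - sin x := by
    intro x
    rw [sin_add (x + φ), cos_add x, sin_add x]
    linear_combination (-sin x) * sin_sq_add_cos_sq φ
  induction m using Nat.twoStepInduction with
  | zero => simp
  | one =>
    have e : sin ((1 + 1) * φ) = 2 * sin φ * cos φ := by rw [← sin_two_mul]; ring_nf
    simp [h0, e]
    ring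
  | more m ih1 ih2 =>
    rw [Finset.sum_range_succ, Finset.sum_range_succ]
    rw [Finset.sum_range_succ] at ih2
    push_cast at ih1 ih2 ⊢
    have e1 : ((m : ℝ) + 2 + 1) * φ = (m + 1) * φ + φ + φ := by ring
    have e2 : ((m : ℝ) + 1 + 1) * φ = (m + 1) * φ + φ := by ring
    have e3 : ∀ l : ℕ, ((m : ℝ) + 2 - l) * φ = (m - l) * φ + φ + φ := fun l => by ring
    have e4 : ∀ l : ℕ, ((m : ℝ) + 1 - l) * φ = (m - l) * φ + φ := fun l => by ring
    have e5 : ((m : ℝ) + 2 - (m + 1)) * φ = φ := by ring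
    have e6 : sin (((m : ℝ) - m) * φ + φ) = sin φ := by rw [sub_self, zero_mul, zero_add]
    have e7 : sin (((m : ℝ) - m) * φ) = 0 := by rw [sub_self, zero_mul, sin_zero]
    rw [e2] at ih2
    simp only [e4] at ih2
    rw [e6] at ih2
    rw [e1, e5]
    simp only [e3, g, e6, e7]
    simp only [sub_mul, Finset.sum_sub_distrib, mul_assoc, ← Finset.mul_sum] at *
    linear_combination (2 * cos φ) * ih2 - ih1

theorem abs_apply_le_of_apply_zero {φ : ℝ} (hφ : 0 < sin φ) {y : ℕ → ℝ} (h0 : y 0 = 0) (m : ℕ) :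
    |y (m + 1)| ≤ (|y 1| + ∑ l ∈ Finset.range m, |y (l + 2) - 2 * cos φ * y (l + 1) + y l|) /
      sin φ := by
  rw [le_div_iff₀ hφ, mul_comm, ← abs_of_pos hφ, ← abs_mul,
    sin_mul_eq_sum_of_apply_zero φ h0]
  refine (abs_add_le _ _).trans (add_le_add ?_ ((Finset.abs_sum_le_sum_abs _ _).trans
    (Finset.sum_le_sum fun l _ => ?_)))
  · rw [abs_mul]
    exact mul_le_of_le_one_left (abs_nonneg _) (abs_sin_le_one _)
  · rw [abs_mul]
    exact mul_le_of_le_one_left (abs_nonneg _) (abs_sin_le_one _)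

/-- Differencing the Green function gains a factor `φ` that cancels `1 / sin φ`. Differences of `y`
are therefore smaller than `y` by one power of `n`. -/
theorem abs_sub_apply_le_of_apply_zero {φ : ℝ} (hφ0 : 0 < φ) (hφ1 : φ ≤ 1) {y : ℕ → ℝ}
    (h0 : y 0 = 0) (m : ℕ) : |y (m + 1) - y m| ≤
      2 * (|y 1| + ∑ l ∈ Finset.range m, |y (l + 2) - 2 * cos φ * y (l + 1) + y l|) := by
  have hS : ∀ m, 0 ≤ ∑ l ∈ Finset.range m, |y (l + 2) - 2 * cos φ * y (l + 1) + y l| := fun m =>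
    Finset.sum_nonneg fun _ _ => abs_nonneg _
  have hy1 := abs_nonneg (y 1)
  rcases m with _ | m
  · simp only [zero_add, h0, sub_zero, Finset.range_zero, Finset.sum_empty]
    linarith
  have hpi4 := pi_lt_four
  have hpi3 := pi_gt_three
  have hsin : φ / 2 ≤ sin φ := by
    have e8 := mul_le_sin hφ0.le (by linarith)
    rw [div_mul_eq_mul_div, div_le_iff₀ pi_pos] at e8
    nlinarith
  have hd : ∀ x, |sin (x + φ) - sin x| ≤ φ := fun x => by
    have := abs_sin_sub_sin_le_abs (x + φ) x
    rwa [add_sub_cancel_left, abs_of_pos hφ0] at this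
  set F : ℕ → ℝ := fun l => y (l + 2) - 2 * cos φ * y (l + 1) + y l with hF
  have e : sin φ * (y (m + 1 + 1) - y (m + 1)) =
      (sin ((m + 1) * φ + φ) - sin ((m + 1) * φ)) * y 1 +
      ∑ l ∈ Finset.range (m + 1), (sin ((m - l) * φ + φ) - sin ((m - l) * φ)) * F l := by
    rw [mul_sub, sin_mul_eq_sum_of_apply_zero φ h0 (m + 1), sin_mul_eq_sum_of_apply_zero φ h0 m]
    simp only [sub_mul, Finset.sum_sub_distrib]
    rw [Finset.sum_range_succ (fun l => sin (m * φ - l * φ) * F l)]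
    simp only [sub_self, sin_zero, zero_mul, add_zero]
    push_cast
    simp only [hF, add_mul, one_mul, sub_add_eq_add_sub]
    ring
  have h1 : sin φ * |y (m + 1 + 1) - y (m + 1)| ≤
      φ * (|y 1| + ∑ l ∈ Finset.range (m + 1), |F l|) := by
    rw [← abs_of_pos (show 0 < sin φ by linarith), ← abs_mul, e, mul_add, Finset.mul_sum]
    refine (abs_add_le _ _).trans (add_le_add ?_ ((Finset.abs_sum_le_sum_abs _ _).trans
      (Finset.sum_le_sum fun l _ => ?_)))
    · rw [abs_mul]
      exact mul_le_mul_of_nonneg_right (hd _) (abs_nonneg _)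
    · rw [abs_mul]
      exact mul_le_mul_of_nonneg_right (hd _) (abs_nonneg _)
  have h2 : φ / 2 * |y (m + 1 + 1) - y (m + 1)| ≤
      φ * (|y 1| + ∑ l ∈ Finset.range (m + 1), |F l|) :=
    (mul_le_mul_of_nonneg_right hsin (abs_nonneg _)).trans h1
  have h3 : φ * |y (m + 1 + 1) - y (m + 1)| ≤
      φ * (2 * (|y 1| + ∑ l ∈ Finset.range (m + 1), |F l|)) := by linarith
  exact le_of_mul_le_mul_left h3 hφ0

variable {n : ℕ} {k₁ k₂ k₃₁ k₃₂ : ℝ}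

/-- The forced linear chain in terms of the envelopes of the two sublattices. -/
theorem forced_recurrence_bounds (hk₁ : 0 < k₁) (hk₂ : k₁ < k₂) {K : ℝ} (hK : 0 ≤ K) :
    ∃ C : ℝ, 0 < C ∧ ∀ (n : ℕ) (D φ H Λ : ℝ) (y z a b : ℕ → ℝ), 2 ≤ n → 0 < φ → φ ≤ 1 →
      1 ≤ n * φ → k₂ - k₁ ≤ D → D ≤ k₁ + k₂ →
      D ^ 2 = k₁ ^ 2 + k₂ ^ 2 - 2 * k₁ * k₂ * cos φ → (D - (k₂ - k₁)) * n ^ 2 ≤ K →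
      y 0 = 0 → k₁ * z 0 = a 0 →
      (∀ m, m + 1 < n → D * y (m + 1) - k₂ * z m + k₁ * z (m + 1) = a (m + 1)) →
      (∀ m, m + 1 < n → D * z m + k₁ * y m - k₂ * y (m + 1) = b m) →
      (∀ m, |a m| ≤ H) → (∀ m, |b m| ≤ H) → 0 ≤ Λ → Λ ≤ 2 * H →
      (∀ m, m < n → |a m - b m| ≤ Λ) → (∀ m, m + 1 < n → |a (m + 1) - b m| ≤ Λ) →
      (∀ m, m < n → |y m| ≤ (D + k₂ - k₁) / (k₁ * k₂) / (2 * sin φ) *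
        ∑ l ∈ Finset.range m, (|a l| + |b l|) + C * (n * H + n ^ 2 * Λ)) ∧
      (∀ m, m < n → |z m - y m| ≤ C * (n * H)) ∧
      (∀ m, m + 1 < n → |y (m + 1) - z m| ≤ C * (n * H)) := by
  have hk : 0 < k₂ := hk₁.trans hk₂
  have hkk : 0 < k₂ - k₁ := sub_pos.2 hk₂
  set c₁ := (11 * K / k₁ + 12) / (k₂ - k₁) with hc₁
  have hc₁0 : 0 < c₁ := by positivity
  set c₂ := (1 + 11 * K / k₁ + k₂ * c₁) / k₁ with hc₂
  have hc₂0 : 0 < c₂ := by positivity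
  refine ⟨c₁ + c₂ + 6 / k₁, by positivity, ?_⟩
  intro n D φ H Λ y z a b hn hφ0 hφ1 hnφ hD1 hD2 hcos hDK hy0 hz0 heven hodd ha hb hΛ0 hΛ2 hab hab'
  have hn2 : (2 : ℝ) ≤ n := by exact_mod_cast hn
  have hn0 : (0 : ℝ) < n := by linarith
  have hH : 0 ≤ H := (abs_nonneg _).trans (ha 0)
  have hD0 : 0 < D := by linarith
  have hnH : H ≤ n * H := le_mul_of_one_le_left hH (by linarith)
  set q := H / k₁ with hq
  have hq0 : 0 ≤ q := by positivity
  have hHq : H = k₁ * q := by rw [hq]; field_simp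
  have hy1 : |y 1| ≤ 3 * q := by
    have e := hodd 0 (by omega)
    have e1 : k₁ * k₂ * y 1 = D * a 0 - k₁ * b 0 := by
      rw [hy0, zero_add] at e
      linear_combination (-k₁) * e + D * hz0
    have e2 : k₁ * k₂ * |y 1| ≤ k₁ * k₂ * (3 * q) := by
      rw [← abs_of_pos (mul_pos hk₁ hk), ← abs_mul, e1, abs_of_pos (mul_pos hk₁ hk)]
      refine (abs_sub _ _).trans ?_
      rw [abs_mul, abs_mul, abs_of_pos hD0, abs_of_pos hk₁]
      have e3 := mul_le_mul_of_nonneg_left (ha 0) hD0.le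
      have e4 := mul_le_mul_of_nonneg_left (hb 0) hk₁.le
      have e5 : (D + k₁) * H ≤ 3 * k₂ * H := mul_le_mul_of_nonneg_right (by linarith) hH
      have e6 : k₁ * k₂ * (3 * q) = 3 * k₂ * H := by rw [hHq]; ring
      linarith
    exact le_of_mul_le_mul_left e2 (mul_pos hk₁ hk)
  set F : ℕ → ℝ := fun l => y (l + 2) - 2 * cos φ * y (l + 1) + y l with hF
  -- Elimination of `z` from one even row and two adjacent odd rows; the dispersion relation turns
  -- `D²` into `cos φ`.
  have hFeq : ∀ l, l + 2 < n →
      k₁ * k₂ * F l = D * a (l + 1) + k₂ * b l - k₁ * b (l + 1) := by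
    intro l hl
    have e1 := heven l (by omega)
    have e2 := hodd l (by omega)
    have e3 := hodd (l + 1) (by omega)
    simp only [hF]
    linear_combination D * e1 + k₂ * e2 - k₁ * e3 - y (l + 1) * hcos
  have hFle : ∀ l, l + 2 < n → |F l| ≤ 4 * q := by
    intro l hl
    have e2 : k₁ * k₂ * |F l| ≤ k₁ * k₂ * (4 * q) := by
      rw [← abs_of_pos (mul_pos hk₁ hk), ← abs_mul, hFeq l hl, abs_of_pos (mul_pos hk₁ hk)]
      refine (abs_sub _ _).trans ((add_le_add_left (abs_add_le _ _) _).trans ?_)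
      rw [abs_mul, abs_mul, abs_mul, abs_of_pos hD0, abs_of_pos hk₁, abs_of_pos hk]
      have e3 := mul_le_mul_of_nonneg_left (ha (l + 1)) hD0.le
      have e4 := mul_le_mul_of_nonneg_left (hb (l + 1)) hk₁.le
      have e7 := mul_le_mul_of_nonneg_left (hb l) hk.le
      have e5 : (D + k₁ + k₂) * H ≤ 4 * k₂ * H := mul_le_mul_of_nonneg_right (by linarith) hH
      have e6 : k₁ * k₂ * (4 * q) = 4 * k₂ * H := by rw [hHq]; ring
      linarith
    exact le_of_mul_le_mul_left e2 (mul_pos hk₁ hk)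
  set C1 := (D + k₂ - k₁) / (k₁ * k₂) with hC1
  have hC10 : 0 ≤ C1 := by
    have : 0 ≤ D + k₂ - k₁ := by linarith
    positivity
  -- The forcing splits into its mean over the two sublattices, with coefficient `D + k₂ - k₁` close
  -- to `2 (k₂ - k₁)`, and differences controlled by `Λ`. This is where slow variation improves the
  -- leading constant.
  have hFle' : ∀ l, l + 2 < n →
      |F l| ≤ C1 / 2 * (|a (l + 1)| + |b (l + 1)|) + 3 * Λ / k₁ := by
    intro l hl
    have e2 : k₁ * k₂ * |F l| ≤
        k₁ * k₂ * (C1 / 2 * (|a (l + 1)| + |b (l + 1)|) + 3 * Λ / k₁) := by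
      rw [← abs_of_pos (mul_pos hk₁ hk), ← abs_mul, hFeq l hl, abs_of_pos (mul_pos hk₁ hk)]
      have e1 : D * a (l + 1) + k₂ * b l - k₁ * b (l + 1) =
          (D + k₂ - k₁) / 2 * (a (l + 1) + b (l + 1)) +
          (D + k₂ + k₁) / 2 * (a (l + 1) - b (l + 1)) - k₂ * (a (l + 1) - b l) := by ring
      rw [e1]
      refine (abs_sub _ _).trans ((add_le_add_left (abs_add_le _ _) _).trans ?_)
      rw [abs_mul, abs_mul, abs_mul, abs_of_nonneg (by linarith : 0 ≤ (D + k₂ - k₁) / 2),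
        abs_of_nonneg (by linarith : 0 ≤ (D + k₂ + k₁) / 2), abs_of_pos hk]
      have e3 := mul_le_mul_of_nonneg_left (abs_add_le (a (l + 1)) (b (l + 1)))
        (by linarith : 0 ≤ (D + k₂ - k₁) / 2)
      have e4 := mul_le_mul_of_nonneg_left (hab (l + 1) (by omega))
        (by linarith : 0 ≤ (D + k₂ + k₁) / 2)
      have e7 := mul_le_mul_of_nonneg_left (hab' l (by omega)) hk.le
      have e5 : ((D + k₁ + k₂) / 2 + k₂) * Λ ≤ 3 * k₂ * Λ :=
        mul_le_mul_of_nonneg_right (by linarith) hΛ0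
      have e6 : k₁ * k₂ * (C1 / 2 * (|a (l + 1)| + |b (l + 1)|) + 3 * Λ / k₁) =
          (D + k₂ - k₁) / 2 * (|a (l + 1)| + |b (l + 1)|) + 3 * k₂ * Λ := by
        rw [hC1]
        field_simp
      linarith
    exact le_of_mul_le_mul_left e2 (mul_pos hk₁ hk)
  have hdiff : ∀ m, m + 1 < n → |y (m + 1) - y m| ≤ 11 * n * q := by
    intro m hm
    refine (abs_sub_apply_le_of_apply_zero hφ0 hφ1 hy0 m).trans ?_
    have hlast : ∑ l ∈ Finset.range m, |F l| ≤ ∑ l ∈ Finset.range m, 4 * q :=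
      Finset.sum_le_sum fun l hl => hFle l (by rw [Finset.mem_range] at hl; omega)
    rw [Finset.sum_const, Finset.card_range, nsmul_eq_mul] at hlast
    have hmn : (m : ℝ) ≤ n := by exact_mod_cast (by omega : m ≤ n)
    have e1 : m * (4 * q) ≤ n * (4 * q) := mul_le_mul_of_nonneg_right hmn (by positivity)
    have e2 : 2 * q ≤ n * q := mul_le_mul_of_nonneg_right hn2 hq0
    linarith
  have hyle : ∀ m, m < n → |y m| ≤ 11 * n ^ 2 * q := by
    intro m hm
    have e : ∀ m : ℕ, m < n → |y m| ≤ m * (11 * n * q) := by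
      intro m
      induction m with
      | zero => simp [hy0]
      | succ m ih =>
        intro hm
        have e1 := abs_add_le (y (m + 1) - y m) (y m)
        rw [sub_add_cancel] at e1
        have e2 := ih (by omega)
        have e3 := hdiff m hm
        push_cast
        linarith
    have hmn : (m : ℝ) ≤ n := by exact_mod_cast hm.le
    have e1 := mul_le_mul_of_nonneg_right hmn (by positivity : 0 ≤ 11 * n * q)
    have e2 := e m hm
    linarith
  -- Although `y` may be of size `n² H`, the offset from the band edge is `O(n⁻²)`, so this term is
  -- harmless in the differences between sublattices.
  have hκ : ∀ m, m < n → (D - (k₂ - k₁)) * |y m| ≤ 11 * K / k₁ * (n * H) := by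
    intro m hm
    have e1 := mul_le_mul_of_nonneg_left (hyle m hm) (by linarith : 0 ≤ D - (k₂ - k₁))
    have e2 := mul_le_mul_of_nonneg_right hDK (by positivity : 0 ≤ 11 * q)
    have e3 : 11 * K / k₁ * H ≤ 11 * K / k₁ * (n * H) :=
      mul_le_mul_of_nonneg_left hnH (by positivity)
    have e4 : 11 * K / k₁ * H = K * (11 * q) := by rw [hq]; ring
    linarith
  have hP : ∀ m, m + 1 < n → |y (m + 1) - z m| ≤ c₁ * (n * H) := by
    intro m hm
    have e1 : D * (y (m + 1) - z m) = (D - (k₂ - k₁)) * y (m + 1) -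
        k₁ * (y (m + 1) - y m) - b m := by
      linear_combination -hodd m hm
    have e2 : D * |y (m + 1) - z m| ≤ (11 * K / k₁ + 12) * (n * H) := by
      rw [← abs_of_pos hD0, ← abs_mul, e1]
      refine (abs_sub _ _).trans ((add_le_add_left (abs_sub _ _) _).trans ?_)
      rw [abs_mul, abs_mul, abs_of_nonneg (by linarith : 0 ≤ D - (k₂ - k₁)), abs_of_pos hk₁]
      have e3 := hκ (m + 1) hm
      have e4 := mul_le_mul_of_nonneg_left (hdiff m hm) hk₁.le
      have e5 : k₁ * (11 * n * q) = 11 * (n * H) := by rw [hHq]; ring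
      have e6 := hb m
      linarith
    have e3 : (k₂ - k₁) * |y (m + 1) - z m| ≤ D * |y (m + 1) - z m| :=
      mul_le_mul_of_nonneg_right hD1 (abs_nonneg _)
    rw [hc₁, div_mul_eq_mul_div, le_div_iff₀ hkk]
    linarith
  have hR : ∀ m, m < n → |z m - y m| ≤ c₂ * (n * H) := by
    intro m hm
    rw [hc₂, div_mul_eq_mul_div, le_div_iff₀ hk₁, mul_comm, ← abs_of_pos hk₁, ← abs_mul,
      abs_of_pos hk₁]
    have e0 : 0 ≤ k₂ * c₁ * (n * H) := by positivity
    have e00 : 0 ≤ 11 * K / k₁ * (n * H) := by positivity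
    rcases m with _ | m
    · rw [hy0, sub_zero, hz0]
      linarith [ha 0]
    · have e1 : k₁ * (z (m + 1) - y (m + 1)) = a (m + 1) - (D - (k₂ - k₁)) * y (m + 1) -
          k₂ * (y (m + 1) - z m) := by
        linear_combination heven m hm
      rw [e1]
      refine (abs_sub _ _).trans ((add_le_add_left (abs_sub _ _) _).trans ?_)
      rw [abs_mul, abs_mul, abs_of_nonneg (by linarith : 0 ≤ D - (k₂ - k₁)), abs_of_pos hk]
      have e3 := hκ (m + 1) hm
      have e4 := mul_le_mul_of_nonneg_left (hP m hm) hk.le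
      have e6 := ha (m + 1)
      linarith
  have hnH0 : 0 ≤ n * H := by positivity
  have hnΛ0 : 0 ≤ n ^ 2 * Λ := by positivity
  have hk₁6 : 0 < 6 / k₁ := by positivity
  have hpi4 := pi_lt_four
  have hpi3 := pi_gt_three
  have hsin : φ / 2 ≤ sin φ := by
    have e8 := mul_le_sin hφ0.le (by linarith)
    rw [div_mul_eq_mul_div, div_le_iff₀ pi_pos] at e8
    nlinarith
  have hsin0 : 0 < sin φ := by linarith
  refine ⟨fun m hm => ?_, fun m hm => (hR m hm).trans ?_, fun m hm => (hP m hm).trans ?_⟩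
  · have hsum0 : 0 ≤ ∑ l ∈ Finset.range m, (|a l| + |b l|) :=
      Finset.sum_nonneg fun _ _ => by positivity
    rcases m with _ | m
    · rw [hy0, abs_zero]
      positivity
    refine (abs_apply_le_of_apply_zero hsin0 hy0 m).trans ?_
    have e1 : ∑ l ∈ Finset.range m, |F l| ≤
        C1 / 2 * ∑ l ∈ Finset.range (m + 1), (|a l| + |b l|) + n * (3 * Λ / k₁) := by
      calc _ ≤ ∑ l ∈ Finset.range m, (C1 / 2 * (|a (l + 1)| + |b (l + 1)|) + 3 * Λ / k₁) :=
            Finset.sum_le_sum fun l hl => hFle' l (by rw [Finset.mem_range] at hl; omega)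
        _ ≤ _ := by
          rw [Finset.sum_add_distrib, ← Finset.mul_sum, Finset.sum_const, Finset.card_range,
            nsmul_eq_mul, Finset.sum_range_succ' (fun l => |a l| + |b l|)]
          refine add_le_add (mul_le_mul_of_nonneg_left ?_ (by positivity))
            (mul_le_mul_of_nonneg_right ?_ (by positivity))
          · linarith [abs_nonneg (a 0), abs_nonneg (b 0)]
          · exact_mod_cast (by omega : m ≤ n)
    -- Here `1 / sin φ ≤ 2 n`, because `n φ ≥ 1` and `sin φ ≥ φ / 2`.
    have e2 : (3 * q + n * (3 * Λ / k₁)) / sin φ ≤ 6 / k₁ * (n * H + n ^ 2 * Λ) := by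
      rw [div_le_iff₀ hsin0]
      have e3 : 1 ≤ 2 * n * sin φ := by nlinarith
      have e4 : 6 / k₁ * (n * H + n ^ 2 * Λ) * sin φ =
          (3 * q + n * (3 * Λ / k₁)) * (2 * n * sin φ) := by
        rw [hq]
        field_simp
        ring
      rw [e4]
      exact le_mul_of_one_le_right (by positivity) e3
    have e3 : (|y 1| + ∑ l ∈ Finset.range m, |F l|) / sin φ ≤
        (C1 / 2 * ∑ l ∈ Finset.range (m + 1), (|a l| + |b l|) +
          (3 * q + n * (3 * Λ / k₁))) / sin φ := by
      refine div_le_div_of_nonneg_right ?_ hsin0.le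
      linarith
    refine e3.trans ?_
    rw [add_div]
    refine add_le_add (le_of_eq ?_) (e2.trans ?_)
    · field_simp
    · exact mul_le_mul_of_nonneg_right (by linarith) (by positivity)
  · exact mul_le_mul_of_nonneg_right (by linarith) hnH0
  · exact mul_le_mul_of_nonneg_right (by linarith) hnH0

/-- Size of a solution of the forced chain that vanishes at the first mass. -/
theorem forced_left_bounds (hk₁ : 0 < k₁) (hk₂ : k₁ < k₂) {K : ℝ} (hK : 0 ≤ K) :
    ∃ C : ℝ, 0 < C ∧ ∀ (n : ℕ) (D φ k₃₁ k₃₂ : ℝ) (w h : Fin (2 * n) → ℝ), 2 ≤ n → 0 < φ → φ ≤ 1 →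
      1 ≤ n * φ → k₂ - k₁ ≤ D → D ≤ k₁ + k₂ →
      D ^ 2 = k₁ ^ 2 + k₂ ^ 2 - 2 * k₁ * k₂ * cos φ → (D - (k₂ - k₁)) * n ^ 2 ≤ K →
      vecExt w 0 = 0 →
      (D + k₁ + k₂) • w + (chainMatrix n k₁ k₂ k₃₁ k₃₂).mulVec w = h →
      (∀ i, i < 2 * n → |vecExt w i| ≤ (D + k₂ - k₁) / (k₁ * k₂) / (2 * sin φ) *
        ∑ j ∈ Finset.range (2 * (i / 2)), |vecExt h j| + C * (n * ‖h‖ + n ^ 2 * envelopeLip h)) ∧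
      envelopeLip w ≤ C * (n * ‖h‖) := by
  obtain ⟨C, hC, hmain⟩ := forced_recurrence_bounds hk₁ hk₂ hK
  refine ⟨2 * C, by positivity, ?_⟩
  intro n D φ k₃₁ k₃₂ w h hn hφ0 hφ1 hnφ hD1 hD2 hcos hDK hw0 hw
  have hsgn : ∀ m : ℕ, ((-1 : ℝ) ^ m) * (-1) ^ m = 1 := fun m => by
    rw [← mul_pow]
    norm_num
  have habs : ∀ (m : ℕ) (x : ℝ), |(-1) ^ m * x| = |x| := fun m x => by
    rw [abs_mul, abs_pow, abs_neg, abs_one, one_pow, one_mul]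
  have hL0 : 0 ≤ envelopeLip h := apply_nonneg _ _
  -- Multiplication by the edge sign `(-1) ^ m` of each cell turns the chain rows into the envelope
  -- recurrences.
  obtain ⟨h1, h2, h3⟩ := hmain n D φ ‖h‖ (envelopeLip h) (fun m => (-1) ^ m * vecExt w (2 * m))
    (fun m => (-1) ^ m * vecExt w (2 * m + 1)) (fun m => (-1) ^ m * vecExt h (2 * m))
    (fun m => (-1) ^ m * vecExt h (2 * m + 1)) hn hφ0 hφ1 hnφ hD1 hD2 hcos hDK
    (by simp [hw0])
    (by
      have := row_zero (by omega) hw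
      simp only [pow_zero, mul_zero, zero_add, one_mul]
      rw [hw0] at this
      linarith)
    (fun m hm => by
      have := row_even hw hm
      rw [pow_succ]
      linear_combination (-(-1) ^ m) * this)
    (fun m hm => by
      have := row_odd hw hm
      rw [pow_succ]
      linear_combination ((-1) ^ m) * this)
    (fun m => by rw [habs]; exact abs_vecExt_le _ _)
    (fun m => by rw [habs]; exact abs_vecExt_le _ _) hL0 (envelopeLip_le_two_mul_norm h)
    (fun m hm => by
      have := abs_envelope_sub_le h (show 2 * m + 1 < 2 * n by omega)
      rw [abs_sub_comm]
      rwa [edgeSign_two_mul, edgeSign_two_mul_add_one] at this)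
    (fun m hm => by
      have := abs_envelope_sub_le h (show 2 * m + 1 + 1 < 2 * n by omega)
      rwa [show 2 * m + 1 + 1 = 2 * (m + 1) by ring, edgeSign_two_mul,
        edgeSign_two_mul_add_one] at this)
  have hnh : 0 ≤ n * ‖h‖ := by positivity
  have hnl : 0 ≤ (n : ℝ) ^ 2 * envelopeLip h := by positivity
  have hCnh : 0 ≤ C * (n * ‖h‖) := by positivity
  have hCnl : 0 ≤ C * (n ^ 2 * envelopeLip h) := by positivity
  simp only [habs] at h1
  constructor
  · intro i hi
    rcases Nat.even_or_odd' i with ⟨m, hm | hm⟩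
    · have e : i / 2 = m := by omega
      rw [e, hm, sum_range_two_mul]
      have := h1 m (by omega)
      linarith
    · have e : i / 2 = m := by omega
      rw [e, hm, sum_range_two_mul]
      have e1 := h1 m (by omega)
      have e2 := h2 m (by omega)
      have e3 := abs_add_le ((-1) ^ m * vecExt w (2 * m + 1) - (-1) ^ m * vecExt w (2 * m))
        ((-1) ^ m * vecExt w (2 * m))
      rw [sub_add_cancel, habs, habs] at e3
      linarith
  · refine envelopeLip_le (by positivity) fun i hi => ?_
    rcases Nat.even_or_odd' i with ⟨m, rfl | rfl⟩
    · rw [edgeSign_two_mul, edgeSign_two_mul_add_one]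
      linarith [h2 m (by omega)]
    · rw [show 2 * m + 1 + 1 = 2 * (m + 1) by ring, edgeSign_two_mul, edgeSign_two_mul_add_one]
      linarith [h3 m (by omega)]

/-- Size of a solution of the forced chain that vanishes at the last mass. -/
theorem forced_right_bounds (hk₁ : 0 < k₁) (hk₂ : k₁ < k₂) {K : ℝ} (hK : 0 ≤ K) :
    ∃ C : ℝ, 0 < C ∧ ∀ (n : ℕ) (D φ k₃₁ k₃₂ : ℝ) (w h : Fin (2 * n) → ℝ), 2 ≤ n → 0 < φ → φ ≤ 1 →
      1 ≤ n * φ → k₂ - k₁ ≤ D → D ≤ k₁ + k₂ →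
      D ^ 2 = k₁ ^ 2 + k₂ ^ 2 - 2 * k₁ * k₂ * cos φ → (D - (k₂ - k₁)) * n ^ 2 ≤ K →
      vecExt w (2 * n - 1) = 0 →
      (D + k₁ + k₂) • w + (chainMatrix n k₁ k₂ k₃₁ k₃₂).mulVec w = h →
      (∀ i, i < 2 * n → |vecExt w i| ≤ (D + k₂ - k₁) / (k₁ * k₂) / (2 * sin φ) *
        ∑ j ∈ Finset.Ico (2 * (i / 2)) (2 * n), |vecExt h j| +
          C * (n * ‖h‖ + n ^ 2 * envelopeLip h)) ∧
      envelopeLip w ≤ C * (n * ‖h‖) := by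
  obtain ⟨C, hC, hmain⟩ := forced_left_bounds hk₁ hk₂ hK
  refine ⟨C, hC, ?_⟩
  intro n D φ k₃₁ k₃₂ w h hn hφ0 hφ1 hnφ hD1 hD2 hcos hDK hw0 hw
  have hw' : (D + k₁ + k₂) • (w ∘ Fin.rev) +
      (chainMatrix n k₁ k₂ k₃₂ k₃₁).mulVec (w ∘ Fin.rev) = h ∘ Fin.rev := by
    rw [chainMatrix_mulVec_rev, ← hw]
    rfl
  obtain ⟨h1, h2⟩ := hmain n D φ k₃₂ k₃₁ _ _ hn hφ0 hφ1 hnφ hD1 hD2 hcos hDK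
    (by rw [vecExt_rev _ (by omega), Nat.sub_zero, hw0]) hw'
  rw [norm_comp_rev, envelopeLip_comp_rev] at h1
  rw [norm_comp_rev, envelopeLip_comp_rev] at h2
  refine ⟨fun i hi => ?_, h2⟩
  have e := h1 (2 * n - 1 - i) (by omega)
  rw [vecExt_rev _ (by omega), show 2 * n - 1 - (2 * n - 1 - i) = i by omega] at e
  refine e.trans (add_le_add_left (mul_le_mul_of_nonneg_left ?_ ?_) _)
  · have e1 : ∑ j ∈ Finset.range (2 * ((2 * n - 1 - i) / 2)), |vecExt (h ∘ Fin.rev) j| =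
        ∑ j ∈ Finset.range (2 * ((2 * n - 1 - i) / 2)), |vecExt h (2 * n - 1 - j)| :=
      Finset.sum_congr rfl fun j hj => by
        rw [Finset.mem_range] at hj
        rw [vecExt_rev _ (by omega)]
    rw [e1, Finset.range_eq_Ico,
      Finset.sum_Ico_reflect (fun j => |vecExt h j|) 0 (n := 2 * n - 1) (by omega)]
    refine Finset.sum_le_sum_of_subset_of_nonneg (fun j hj => ?_) fun _ _ _ => abs_nonneg _
    rw [Finset.mem_Ico] at hj ⊢
    omega
  · have : 0 < sin φ := sin_pos_of_pos_of_lt_pi hφ0 (by linarith [pi_gt_three])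
    have : 0 ≤ D + k₂ - k₁ := by linarith
    have := hk₁.trans hk₂
    positivity

end ForcedChain

/-! ### The inverse on the orthogonal complement of the mode -/

section Resolvent

open Real

theorem sq_dotProduct_le {d : ℕ} {e : Fin d → ℝ} (he : e ⬝ᵥ e = 1) (x : Fin d → ℝ) :
    (x ⬝ᵥ e) ^ 2 ≤ x ⬝ᵥ x := by
  have h := Finset.sum_mul_sq_le_sq_mul_sq Finset.univ x e
  simp only [dotProduct, ← sq] at he ⊢
  rwa [he, mul_one] at h

theorem dotProduct_self_le {d : ℕ} (x : Fin d → ℝ) : x ⬝ᵥ x ≤ d * ‖x‖ ^ 2 := by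
  have h : ∀ i ∈ Finset.univ, x i * x i ≤ ‖x‖ ^ 2 := fun i _ => by
    rw [← sq, ← sq_abs]
    exact pow_le_pow_left₀ (abs_nonneg _) (norm_le_pi_norm x i) 2
  have := Finset.sum_le_sum h
  simpa [dotProduct] using this

/-- Cauchy–Schwarz in dimension `2n`; the constant `1.4143` exceeds `√2`. -/
theorem abs_dotProduct_le_sqrt {n : ℕ} {e : Fin (2 * n) → ℝ} (he : e ⬝ᵥ e = 1)
    (x : Fin (2 * n) → ℝ) : |x ⬝ᵥ e| ≤ 1.4143 * √n * ‖x‖ := by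
  refine abs_le_of_sq_le_sq ?_ (by positivity)
  refine (sq_dotProduct_le he x).trans ((dotProduct_self_le x).trans ?_)
  rw [mul_pow, mul_pow, sq_sqrt (Nat.cast_nonneg n)]
  push_cast
  have : 0 ≤ (n : ℝ) * ‖x‖ ^ 2 := by positivity
  linarith

theorem dotProduct_self_orthogonal {d : ℕ} {e : Fin d → ℝ} (he : e ⬝ᵥ e = 1) (x : Fin d → ℝ) :
    (x - (x ⬝ᵥ e) • e) ⬝ᵥ (x - (x ⬝ᵥ e) • e) = x ⬝ᵥ x - (x ⬝ᵥ e) ^ 2 := by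
  simp only [sub_dotProduct, dotProduct_sub, smul_dotProduct, dotProduct_smul, he, smul_eq_mul,
    dotProduct_comm e x]
  ring

/-- Pythagoras and Cauchy–Schwarz: in the Euclidean norm the projection costs nothing, whereas a
sup-norm estimate of it would cost a constant factor in the leading term. -/
theorem sum_abs_orthogonal_le {n : ℕ} {e : Fin (2 * n) → ℝ} (he : e ⬝ᵥ e = 1)
    (x : Fin (2 * n) → ℝ) :
    ∑ j ∈ Finset.range (2 * n), |vecExt (x - (x ⬝ᵥ e) • e) j| ≤ 2 * n * ‖x‖ := by
  set h := x - (x ⬝ᵥ e) • e with hh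
  rw [← sum_fin_eq_sum_vecExt h (fun y => |y|)]
  refine (le_abs_self _).trans (abs_le_of_sq_le_sq ?_ (by positivity))
  have h1 := Finset.sum_mul_sq_le_sq_mul_sq Finset.univ (fun _ : Fin (2 * n) => (1 : ℝ))
    (fun j => |h j|)
  simp only [one_mul, one_pow, Finset.sum_const, Finset.card_univ, Fintype.card_fin, sq_abs,
    nsmul_eq_mul, mul_one] at h1
  push_cast at h1
  have h2 : ∑ j, h j ^ 2 = x ⬝ᵥ x - (x ⬝ᵥ e) ^ 2 := by
    rw [← dotProduct_self_orthogonal he x, ← hh]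
    simp only [dotProduct, sq]
  have h3 := dotProduct_self_le x
  push_cast at h3
  refine h1.trans ?_
  have h4 : 2 * (n : ℝ) * ∑ j, h j ^ 2 ≤ 2 * n * (2 * n * ‖x‖ ^ 2) :=
    mul_le_mul_of_nonneg_left (by linarith [sq_nonneg (x ⬝ᵥ e)]) (by positivity)
  linarith

variable {n : ℕ} {k₁ k₂ k₃₁ k₃₂ : ℝ}

theorem eq_zero_of_apply_last_zero (hk₁ : 0 < k₁) (hk₂ : k₁ < k₂) (hn : 1 ≤ n) {s : ℝ}
    {v : Fin (2 * n) → ℝ} (hv : s • v + (chainMatrix n k₁ k₂ k₃₁ k₃₂).mulVec v = 0)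
    (h0 : vecExt v (2 * n - 1) = 0) : v = 0 := by
  have h : s • (v ∘ Fin.rev) + (chainMatrix n k₁ k₂ k₃₂ k₃₁).mulVec (v ∘ Fin.rev) = 0 := by
    have : s • (v ∘ Fin.rev) + (chainMatrix n k₁ k₂ k₃₂ k₃₁).mulVec (v ∘ Fin.rev) =
        (s • v + (chainMatrix n k₁ k₂ k₃₁ k₃₂).mulVec v) ∘ Fin.rev := by
      rw [chainMatrix_mulVec_rev]
      rfl
    rw [this, hv]
    rfl
  have e := eq_zero_of_apply_zero hk₁ hk₂ h (by rw [vecExt_rev _ (by omega), Nat.sub_zero, h0])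
  rw [← norm_eq_zero, ← norm_comp_rev, e, norm_zero]

/-- The average of the two solutions of the forced chain that vanish at either end. -/
theorem exists_centered_solution (hk₁ : 0 < k₁) (hk₂ : k₁ < k₂) {K : ℝ} (hK : 0 ≤ K) :
    ∃ C : ℝ, 0 < C ∧ ∀ (n : ℕ) (D φ k₃₁ k₃₂ : ℝ) (e v h : Fin (2 * n) → ℝ), 2 ≤ n → 0 < φ →
      φ ≤ 1 → 1 ≤ n * φ → k₂ - k₁ ≤ D → D ≤ k₁ + k₂ →
      D ^ 2 = k₁ ^ 2 + k₂ ^ 2 - 2 * k₁ * k₂ * cos φ → (D - (k₂ - k₁)) * n ^ 2 ≤ K → e ≠ 0 →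
      (D + k₁ + k₂) • e + (chainMatrix n k₁ k₂ k₃₁ k₃₂).mulVec e = 0 →
      (D + k₁ + k₂) • v + (chainMatrix n k₁ k₂ k₃₁ k₃₂).mulVec v = h →
      ∃ c : ℝ, ‖v - c • e‖ ≤ (D + k₂ - k₁) / (k₁ * k₂) / (4 * sin φ) *
        ∑ j ∈ Finset.range (2 * n), |vecExt h j| + C * (n * ‖h‖ + n ^ 2 * envelopeLip h) ∧
      envelopeLip (v - c • e) ≤ C * (n * ‖h‖) := by
  obtain ⟨C, hC, hleft⟩ := forced_left_bounds hk₁ hk₂ hK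
  obtain ⟨C', hC', hright⟩ := forced_right_bounds hk₁ hk₂ hK
  refine ⟨C + C', by positivity, ?_⟩
  intro n D φ k₃₁ k₃₂ e v h hn hφ0 hφ1 hnφ hD1 hD2 hcos hDK he0 he hv
  have hL0 : 0 ≤ envelopeLip h := apply_nonneg _ _
  have hsol : ∀ c : ℝ, (D + k₁ + k₂) • (v - c • e) +
      (chainMatrix n k₁ k₂ k₃₁ k₃₂).mulVec (v - c • e) = h := by
    intro c
    rw [Matrix.mulVec_sub, Matrix.mulVec_smul, ← hv]
    have : (chainMatrix n k₁ k₂ k₃₁ k₃₂).mulVec e = -((D + k₁ + k₂) • e) :=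
      eq_neg_of_add_eq_zero_right he
    rw [this]
    module
  -- The mode vanishes at neither end, so a multiple of it can be subtracted to make the solution
  -- vanish at whichever end is chosen.
  have h0 : vecExt e 0 ≠ 0 := fun h => he0 (eq_zero_of_apply_zero hk₁ hk₂ he h)
  have h1 : vecExt e (2 * n - 1) ≠ 0 := fun h =>
    he0 (eq_zero_of_apply_last_zero hk₁ hk₂ (by omega) he h)
  set a := vecExt v 0 / vecExt e 0 with ha
  set b := vecExt v (2 * n - 1) / vecExt e (2 * n - 1) with hb
  obtain ⟨l1, l2⟩ := hleft n D φ k₃₁ k₃₂ (v - a • e) h hn hφ0 hφ1 hnφ hD1 hD2 hcos hDK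
    (by rw [vecExt_sub, vecExt_smul, ha, div_mul_cancel₀ _ h0, sub_self]) (hsol a)
  obtain ⟨r1, r2⟩ := hright n D φ k₃₁ k₃₂ (v - b • e) h hn hφ0 hφ1 hnφ hD1 hD2 hcos hDK
    (by rw [vecExt_sub, vecExt_smul, hb, div_mul_cancel₀ _ h1, sub_self]) (hsol b)
  -- At each site the left solution is bounded by the forcing on one side and the right solution by
  -- the forcing on the other. Their average sees the whole forcing once, with half the constant.
  have havg : v - ((a + b) / 2) • e = (1 / 2 : ℝ) • ((v - a • e) + (v - b • e)) := by module
  have hsin : 0 < sin φ := sin_pos_of_pos_of_lt_pi hφ0 (by linarith [pi_gt_three])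
  have hk : 0 < k₂ := hk₁.trans hk₂
  have hDp : 0 ≤ D + k₂ - k₁ := by linarith
  have hpos : 0 ≤ n * ‖h‖ + (n : ℝ) ^ 2 * envelopeLip h := by positivity
  have hCp : 0 ≤ C * (n * ‖h‖ + (n : ℝ) ^ 2 * envelopeLip h) := by positivity
  have hCp' : 0 ≤ C' * (n * ‖h‖ + (n : ℝ) ^ 2 * envelopeLip h) := by positivity
  have hCn : 0 ≤ C * (n * ‖h‖) := by positivity
  have hCn' : 0 ≤ C' * (n * ‖h‖) := by positivity
  refine ⟨(a + b) / 2, ?_, ?_⟩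
  · refine (pi_norm_le_iff_of_nonneg ?_).2 fun i => ?_
    · have : 0 ≤ ∑ j ∈ Finset.range (2 * n), |vecExt h j| :=
        Finset.sum_nonneg fun _ _ => abs_nonneg _
      positivity
    · rw [← vecExt_val (v - ((a + b) / 2) • e) i, Real.norm_eq_abs, havg, vecExt_smul, vecExt_add,
        abs_mul, abs_of_pos (by norm_num : (0 : ℝ) < 1 / 2)]
      have e1 := abs_add_le (vecExt (v - a • e) i) (vecExt (v - b • e) i)
      have e2 := l1 i i.2
      have e3 := r1 i i.2
      rw [← Finset.sum_range_add_sum_Ico _ (show 2 * ((i : ℕ) / 2) ≤ 2 * n by omega)]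
      have e4 : (D + k₂ - k₁) / (k₁ * k₂) / (4 * sin φ) =
          (D + k₂ - k₁) / (k₁ * k₂) / (2 * sin φ) / 2 := by
        field_simp
        norm_num
      rw [e4]
      linarith
  · rw [havg, map_smul_eq_mul, Real.norm_eq_abs, abs_of_pos (by norm_num : (0 : ℝ) < 1 / 2)]
    have e1 := map_add_le_add envelopeLip (v - a • e) (v - b • e)
    linarith

set_option maxHeartbeats 2000000 in
/-- Bounds on the solution orthogonal to the mode of the linear chain forced at resonance. -/
theorem resonant_solution_bounds (hk₁ : 0 < k₁) (hk₂ : k₁ < k₂) {C₀ : ℝ} (hC₀ : 0 < C₀) :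
    ∃ (C : ℝ) (N : ℕ), 0 < C ∧ ∀ (n : ℕ) (φ k₃₁ k₃₂ : ℝ) (e v x : Fin (2 * n) → ℝ), N ≤ n →
      0 < φ → |n * φ - π| ≤ C₀ / n → e ⬝ᵥ e = 1 → ‖e‖ ≤ 1.01 / √n →
      envelopeLip e ≤ C₀ / (n * √n) →
      (bandOffset k₁ k₂ φ + k₁ + k₂) • e + (chainMatrix n k₁ k₂ k₃₁ k₃₂).mulVec e = 0 →
      (bandOffset k₁ k₂ φ + k₁ + k₂) • v + (chainMatrix n k₁ k₂ k₃₁ k₃₂).mulVec v =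
        x - (x ⬝ᵥ e) • e → v ⬝ᵥ e = 0 →
      ‖v‖ ≤ 0.40 * (2 * (k₂ - k₁) / (k₁ * k₂)) * n ^ 2 * ‖x‖ + C * (n ^ 2 * envelopeLip x) ∧
      envelopeLip v ≤ C * (n * ‖x‖) := by
  have hk : 0 < k₂ := hk₁.trans hk₂
  have hkk : 0 < k₂ - k₁ := sub_pos.2 hk₂
  -- From `(n φ)² / 2 ≤ 4² / 2 = 8`.
  set K := 8 * (k₁ * k₂ / (k₂ - k₁)) with hK
  have hK0 : 0 < K := by positivity
  obtain ⟨C, hC, hsol⟩ := exists_centered_solution hk₁ hk₂ hK0.le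
  set c := 2 * (k₂ - k₁) / (k₁ * k₂) with hc
  have hc0 : 0 < c := by positivity
  set C' := 3.1 * C + 2.02 * C * C₀ with hC'
  have hC'0 : 0 < C' := by positivity
  obtain ⟨N, hN⟩ := exists_nat_ge (100 + 1000 * C₀ + 10000 * (K / (k₁ * k₂) / c) + 300 * C' / c)
  refine ⟨3 * C + 8 * C + 1.4143 * (c + C' + 2 * C) * C₀, N, by positivity, ?_⟩
  intro n φ k₃₁ k₃₂ e v x hn hφ0 hφn he hen hel heig hv hve
  have hnN : (N : ℝ) ≤ n := by exact_mod_cast hn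
  have hp1 : 0 < K / (k₁ * k₂) / c := by positivity
  have hp2 : 0 < 300 * C' / c := by positivity
  have hn100 : (100 : ℝ) ≤ n := by linarith
  have hn1 : 1000 * C₀ ≤ n := by linarith
  have hn2 : 10000 * (K / (k₁ * k₂) / c) ≤ n := by linarith
  have hn3 : 300 * C' / c ≤ n := by linarith
  have hn0 : (0 : ℝ) < n := by linarith
  have hC₀n : C₀ / n ≤ 0.001 := by
    rw [div_le_iff₀ hn0]
    linarith
  have hpi1 := pi_gt_d2
  have hpi2 := pi_lt_d2
  obtain ⟨hφ1, hφ2⟩ := abs_le.1 (hφn.trans hC₀n)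
  have hφn4 : n * φ ≤ 4 := by linarith
  have hφs : φ ≤ 0.04 := by
    have := mul_le_mul_of_nonneg_right hn100 hφ0.le
    linarith
  have hD1 := bandOffset_lower hk₁ hk₂ hφ0 (by linarith)
  have hD2 := bandOffset_upper hk₁ hk₂ hφ0 (by linarith)
  have hsq := bandOffset_sq hk₁ hk₂ φ
  have hedge := sub_edge_le hk₂ hsq
  set D := bandOffset k₁ k₂ φ
  have hDK : (D - (k₂ - k₁)) * n ^ 2 ≤ K := by
    have h1 : (D - (k₂ - k₁)) ≤ k₁ * k₂ / (k₂ - k₁) * (φ ^ 2 / 2) :=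
      hedge.trans (mul_le_mul_of_nonneg_left (one_sub_cos_le φ) (by positivity))
    have h2 : (n * φ) ^ 2 ≤ 4 ^ 2 := pow_le_pow_left₀ (by positivity) hφn4 2
    calc (D - (k₂ - k₁)) * n ^ 2 ≤ k₁ * k₂ / (k₂ - k₁) * (φ ^ 2 / 2) * n ^ 2 := by gcongr
      _ = k₁ * k₂ / (k₂ - k₁) * ((n * φ) ^ 2 / 2) := by ring
      _ ≤ k₁ * k₂ / (k₂ - k₁) * 8 := by
        gcongr
        linarith
      _ = K := by rw [hK]; ring
  have hsin : 0.9996 * φ ≤ sin φ := by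
    have h1 := sin_gt_sub_cube hφ0
    have h2 : φ ^ 2 ≤ 0.04 ^ 2 := pow_le_pow_left₀ hφ0.le hφs 2
    have h3 := mul_le_mul_of_nonneg_left h2 hφ0.le
    have h4 : φ ^ 3 = φ * φ ^ 2 := by ring
    linarith
  have hsin0 : 0 < sin φ := by linarith
  -- In the limit the coefficient is `c n / (4π)`, and `1 / (4π) < 0.08`.
  have hcoef : (D + k₂ - k₁) / (k₁ * k₂) / (4 * sin φ) ≤ 0.08 * c * n := by
    have h1 : (D + k₂ - k₁) / (k₁ * k₂) = c + (D - (k₂ - k₁)) / (k₁ * k₂) := by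
      rw [hc]
      field_simp
      ring
    have h2 : (D - (k₂ - k₁)) / (k₁ * k₂) ≤ 0.001 * c := by
      have h3 : (D - (k₂ - k₁)) * n ≤ K := by
        have : (D - (k₂ - k₁)) * n ≤ (D - (k₂ - k₁)) * n ^ 2 := by
          have : 0 ≤ D - (k₂ - k₁) := by linarith
          gcongr
          nlinarith
        linarith
      have h4 : K / (k₁ * k₂) * 10000 ≤ n * c := by
        have := mul_le_mul_of_nonneg_right hn2 hc0.le
        have e : 10000 * (K / (k₁ * k₂) / c) * c = K / (k₁ * k₂) * 10000 := by field_simp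
        linarith
      have h5 : (D - (k₂ - k₁)) / (k₁ * k₂) * n ≤ K / (k₁ * k₂) := by
        rw [div_mul_eq_mul_div]
        gcongr
      have h6 : (D - (k₂ - k₁)) / (k₁ * k₂) * n ≤ 0.001 * c * n := by
        have : 0 < K / (k₁ * k₂) := by positivity
        linarith
      exact le_of_mul_le_mul_right h6 hn0
    rw [h1, div_le_iff₀ (by positivity)]
    have h7 : 3.13 ≤ n * sin φ := by
      have := mul_le_mul_of_nonneg_left hsin hn0.le
      linarith
    have h8 := mul_le_mul_of_nonneg_left h7 hc0.le
    linarith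
  set h := x - (x ⬝ᵥ e) • e with hh
  have he0 : e ≠ 0 := by
    rintro rfl
    simp at he
  obtain ⟨t, ht1, ht2⟩ := hsol n D φ k₃₁ k₃₂ e v h
    (by exact_mod_cast (by linarith : (2 : ℝ) ≤ n)) hφ0 (by linarith) (by linarith) hD1.le hD2.le
    hsq hDK he0 heig hv
  set z := v - t • e with hz
  set r := √n with hr
  have hr0 : 0 < r := sqrt_pos.2 hn0
  have hrr : r * r = n := mul_self_sqrt hn0.le
  have hxe := abs_dotProduct_le_sqrt he x
  have hze := abs_dotProduct_le_sqrt he z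
  rw [← hr] at hxe hze
  -- The projection costs `√(2n) · 1.01 / √n`, a constant close to `√2` because the mode is spread
  -- over the whole chain.
  have hproj : ∀ y : Fin (2 * n) → ℝ, |y ⬝ᵥ e| * ‖e‖ ≤ 1.43 * ‖y‖ := by
    intro y
    have h1 := abs_dotProduct_le_sqrt he y
    rw [← hr] at h1
    calc |y ⬝ᵥ e| * ‖e‖ ≤ 1.4143 * r * ‖y‖ * (1.01 / r) := by gcongr
      _ = 1.4143 * 1.01 * ‖y‖ * (r / r) := by ring
      _ = 1.4143 * 1.01 * ‖y‖ := by rw [div_self hr0.ne', mul_one]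
      _ ≤ 1.43 * ‖y‖ := by
        gcongr
        norm_num
  have hprojL : ∀ y : Fin (2 * n) → ℝ, |y ⬝ᵥ e| * envelopeLip e ≤ 1.4143 * C₀ * ‖y‖ / n := by
    intro y
    have h1 := abs_dotProduct_le_sqrt he y
    rw [← hr] at h1
    calc |y ⬝ᵥ e| * envelopeLip e ≤ 1.4143 * r * ‖y‖ * (C₀ / (n * r)) := by gcongr
      _ = 1.4143 * C₀ * ‖y‖ / n * (r / r) := by ring
      _ = 1.4143 * C₀ * ‖y‖ / n := by rw [div_self hr0.ne', mul_one]
  have hLx0 : 0 ≤ envelopeLip x := apply_nonneg _ _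
  have hx0 := norm_nonneg x
  have hnorm : ‖h‖ ≤ 3.1 * ‖x‖ := by
    have h1 := norm_sub_le x ((x ⬝ᵥ e) • e)
    rw [norm_smul, Real.norm_eq_abs] at h1
    linarith [hproj x]
  have hlip : n ^ 2 * envelopeLip h ≤ n ^ 2 * envelopeLip x + 1.4143 * C₀ * (n * ‖x‖) := by
    have h1 := map_sub_le_add envelopeLip x ((x ⬝ᵥ e) • e)
    rw [map_smul_eq_mul, Real.norm_eq_abs] at h1
    have h2 : envelopeLip h ≤ envelopeLip x + 1.4143 * C₀ * ‖x‖ / n := by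
      linarith [hprojL x]
    calc n ^ 2 * envelopeLip h ≤ n ^ 2 * (envelopeLip x + 1.4143 * C₀ * ‖x‖ / n) := by gcongr
      _ = n ^ 2 * envelopeLip x + 1.4143 * C₀ * (n * ‖x‖) * (n / n) := by ring
      _ = n ^ 2 * envelopeLip x + 1.4143 * C₀ * (n * ‖x‖) := by rw [div_self hn0.ne', mul_one]
  -- The solution orthogonal to `e` is the projection of the centered one, whatever multiple of `e`
  -- was subtracted.
  have hvz : v = z - (z ⬝ᵥ e) • e := by
    have : z ⬝ᵥ e = -t := by
      rw [hz, sub_dotProduct, smul_dotProduct, he, hve, smul_eq_mul]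
      ring
    rw [this, hz]
    module
  have hz1 : ‖z‖ ≤ 0.16 * c * n ^ 2 * ‖x‖ + C' * (n * ‖x‖) + C * (n ^ 2 * envelopeLip x) := by
    have h1 : (D + k₂ - k₁) / (k₁ * k₂) / (4 * sin φ) *
        ∑ j ∈ Finset.range (2 * n), |vecExt h j| ≤ 0.08 * c * n * (2 * n * ‖x‖) :=
      mul_le_mul hcoef (sum_abs_orthogonal_le he x)
        (Finset.sum_nonneg fun _ _ => abs_nonneg _) (by positivity)
    have h2 : C * (n * ‖h‖ + n ^ 2 * envelopeLip h) ≤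
        C * (n * (3.1 * ‖x‖) + (n ^ 2 * envelopeLip x + 1.4143 * C₀ * (n * ‖x‖))) := by
      gcongr
    have h3 : 0 ≤ C * C₀ * (n * ‖x‖) := by positivity
    rw [hC']
    linarith
  have hz2 : ‖z‖ ≤ (c + C' + 2 * C) * (n ^ 2 * ‖x‖) := by
    have h1 : C * (n ^ 2 * envelopeLip x) ≤ C * (n ^ 2 * (2 * ‖x‖)) := by
      gcongr
      exact envelopeLip_le_two_mul_norm x
    have h2 : C' * (n * ‖x‖) ≤ C' * (n ^ 2 * ‖x‖) := by
      gcongr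
      nlinarith
    have h3 : 0 ≤ c * (n ^ 2 * ‖x‖) := by positivity
    linarith
  have hM : 0 ≤ 8 * C + 1.4143 * (c + C' + 2 * C) * C₀ := by positivity
  constructor
  -- The leading constant is `(1 + 1.43) · 0.16 < 0.39`; the terms of order `n` fit into the margin
  -- up to `0.40` because `n ≥ 300 C' / c`.
  · have h1 := norm_sub_le z ((z ⬝ᵥ e) • e)
    rw [norm_smul, Real.norm_eq_abs, ← hvz] at h1
    have h2 := hproj z
    have h3 : 300 * C' * (n * ‖x‖) ≤ c * n ^ 2 * ‖x‖ := by
      rw [div_le_iff₀ hc0] at hn3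
      have := mul_le_mul_of_nonneg_right hn3 (by positivity : 0 ≤ n * ‖x‖)
      linarith
    have h4 : 0 ≤ C * (n ^ 2 * envelopeLip x) := by positivity
    have h5 : 0 ≤ (8 * C + 1.4143 * (c + C' + 2 * C) * C₀) * (n ^ 2 * envelopeLip x) := by
      positivity
    have h6 : 0 ≤ c * n ^ 2 * ‖x‖ := by positivity
    linarith
  · have h1 := map_sub_le_add envelopeLip z ((z ⬝ᵥ e) • e)
    rw [map_smul_eq_mul, Real.norm_eq_abs, ← hvz] at h1
    have h2 := hprojL z
    have h3 : 1.4143 * C₀ * ‖z‖ / n ≤ 1.4143 * (c + C' + 2 * C) * C₀ * (n * ‖x‖) := by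
      rw [div_le_iff₀ hn0]
      have := mul_le_mul_of_nonneg_left hz2 (by positivity : 0 ≤ 1.4143 * C₀)
      linarith
    have h4 : C * (n * ‖h‖) ≤ C * (n * (3.1 * ‖x‖)) := by gcongr
    have h5 : 0 ≤ C * (n * ‖x‖) := by positivity
    linarith

end Resolvent

/-! ### Solving each harmonic, fixing the constants, and the radius of convergence -/

section MainResult

open Real

theorem exists_solution_of_injective {d : ℕ} {L : Matrix (Fin d) (Fin d) ℝ} {s : ℝ}
    (h : ∀ v, s • v + L.mulVec v = 0 → v = 0) (x : Fin d → ℝ) : ∃ v, s • v + L.mulVec v = x := by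
  set A : Matrix (Fin d) (Fin d) ℝ := s • (1 : Matrix (Fin d) (Fin d) ℝ) + L with hA
  have hAv : ∀ v, A.mulVec v = s • v + L.mulVec v := fun v => by
    rw [hA, Matrix.add_mulVec, Matrix.smul_mulVec, Matrix.one_mulVec]
  have hinj : Function.Injective A.mulVec := by
    intro v w hvw
    rw [← sub_eq_zero]
    refine h _ ?_
    rw [← hAv, Matrix.mulVec_sub, sub_eq_zero]
    exact hvw
  obtain ⟨v, hv⟩ := Matrix.mulVec_surjective_iff_isUnit.2
    (Matrix.mulVec_injective_iff_isUnit.1 hinj) x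
  exact ⟨v, by rw [← hAv, hv]⟩

/-- Adding the rank-one matrix `e eᵀ` makes the resonant operator injective. Pairing with `e` shows
`v·e = x·e`, so subtracting `(x·e) e` yields the orthogonal solution. -/
theorem exists_resonant_solution {d : ℕ} {L : Matrix (Fin d) (Fin d) ℝ} (hL : L.IsSymm) {s : ℝ}
    {e : Fin d → ℝ} (he : e ⬝ᵥ e = 1) (hLe : s • e + L.mulVec e = 0)
    (hker : ∀ v, s • v + L.mulVec v = 0 → ∃ c : ℝ, v = c • e) (x : Fin d → ℝ) :
    ∃ v, s • v + L.mulVec v = x - (x ⬝ᵥ e) • e ∧ v ⬝ᵥ e = 0 := by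
  have hmul : ∀ v, (L + Matrix.vecMulVec e e).mulVec v = L.mulVec v + (v ⬝ᵥ e) • e := fun v => by
    rw [Matrix.add_mulVec, Matrix.vecMulVec_mulVec, op_smul_eq_smul, dotProduct_comm]
  have hdot : ∀ v, (s • v + L.mulVec v) ⬝ᵥ e = 0 := fun v => by
    rw [add_dotProduct, dotProduct_mulVec_comm hL, smul_dotProduct, ← dotProduct_smul,
      ← dotProduct_add, hLe, dotProduct_zero]
  have key : ∀ v x, s • v + (L + Matrix.vecMulVec e e).mulVec v = x → v ⬝ᵥ e = x ⬝ᵥ e := by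
    intro v x hv
    rw [← hv, hmul, ← add_assoc, add_dotProduct, hdot, smul_dotProduct, he, smul_eq_mul, mul_one,
      zero_add]
  obtain ⟨v, hv⟩ := exists_solution_of_injective (L := L + Matrix.vecMulVec e e) (s := s) (by
    intro v hv
    have h0 := key v 0 hv
    rw [zero_dotProduct] at h0
    rw [hmul, h0, zero_smul, add_zero] at hv
    obtain ⟨c, rfl⟩ := hker v hv
    rw [smul_dotProduct, he, smul_eq_mul, mul_one] at h0
    rw [h0, zero_smul]) x
  have h1 := key v x hv
  rw [hmul, h1] at hv
  refine ⟨v - (x ⬝ᵥ e) • e, ?_, ?_⟩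
  · have : L.mulVec e = -(s • e) := eq_neg_of_add_eq_zero_right hLe
    rw [Matrix.mulVec_sub, Matrix.mulVec_smul, this, eq_sub_iff_add_eq]
    refine Eq.trans ?_ hv
    module
  · rw [sub_dotProduct, h1, smul_dotProduct, he, smul_eq_mul, mul_one, sub_self]

/-- The smallness conditions for the majorant at the amplitude scale `n ^ (-1 / 2)`. -/
theorem majorant_condition {c k n p t : ℝ} (hc : 0 < c) (hn : 1 ≤ n)
    (hp0 : 0 ≤ p) (hp : p ≤ 1.02 / √n) (ht0 : 0 ≤ t) (ht : t < 1 / (20 * c * n))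
    (hnc : 1 ≤ c * k * n) :
    0.45 * c * n ^ 2 * (t * (2 * p + 0.6 / √n) ^ 3 +
        1.4143 * √n / 2 * (t * (2 * p + 0.6 / √n) ^ 3) * (0.6 / √n)) ≤ 0.6 / √n ∧
      1.4143 * √n / 2 * (t * (2 * p + 0.6 / √n) ^ 3) ≤ 2 * k := by
  have hn0 : 0 < n := by linarith
  have hr : 0 < √n := sqrt_pos.2 hn0
  have hrr : √n ^ 2 = n := sq_sqrt hn0.le
  set r := √n with hr'
  -- The values `p ≤ 1.02/r` and `s = 0.6/r` give `2.04 + 0.6 = 2.64`.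
  have hX : 2 * p + 0.6 / r ≤ 2.64 / r := by
    have : (2.64 : ℝ) / r = 2 * (1.02 / r) + 0.6 / r := by ring
    linarith
  have hX0 : 0 ≤ 2 * p + 0.6 / r := by positivity
  have hX3 : (2 * p + 0.6 / r) ^ 3 ≤ (2.64 / r) ^ 3 := pow_le_pow_left₀ hX0 hX 3
  have hY : t * (2 * p + 0.6 / r) ^ 3 ≤ 1 / (20 * c * n) * (2.64 / r) ^ 3 :=
    mul_le_mul ht.le hX3 (by positivity) (by positivity)
  have hY0 : 0 ≤ t * (2 * p + 0.6 / r) ^ 3 := by positivity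
  set Y := t * (2 * p + 0.6 / r) ^ 3 with hYdef
  -- `2.64³ / 20 < 0.92`; in the first conclusion `0.45 (1 + 1.4143 · 0.3) · 0.92 < 0.6` closes the
  -- majorant.
  have hY2 : c * n ^ 2 * r * Y ≤ 0.92 := by
    calc c * n ^ 2 * r * Y ≤ c * n ^ 2 * r * (1 / (20 * c * n) * (2.64 / r) ^ 3) := by gcongr
      _ = 2.64 ^ 3 / 20 * (n / r ^ 2) := by field_simp
      _ ≤ 0.92 := by
        rw [hrr, div_self hn0.ne']
        norm_num
  constructor
  · rw [le_div_iff₀ hr]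
    have e : 0.45 * c * n ^ 2 * (Y + 1.4143 * r / 2 * Y * (0.6 / r)) * r =
        0.45 * (1 + 1.4143 * 0.3 * (r / r)) * (c * n ^ 2 * r * Y) := by ring
    rw [e, div_self hr.ne']
    linarith
  · have h1 : c * n ^ 2 * (1.4143 * r / 2 * Y) ≤ c * n ^ 2 * (2 * k) := by
      have h2 : 1 * 1 ≤ c * k * n * n := mul_le_mul hnc hn zero_le_one (by linarith)
      linarith
    exact le_of_mul_le_mul_left h1 (by positivity)

theorem le_radius_of_forall_summable {a : ℕ → ℝ} {R : ℝ}
    (h : ∀ r : ℝ, 0 < r → r < R → Summable fun m => r ^ m * a m) :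
    ENNReal.ofReal R ≤ (FormalMultilinearSeries.ofScalars ℝ a).radius := by
  refine ENNReal.le_of_forall_nnreal_lt fun r hr => ?_
  rcases eq_or_ne r 0 with rfl | h0
  · simp
  · refine FormalMultilinearSeries.le_radius_of_summable _ ?_
    rw [ENNReal.lt_ofReal_iff_toReal_lt ENNReal.coe_ne_top, ENNReal.coe_toReal] at hr
    have := (h r (NNReal.coe_pos.2 (pos_iff_ne_zero.2 h0)) hr).norm
    refine this.congr fun m => ?_
    rw [FormalMultilinearSeries.ofScalars_norm, norm_mul, norm_pow, Real.norm_eq_abs (r : ℝ),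
      NNReal.abs_eq, mul_comm]

variable {k₁ k₂ δ : ℝ}

/-- The weight `γ = n / K` balances two demands: inverting turns `‖x‖` into a variation of order `n
‖x‖`, which needs `K` large, while variation of `x` produces size `n² Lip x`, which is absorbed once
`n` is large compared with `K`. -/
theorem exists_modeExpansion (hk₁ : 0 < k₁) (hk₂ : k₁ < k₂) {C₀ : ℝ} (hC₀ : 0 < C₀) :
    ∃ N : ℕ, ∀ n, N ≤ n → ∀ k₃₁ k₃₂ : ℝ, 0 ≤ k₃₁ → 0 ≤ k₃₂ →
      k₃₁ ≤ k₁ + 2 * k₂ → k₃₂ ≤ k₁ + 2 * k₂ → ∀ (w φ : ℝ) (u : Fin (2 * n) → ℝ),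
      IsOpticalMode n k₁ k₂ k₃₁ k₃₂ w u → 0 < φ → |n * φ - π| ≤ C₀ / n →
      w ^ 2 = bandOffset k₁ k₂ φ + k₁ + k₂ → ‖(1 / √(∑ j, u j ^ 2)) • u‖ ≤ 1.01 / √n →
      envelopeLip ((1 / √(∑ j, u j ^ 2)) • u) ≤ C₀ / (n * √n) →
      ∃ (ω : ℕ → ℝ) (Q : ℕ → ℝ → Fin (2 * n) → ℝ),
        IsFormalExpansion (chainMatrix n k₁ k₂ k₃₁ k₃₂) w u ω Q ∧
        ∀ ε : ℝ, ε ^ 2 < 1 / (40 * (k₂ - k₁) / (k₁ * k₂) * n) →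
          Summable (fun m => ε ^ m * ω m) ∧
          Summable (fun m => |ε| ^ (m + 1) * perNorm (Q m)) ∧
          ∃ q : ℝ → Fin (2 * n) → ℝ,
            IsEvenPeriodicSolution (chainMatrix n k₁ k₂ k₃₁ k₃₂) (∑' m, ε ^ m * ω m) q ∧
            Filter.Tendsto (fun M : ℕ => perNorm fun τ =>
              (∑ m ∈ Finset.range M, ε ^ (m + 1) • Q m τ) - q τ) Filter.atTop (nhds 0) := by
  have hk : 0 < k₂ := hk₁.trans hk₂
  have hkk : 0 < k₂ - k₁ := sub_pos.2 hk₂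
  obtain ⟨C, N, hC, hres⟩ := resonant_solution_bounds hk₁ hk₂ hC₀
  set c := 2 * (k₂ - k₁) / (k₁ * k₂) with hc
  have hc0 : 0 < c := by positivity
  -- The first summand makes `C / K ≤ 0.05 c`, so that `0.40 + 0.05 = 0.45`; the second makes the
  -- variation of the mode contribute at most `0.01 / √n` to its norm.
  set K := 20 * C / c + 100 * C₀ with hK
  have hK0 : 0 < K := by positivity
  have hKc : C / K ≤ 0.05 * c := by
    rw [div_le_iff₀ hK0, hK]
    have : 0.05 * c * (20 * C / c + 100 * C₀) = C + 5 * c * C₀ := by field_simp; ring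
    have : 0 < c * C₀ := by positivity
    linarith
  have hKC₀ : C₀ / K ≤ 0.01 := by
    rw [div_le_iff₀ hK0, hK]
    have : 0 < 20 * C / c := by positivity
    linarith
  -- `n ≥ A` absorbs the variation of the forcing, `n ≥ B` the higher harmonics, and `n ≥ E` keeps
  -- the correction to `ω²` below `2 k₂`.
  set A := C * K / (0.45 * c) with hA
  set B := (1 + 2 / K) * (4 / (3 * k₂)) / (0.45 * c) with hB
  set E := 1 / (c * k₂) with hE
  have hA0 : 0 < A := by positivity
  have hB0 : 0 < B := by positivity
  have hE0 : 0 < E := by positivity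
  obtain ⟨M, hM⟩ := exists_nat_ge (1 + A + B + E)
  refine ⟨N + M, ?_⟩
  intro n hn k₃₁ k₃₂ h1 h2 h3 h4 w φ u hu hφ0 hφn hw hue hul
  have hnM : 1 + A + B + E ≤ n := hM.trans (by exact_mod_cast (by omega : M ≤ n))
  have hn1 : (1 : ℝ) ≤ n := by linarith
  have hn0 : (0 : ℝ) < n := by linarith
  have hnat : 1 ≤ n := by exact_mod_cast hn1
  have huu : 0 < ∑ j, u j ^ 2 := by
    obtain ⟨j, hj⟩ := Function.ne_iff.1 hu.ne_zero
    exact Finset.sum_pos' (fun j _ => sq_nonneg _) ⟨j, Finset.mem_univ j, by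
      have : u j ≠ 0 := hj
      positivity⟩
  set L := chainMatrix n k₁ k₂ k₃₁ k₃₂ with hL
  set e := (1 / √(∑ j, u j ^ 2)) • u with he
  have hee : e ⬝ᵥ e = 1 := by
    rw [he, smul_dotProduct, dotProduct_smul, smul_smul, smul_eq_mul]
    have : u ⬝ᵥ u = ∑ j, u j ^ 2 := by simp only [dotProduct, sq]
    rw [this, div_mul_div_comm, mul_self_sqrt huu.le]
    field_simp
  have hLe : w ^ 2 • e + L.mulVec e = 0 := by
    rw [he, Matrix.mulVec_smul, smul_comm, ← smul_add, hu.smul_add_eq, smul_zero]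
  have hLe' : L.mulVec e = (-w ^ 2) • e := by
    rw [neg_smul]
    exact eq_neg_of_add_eq_zero_right hLe
  have he0 : e ≠ 0 := by
    intro h
    rw [h] at hee
    simp at hee
  set γ : NNReal := ⟨n / K, by positivity⟩ with hγ
  have hγc : (γ : ℝ) = n / K := rfl
  have hLip : ∀ x : Fin (2 * n) → ℝ, 0 ≤ envelopeLip x := fun x => apply_nonneg _ _
  have hkey : ∀ k : ℕ, 1 ≤ k → ∀ x, ∃ v, ((k : ℝ) ^ 2 * w ^ 2) • v + L.mulVec v =
      x - (if k = 1 then (x ⬝ᵥ e) • e else 0) ∧ (k = 1 → v ⬝ᵥ e = 0) ∧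
      (k : ℝ) ^ 2 * envelopeNorm γ v ≤ 0.45 * c * n ^ 2 * envelopeNorm γ x := by
    intro k hk1 x
    have hLx := hLip x
    have hx0 := norm_nonneg x
    rcases eq_or_lt_of_le hk1 with rfl | hk2
    · obtain ⟨v, hv, hve⟩ := exists_resonant_solution chainMatrix_isSymm hee hLe
        (fun v hv => exists_smul_of_mem_ker hk₁ hk₂ hLe he0 hv) x
      refine ⟨v, by simpa using hv, fun _ => hve, ?_⟩
      obtain ⟨b1, b2⟩ := hres n φ k₃₁ k₃₂ e v x (by omega) hφ0 hφn hee hue hul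
        (by rw [← hw]; exact hLe) (by rw [← hw]; exact hv) hve
      rw [Nat.cast_one, one_pow, one_mul, envelopeNorm_apply, envelopeNorm_apply, hγc]
      have b3 : n / K * envelopeLip v ≤ 0.05 * c * n ^ 2 * ‖x‖ := by
        calc n / K * envelopeLip v ≤ n / K * (C * (n * ‖x‖)) := by gcongr
          _ = C / K * (n ^ 2 * ‖x‖) := by ring
          _ ≤ 0.05 * c * (n ^ 2 * ‖x‖) := by gcongr
          _ = _ := by ring
      have b4 : C * (n ^ 2 * envelopeLip x) ≤ 0.45 * c * n ^ 2 * (n / K * envelopeLip x) := by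
        have b5 : C ≤ 0.45 * c * (n / K) := by
          have : A ≤ n := by linarith
          rw [hA, div_le_iff₀ (by positivity)] at this
          rw [mul_div_assoc', le_div_iff₀ hK0]
          linarith
        have := mul_le_mul_of_nonneg_right b5 (by positivity : 0 ≤ n ^ 2 * envelopeLip x)
        linarith
      linarith
    -- At higher harmonics the inverse is bounded uniformly in `n`; the weight `γ` costs one power
    -- of `n`, still less than the `n²` allowed.
    · obtain ⟨v, hv⟩ := exists_solution_of_injective (L := L) (s := (k : ℝ) ^ 2 * w ^ 2) (by
        intro v hv
        have b := norm_le_of_higher_harmonic hnat hk₁ hk₂ h1 h2 h3 h4 hu.lower hk2 hv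
        rw [norm_zero] at b
        have : 0 < 3 / 4 * k₂ * (k : ℝ) ^ 2 := by positivity
        by_contra hv0
        have := mul_pos this (norm_pos_iff.2 hv0)
        linarith) x
      refine ⟨v, by rw [hv, if_neg (by omega), sub_zero], fun h => absurd h (by omega), ?_⟩
      have b := norm_le_of_higher_harmonic hnat hk₁ hk₂ h1 h2 h3 h4 hu.lower hk2 hv
      have b1 : (k : ℝ) ^ 2 * ‖v‖ ≤ 4 / (3 * k₂) * ‖x‖ := by
        rw [div_mul_eq_mul_div, le_div_iff₀ (by positivity)]
        linarith
      have b2 : envelopeNorm γ v ≤ (1 + 2 / K) * n * ‖v‖ := by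
        rw [envelopeNorm_apply, hγc]
        have b3 : n / K * envelopeLip v ≤ n / K * (2 * ‖v‖) := by
          gcongr
          exact envelopeLip_le_two_mul_norm v
        have b4 : ‖v‖ ≤ n * ‖v‖ := le_mul_of_one_le_left (norm_nonneg v) hn1
        have b5 : (1 + 2 / K) * n * ‖v‖ = n * ‖v‖ + n / K * (2 * ‖v‖) := by ring
        linarith
      have b6 : (1 + 2 / K) * (4 / (3 * k₂)) ≤ 0.45 * c * n := by
        have : B ≤ n := by linarith
        rw [hB, div_le_iff₀ (by positivity)] at this
        linarith
      calc (k : ℝ) ^ 2 * envelopeNorm γ v ≤ (k : ℝ) ^ 2 * ((1 + 2 / K) * n * ‖v‖) := by gcongr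
        _ = (1 + 2 / K) * n * ((k : ℝ) ^ 2 * ‖v‖) := by ring
        _ ≤ (1 + 2 / K) * n * (4 / (3 * k₂) * ‖x‖) := by gcongr
        _ = ((1 + 2 / K) * (4 / (3 * k₂))) * (n * ‖x‖) := by ring
        _ ≤ 0.45 * c * n * (n * ‖x‖) := by gcongr
        _ = 0.45 * c * n ^ 2 * ‖x‖ := by ring
        _ ≤ 0.45 * c * n ^ 2 * envelopeNorm γ x := by
          gcongr
          exact norm_le_envelopeNorm γ x
  have hνe : envelopeNorm γ e ≤ 1.02 / √n := by
    rw [envelopeNorm_apply, hγc]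
    have b1 : n / K * envelopeLip e ≤ 0.01 / √n := by
      calc n / K * envelopeLip e ≤ n / K * (C₀ / (n * √n)) := by gcongr
        _ = C₀ / K / √n * (n / n) := by ring
        _ = C₀ / K / √n := by rw [div_self hn0.ne', mul_one]
        _ ≤ 0.01 / √n := by gcongr
    have b2 : (1.02 : ℝ) / √n = 1.01 / √n + 0.01 / √n := by ring
    linarith
  obtain ⟨ω, Q, hform, hconv⟩ := exists_expansion L hu.pos he hLe' (envelopeNorm γ)
    (norm_le_envelopeNorm γ) (envelopeNorm_mul_le γ) (g := 0.45 * c * n ^ 2) (ℓ := 1.4143 * √n)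
    (by positivity) (by positivity) (fun x => (abs_dotProduct_le_sqrt hee x).trans
      (mul_le_mul_of_nonneg_left (norm_le_envelopeNorm γ x) (by positivity))) hkey
  refine ⟨ω, Q, hform, fun ε hε => ?_⟩
  have hf : 40 * (k₂ - k₁) / (k₁ * k₂) * n = 20 * c * n := by rw [hc]; ring
  rw [hf] at hε
  have hck : 1 ≤ c * k₂ * n := by
    have : E ≤ n := by linarith
    rw [hE, div_le_iff₀ (by positivity)] at this
    linarith
  obtain ⟨m1, m2⟩ := majorant_condition hc0 hn1 (apply_nonneg (envelopeNorm γ) e) hνe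
    (sq_nonneg ε) hε hck
  exact hconv ε (0.6 / √n) (by positivity) m1 (m2.trans hu.lower.le)

end MainResult

/-! ### Assembly of the main theorem -/

theorem theorem1 (k₁ k₂ δ : ℝ) (hk₁ : 0 < k₁) (hk₂ : k₁ < k₂) (hδ : 0 < δ)
    (f : ℝ) (hf : f = 40 * (k₂ - k₁) / (k₁ * k₂)) :
    ∃ N : ℕ, ∀ n : ℕ, N ≤ n → ∀ k₃₁ k₃₂ : ℝ, 0 ≤ k₃₁ → 0 ≤ k₃₂ → k₃₁ ^ 2 + k₃₂ ^ 2 ≠ 0 →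
      δ ≤ |k₃₁ - 2 * k₂| → δ ≤ |k₃₂ - 2 * k₂| →
      NoFrequencyAboveOpticalBand n k₁ k₂ k₃₁ k₃₂ →
      (∃ (w : ℝ) (u : Fin (2 * n) → ℝ), IsLowestOpticalMode n k₁ k₂ k₃₁ k₃₂ w u) ∧
      ∀ (w : ℝ) (u : Fin (2 * n) → ℝ), IsLowestOpticalMode n k₁ k₂ k₃₁ k₃₂ w u →
        ∃ (ω : ℕ → ℝ) (Q : ℕ → ℝ → Fin (2 * n) → ℝ),
          IsFormalExpansion (chainMatrix n k₁ k₂ k₃₁ k₃₂) w u ω Q ∧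
          (∀ (ω' : ℕ → ℝ) (Q' : ℕ → ℝ → Fin (2 * n) → ℝ),
            IsFormalExpansion (chainMatrix n k₁ k₂ k₃₁ k₃₂) w u ω' Q' → ω' = ω ∧ Q' = Q) ∧
          (∀ ε : ℝ, 0 < ε ^ 2 → ε ^ 2 < 1 / (f * n) →
            Summable (fun m => ε ^ m * ω m) ∧
            Summable (fun m => |ε| ^ (m + 1) * perNorm (Q m)) ∧
            ∃ q : ℝ → Fin (2 * n) → ℝ,
              IsEvenPeriodicSolution (chainMatrix n k₁ k₂ k₃₁ k₃₂) (∑' m, ε ^ m * ω m) q ∧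
              Filter.Tendsto
                (fun M : ℕ => perNorm (fun τ =>
                  (∑ m ∈ Finset.range M, ε ^ (m + 1) • Q m τ) - q τ))
                Filter.atTop (nhds 0)) ∧
          ENNReal.ofReal (1 / Real.sqrt (f * n)) ≤
            (FormalMultilinearSeries.ofScalars ℝ ω).radius ∧
          ENNReal.ofReal (1 / Real.sqrt (f * n)) ≤
            (FormalMultilinearSeries.ofScalars ℝ (fun m => perNorm (Q m))).radius := by
  subst hf
  obtain ⟨C, N₁, hC, hN₁, hmode⟩ := lowestOpticalMode_estimates hk₁ hk₂ hδ
  obtain ⟨N₂, hexp⟩ := exists_modeExpansion hk₁ hk₂ hC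
  refine ⟨N₁ + N₂, ?_⟩
  intro n hn k₃₁ k₃₂ h1 h2 _ h5 h6 hband
  have hn1 : 1 ≤ n := by omega
  -- The absence of frequencies above the band is used only through these two upper bounds on the
  -- wall springs.
  have h3 := hband.left_le hn1
  have h4 := hband.right_le hn1
  obtain ⟨hex, hest⟩ := hmode n (by omega) k₃₁ k₃₂ h1 h2 h3 h4 h5 h6
  refine ⟨hex, fun w u hu => ?_⟩
  obtain ⟨φ, hφ0, hφn, hw, hue, hul⟩ := hest w u hu
  obtain ⟨ω, Q, hform, hconv⟩ := hexp n (by omega) k₃₁ k₃₂ h1 h2 h3 h4 w φ u hu.1 hφ0 hφn hw hue hul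
  have hsq : ∀ r : ℝ, 0 < r → r < 1 / √(40 * (k₂ - k₁) / (k₁ * k₂) * n) →
      r ^ 2 < 1 / (40 * (k₂ - k₁) / (k₁ * k₂) * n) := by
    intro r hr0 hr
    have hpos : 0 ≤ 40 * (k₂ - k₁) / (k₁ * k₂) * n := by
      have := sub_pos.2 hk₂
      have := hk₁.trans hk₂
      positivity
    have := pow_lt_pow_left₀ hr hr0.le two_ne_zero
    rwa [div_pow, one_pow, Real.sq_sqrt hpos] at this
  refine ⟨ω, Q, hform, fun ω' Q' h' => ?_, fun ε _ hε => hconv ε hε, ?_, ?_⟩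
  · refine hform.unique chainMatrix_isSymm hu.1.pos hu.1.ne_zero hu.1.eigen
      (fun v hv => exists_smul_of_mem_ker hk₁ hk₂ hu.1.smul_add_eq hu.1.ne_zero hv)
      (fun k hk v hv => ?_) h'
    have b := norm_le_of_higher_harmonic hn1 hk₁ hk₂ h1 h2 h3 h4 hu.1.lower hk hv
    have hk₂' := hk₁.trans hk₂
    have : 0 < 3 / 4 * k₂ * (k : ℝ) ^ 2 := by positivity
    rw [norm_zero] at b
    by_contra hv0
    have := mul_pos this (norm_pos_iff.2 hv0)
    linarith
  · exact le_radius_of_forall_summable fun r hr0 hr => (hconv r (hsq r hr0 hr)).1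
  · refine le_radius_of_forall_summable fun r hr0 hr => ?_
    -- The factor `r⁻¹` undoes the shift `ε ^ (m + 1)` of the state series.
    have := (hconv r (hsq r hr0 hr)).2.1.mul_left r⁻¹
    refine this.congr fun m => ?_
    rw [abs_of_pos hr0, pow_succ]
    field_simp
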